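/- Let $\mathbf F_q$ be a finite field with $q$ elements and algebraic closure $\bar{\mathbf F}_q$, and let $\mathcal X$ be a projective, irreducible, non-singular algebraic curve over $\bar{\mathbf F}_q$ of genus $g$ that is defined over $\mathbf F_q$, i.e. $\mathcal X\subseteq\mathbf P^n(\bar{\mathbf F}_q)$ for some $n$ and the homogeneous ideal of $\mathcal X$ is generated by polynomials with coefficients in $\mathbf F_q$. Let $\Phi_q:\mathcal X\to\mathcal X$ be the Frobenius morphism relative to $\mathbf F_q$, which raises homogeneous coordinates to the $q$-th power; let $\mathcal X(\mathbf F_q)$ be the set of points of $\mathcal X$ with homogeneous coordinates in $\mathbf F_q$, and $\mathbf F_q(\mathcal X)\subseteq\bar{\mathbf F}_q(\mathcal X)$ the field of rational functions defined over $\mathbf F_q$. Let $r\ge 1$ and let $\mathcal D$ be a base-point-free linear series on $\mathcal X$ of dimension $r$ and degree $d$ (a $g^r_d$), that is, $\mathcal D=\{E+\operatorname{div}(f): 0\ne f\in\mathcal D'\}$ for a divisor $E$ of degree $d$ and an $(r+1)$-dimensional $\bar{\mathbf F}_q$-subspace $\mathcal D'$ of $L(E)=\{f: f=0 \text{ or }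 E+\operatorname{div}(f)\ge 0\}$, and no point of $\mathcal X$ lies in the support of all $D\in\mathcal D$. Assume that $\mathcal D$ is defined over $\mathbf F_q$, i.e. $\sum_P n_P\Phi_q(P)\in\mathcal D$ whenever $\sum_P n_PP\in\mathcal D$. Let $\nu_0<\dots<\nu_{r-1}$ be the $\mathbf F_q$-Frobenius orders of $\mathcal D$, defined as follows. Choose $E$ and $\mathcal D'$ such that $\mathcal D'$ has a basis $f_0,\dots,f_r$ with all $f_j\in\mathbf F_q(\mathcal X)$, and choose a separating variable $x$ of $\bar{\mathbf F}_q(\mathcal X)\,|\,\bar{\mathbf F}_q$; let $D^i_x$ denote the $i$-th Hasse derivative on $\bar{\mathbf F}_q(\mathcal X)$ with respect to $x$. Then $(\nu_0,\dots,\nu_{r-1})$ is the lexicographically smallest tuple of integers $0\le m_0<\dots<m_{r-1}$ for which $$\det\begin{pmatrix} f_0\circ\Phi_q&\cdots&f_r\circ\Phi_q\\ D^{m_0}_xf_0&\cdots&D^{m_0}_xf_r\\ \vdots&&\vdots\\ D^{m_{r-1}}_xf_0&\cdots&D^{m_{r-1}}_xf_r\end{pmatrix}\ne 0$$ (this does not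 depend on the choices of $E$, $f_0,\dots,f_r$ and $x$). Then $$\#\mathcal X(\mathbf F_q)\le\frac{\left(\sum_{i=0}^{r-1}\nu_i\right)(2g-2)+(q+r)d}{r}.$$ -/

import Mathlib

open scoped LinearAlgebra.Projectivization

namespace StohrVoloch

section Taylor

open scoped PowerSeries IntermediateField

variable (F : Type*) {K : Type*} [Field F] [Field K] [Algebra F K]

/-- `x` is a separating variable of `K | F`: it is transcendental over `F` and `K | F(x)` is a
separable algebraic extension. -/
structure IsSeparatingVariable (x : K) : Prop where
  transcendental : Transcendental F x
  separable : Algebra.IsSeparable F⟮x⟯ K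

/-- `η : K → K⟦T⟧`, `f ↦ ∑ Dⁱ(f) Tⁱ`, is the homomorphism of `F`-algebras that encodes the Hasse
derivatives with respect to `x`. Multiplicativity of `η` is the product rule, and the two conditions
say `D⁰ = id`, `D¹ x = 1` and `Dⁱ x = 0` for `i ≥ 2`. If `x` is a separating variable, these
properties determine `η`. -/
structure IsTaylorHom (x : K) (η : K →ₐ[F] K⟦X⟧) : Prop where
  constantCoeff : ∀ f, PowerSeries.constantCoeff (η f) = f
  apply_self : η x = PowerSeries.C x + PowerSeries.X

open Polynomial in
theorem exists_lift {A : Type*} [CommRing A] [Algebra F A] (I : Ideal A) [IsAdicComplete I A]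
    (x : K) (hx : IsSeparatingVariable F x) (s : K →ₐ[F] A ⧸ I) (a : A)
    (ha : Ideal.Quotient.mk I a = s x) :
    ∃ η : K →ₐ[F] A, (∀ f, Ideal.Quotient.mk I (η f) = s f) ∧ η x = a := by
  have := hx.separable
  let : Algebra F[X] F⟮x⟯ := (aeval (IntermediateField.AdjoinSimple.gen F x)).toAlgebra
  let : Algebra F[X] K := (aeval x).toAlgebra
  let : Algebra F[X] A := (aeval a).toAlgebra
  have : IsScalarTower F F[X] A := .of_algebraMap_eq fun c => by
    simp [RingHom.algebraMap_toAlgebra]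
  have : IsScalarTower F[X] F⟮x⟯ K := .of_algebraMap_eq fun p => by
    simp only [RingHom.algebraMap_toAlgebra]
    change aeval x p = F⟮x⟯.val (aeval _ p)
    rw [← aeval_algHom_apply]; simp
  have hinj : Function.Injective (algebraMap F[X] F⟮x⟯) := by
    have h1 : Function.Injective (algebraMap F[X] K) :=
      transcendental_iff_injective.mp hx.transcendental
    rw [IsScalarTower.algebraMap_eq F[X] F⟮x⟯ K, RingHom.coe_comp] at h1
    exact Function.Injective.of_comp h1
  have : FaithfulSMul F[X] F⟮x⟯ := (faithfulSMul_iff_algebraMap_injective _ _).mpr hinj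
  have : IsFractionRing F[X] F⟮x⟯ := by
    refine IsFractionRing.of_field _ _ fun z => ?_
    obtain ⟨p, q, h⟩ := (IntermediateField.mem_adjoin_simple_iff F (z : K)).mp z.2
    refine ⟨p, q, Subtype.ext ?_⟩
    have e : ∀ p : F[X], ((algebraMap F[X] F⟮x⟯ p : F⟮x⟯) : K) = aeval x p := fun p =>
      (IsScalarTower.algebraMap_apply F[X] F⟮x⟯ K p).symm
    simp [e, h]
  have : Algebra.FormallyEtale F[X] F⟮x⟯ := .of_isLocalization (nonZeroDivisors F[X])
  have : Algebra.FormallyEtale F⟮x⟯ K := .of_isSeparable _ _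
  have : Algebra.FormallyEtale F[X] K := .comp _ F⟮x⟯ _
  let s' : K →ₐ[F[X]] A ⧸ I :=
    { s.toRingHom with
      commutes' := fun p => by
        change s (aeval x p) = Ideal.Quotient.mkₐ F I (aeval a p)
        rw [← aeval_algHom_apply, ← aeval_algHom_apply]
        congr 2
        exact ha.symm }
  obtain ⟨g, hg⟩ := Algebra.FormallySmooth.exists_mkₐ_comp_eq_of_isAdicComplete (I := I) s'
  have : IsScalarTower F F[X] K := .of_algebraMap_eq fun c => by
    simp [RingHom.algebraMap_toAlgebra]
  refine ⟨g.restrictScalars F, fun f => congr($hg f), ?_⟩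
  have := g.commutes X
  simpa [RingHom.algebraMap_toAlgebra] using this

theorem exists_isTaylorHom (x : K) (hx : IsSeparatingVariable F x) :
    ∃ η : K →ₐ[F] K⟦X⟧, IsTaylorHom F x η := by
  let I : Ideal K⟦X⟧ := .span {PowerSeries.X}
  let s : K →ₐ[F] K⟦X⟧ ⧸ I :=
    (Ideal.Quotient.mkₐ F I).comp (Algebra.ofId K K⟦X⟧ |>.restrictScalars F)
  obtain ⟨η, h1, h2⟩ := exists_lift F I x hx s (PowerSeries.C x + PowerSeries.X) (by
    change Ideal.Quotient.mk I _ = Ideal.Quotient.mk I (PowerSeries.C x)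
    rw [Ideal.Quotient.eq]
    rw [add_sub_cancel_left]
    exact Ideal.mem_span_singleton_self _)
  refine ⟨η, ⟨fun f => ?_, h2⟩⟩
  have h : Ideal.Quotient.mk I (η f) = Ideal.Quotient.mk I (PowerSeries.C f) := h1 f
  rw [Ideal.Quotient.eq, Ideal.mem_span_singleton, PowerSeries.X_dvd_iff] at h
  simpa [sub_eq_zero] using h

/-- The `i`-th Hasse derivative `Dⁱₓ` on `K` with respect to the separating variable `x`. -/
noncomputable def hasseDeriv (x : K) (hx : IsSeparatingVariable F x) (i : ℕ) : K →ₗ[F] K :=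
  ((PowerSeries.coeff i).restrictScalars F : K⟦X⟧ →ₗ[F] K) ∘ₗ
    (exists_isTaylorHom F x hx).choose.toLinearMap

end Taylor

section Geometry

open MvPolynomial

variable {F : Type*} [Field F] {n : ℕ}
variable (I : Ideal (MvPolynomial (Fin (n + 1)) F)) [I.IsPrime]

/-- The quotient `G / H` of two polynomials in the fraction field of `F[x₀, …, xₙ] / I`. -/
noncomputable def frac (G H : MvPolynomial (Fin (n + 1)) F) :
    FractionRing (MvPolynomial (Fin (n + 1)) F ⧸ I) :=
  algebraMap _ _ (Ideal.Quotient.mk I G) / algebraMap _ _ (Ideal.Quotient.mk I H)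

variable {I}
theorem toFrac_ne_zero {H : MvPolynomial (Fin (n + 1)) F} (h : H ∉ I) :
    algebraMap _ (FractionRing (MvPolynomial (Fin (n + 1)) F ⧸ I)) (Ideal.Quotient.mk I H) ≠ 0 := by
  simpa [Ideal.Quotient.eq_zero_iff_mem] using h

theorem frac_add {G H G' H' : MvPolynomial (Fin (n + 1)) F} (h : H ∉ I) (h' : H' ∉ I) :
    frac I G H + frac I G' H' = frac I (G * H' + H * G') (H * H') := by
  simp only [frac, map_add, map_mul]
  exact div_add_div _ _ (toFrac_ne_zero h) (toFrac_ne_zero h')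

theorem frac_mul (G H G' H' : MvPolynomial (Fin (n + 1)) F) :
    frac I G H * frac I G' H' = frac I (G * G') (H * H') := by
  simp only [frac, map_mul]
  exact div_mul_div_comm _ _ _ _

theorem frac_C (c : F) : frac I (C c) 1 = algebraMap F _ c := by
  simp only [frac, map_one, div_one]
  rw [IsScalarTower.algebraMap_apply F (MvPolynomial (Fin (n + 1)) F ⧸ I)
    (FractionRing (MvPolynomial (Fin (n + 1)) F ⧸ I))]
  rfl

theorem one_notMem : (1 : MvPolynomial (Fin (n + 1)) F) ∉ I :=
  fun h => Ideal.IsPrime.ne_top' ((Ideal.eq_top_iff_one I).mpr h)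

variable (I)

/-- The function field of the projective variety in `ℙⁿ` with homogeneous prime ideal `I`: all
`G / H` with `G`, `H` homogeneous of the same degree and `H ∉ I`. -/
noncomputable def functionField : IntermediateField F (FractionRing (MvPolynomial (Fin (n + 1)) F ⧸ I)) where
  carrier := {z | ∃ d G H, G.IsHomogeneous d ∧ H.IsHomogeneous d ∧ H ∉ I ∧ z = frac I G H}
  mul_mem' := by
    rintro _ _ ⟨d, G, H, hG, hH, h, rfl⟩ ⟨d', G', H', hG', hH', h', rfl⟩
    exact ⟨d + d', G * G', H * H', hG.mul hG', hH.mul hH',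
      fun hm => (Ideal.IsPrime.mem_or_mem ‹_› hm).elim h h', frac_mul ..⟩
  add_mem' := by
    rintro _ _ ⟨d, G, H, hG, hH, h, rfl⟩ ⟨d', G', H', hG', hH', h', rfl⟩
    exact ⟨d + d', G * H' + H * G', H * H', (hG.mul hH').add (hH.mul hG'), hH.mul hH',
      fun hm => (Ideal.IsPrime.mem_or_mem ‹_› hm).elim h h', frac_add h h'⟩
  algebraMap_mem' c := ⟨0, C c, 1, isHomogeneous_C _ _, isHomogeneous_one _ _, one_notMem,
    (frac_C c).symm⟩
  inv_mem' := by
    rintro _ ⟨d, G, H, hG, hH, h, rfl⟩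
    by_cases hGI : G ∈ I
    · refine ⟨0, 0, 1, isHomogeneous_zero _ _ _, isHomogeneous_one _ _, one_notMem, ?_⟩
      simp [frac, Ideal.Quotient.eq_zero_iff_mem.mpr hGI]
    · exact ⟨d, H, G, hH, hG, hGI, by simp [frac]⟩

/-- The points of `ℙⁿ(F)` at which the homogeneous ideal `I` vanishes. -/
def zeroLocus : Set (ℙ F (Fin (n + 1) → F)) := {P | ∀ g ∈ I, eval P.rep g = 0}

/-- The local ring at `P` of the variety with ideal `I`: all `G / H` with `G`, `H` homogeneous of the
same degree and `H(P) ≠ 0`. -/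
noncomputable def localRing (P : zeroLocus I) : Subalgebra F (functionField I) where
  carrier := {z | ∃ d G H, G.IsHomogeneous d ∧ H.IsHomogeneous d ∧ eval P.1.rep H ≠ 0 ∧
    (z : FractionRing (MvPolynomial (Fin (n + 1)) F ⧸ I)) = frac I G H}
  mul_mem' := by
    rintro a b ⟨d, G, H, hG, hH, h, ha⟩ ⟨d', G', H', hG', hH', h', hb⟩
    exact ⟨d + d', G * G', H * H', hG.mul hG', hH.mul hH', by simp [h, h'],
      by rw [← frac_mul, ← ha, ← hb]; rfl⟩
  add_mem' := by
    rintro a b ⟨d, G, H, hG, hH, h, ha⟩ ⟨d', G', H', hG', hH', h', hb⟩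
    exact ⟨d + d', G * H' + H * G', H * H', (hG.mul hH').add (hH.mul hG'), hH.mul hH',
      by simp [h, h'], by
        rw [← frac_add (fun hm => h (P.2 _ hm)) (fun hm => h' (P.2 _ hm)), ← ha, ← hb]; rfl⟩
  algebraMap_mem' c := ⟨0, C c, 1, isHomogeneous_C _ _, isHomogeneous_one _ _, by simp,
    (frac_C c).symm⟩

instance (P : zeroLocus I) : IsFractionRing (localRing I P) (functionField I) := by
  have : FaithfulSMul (localRing I P) (functionField I) :=
    (faithfulSMul_iff_algebraMap_injective _ _).mpr Subtype.val_injective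
  refine IsFractionRing.of_field _ _ ?_
  rintro ⟨z, d, G, H, hG, hH, h, rfl⟩
  obtain ⟨i, hi⟩ : ∃ i, P.1.rep i ≠ 0 := by
    by_contra! hc
    exact P.1.rep_nonzero (funext hc)
  have hXd : (X i ^ d : MvPolynomial (Fin (n + 1)) F).IsHomogeneous d := by
    simpa using (isHomogeneous_X F i).pow d
  have hev : eval P.1.rep (X i ^ d) ≠ 0 := by simp [hi]
  have hXI : (X i ^ d : MvPolynomial (Fin (n + 1)) F) ∉ I := fun hm => hev (P.2 _ hm)
  refine ⟨⟨⟨frac I G (X i ^ d), ⟨d, G, _, hG, hXd, hXI, rfl⟩⟩, ⟨d, G, _, hG, hXd, hev, rfl⟩⟩,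
    ⟨⟨frac I H (X i ^ d), ⟨d, H, _, hH, hXd, hXI, rfl⟩⟩, ⟨d, H, _, hH, hXd, hev, rfl⟩⟩, ?_⟩
  apply Subtype.ext
  change frac I G H = frac I G (X i ^ d) / frac I H (X i ^ d)
  simp only [frac]
  exact (div_div_div_cancel_right₀ (toFrac_ne_zero hXI) _ _).symm

end Geometry

section Frobenius

open MvPolynomial

variable {k F : Type*} [Field k] [Field F] [Algebra k F] {n : ℕ}

/-- The extension to `F[x₀, …, xₙ]` of an ideal of `k[x₀, …, xₙ]`. -/
noncomputable abbrev extend (F : Type*) [Field F] [Algebra k F] (J : Ideal (MvPolynomial (Fin (n + 1)) k)) :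
    Ideal (MvPolynomial (Fin (n + 1)) F) :=
  J.map (MvPolynomial.map (algebraMap k F))

theorem eval_smul_of_isHomogeneous {g : MvPolynomial (Fin (n + 1)) F} {d : ℕ}
    (hg : g.IsHomogeneous d) (c : F) (v : Fin (n + 1) → F) :
    eval (c • v) g = c ^ d * eval v g := by
  rw [eval_eq, eval_eq, Finset.mul_sum]
  refine Finset.sum_congr rfl fun m hm => ?_
  have h : ∑ i ∈ m.support, m i = d := by
    simpa [Finsupp.weight_apply, Finsupp.sum] using hg (mem_support_iff.mp hm)
  simp only [Pi.smul_apply, smul_eq_mul, mul_pow, Finset.prod_mul_distrib, Finset.prod_pow_eq_pow_sum,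
    h]
  ring

variable [Fintype k]

theorem expand_map_frobenius (k : Type*) [Field k] [Fintype k] [Algebra k F]
    (h : MvPolynomial (Fin (n + 1)) F) :
    expand (Fintype.card k) (map (FiniteField.frobeniusAlgHom k F : F →+* F) h) =
      h ^ Fintype.card k := by
  have : ((expand (Fintype.card k) : MvPolynomial (Fin (n + 1)) F →ₐ[F] _) :
      MvPolynomial (Fin (n + 1)) F →+* MvPolynomial (Fin (n + 1)) F).comp
      (map (FiniteField.frobeniusAlgHom k F : F →+* F)) =
      ((FiniteField.frobeniusAlgHom k (MvPolynomial (Fin (n + 1)) F) :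
        MvPolynomial (Fin (n + 1)) F →+* MvPolynomial (Fin (n + 1)) F)) := by
    apply MvPolynomial.ringHom_ext <;> intro i <;> simp
  exact congr($this h)

theorem frobenius_comp_algebraMap (k F : Type*) [Field k] [Fintype k] [Field F] [Algebra k F] :
    (FiniteField.frobeniusAlgHom k F : F →+* F).comp (algebraMap k F) = algebraMap k F :=
  RingHom.ext fun c => (FiniteField.frobeniusAlgHom k F).commutes c

theorem expand_map_algebraMap (g : MvPolynomial (Fin (n + 1)) k) :
    expand (Fintype.card k) (map (algebraMap k F) g) = map (algebraMap k F) g ^ Fintype.card k := by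
  rw [← expand_map_frobenius k, map_map, frobenius_comp_algebraMap]

theorem map_frobenius_mem {J : Ideal (MvPolynomial (Fin (n + 1)) k)}
    {h : MvPolynomial (Fin (n + 1)) F} (hh : h ∈ extend F J) :
    map (FiniteField.frobeniusAlgHom k F : F →+* F) h ∈ extend F J := by
  have hle : extend F J ≤
      (extend F J).comap (map (FiniteField.frobeniusAlgHom k F : F →+* F)) := by
    refine Ideal.map_le_iff_le_comap.mpr fun g hg => ?_
    rw [Ideal.mem_comap, Ideal.mem_comap, map_map, frobenius_comp_algebraMap]
    exact Ideal.mem_map_of_mem _ hg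
  exact hle hh

theorem expand_mem {J : Ideal (MvPolynomial (Fin (n + 1)) k)} :
    extend F J ≤ (extend F J).comap
      (expand (Fintype.card k) : MvPolynomial (Fin (n + 1)) F →ₐ[F] _) := by
  refine Ideal.map_le_iff_le_comap.mpr fun g hg => ?_
  rw [Ideal.mem_comap, Ideal.mem_comap]
  exact expand_map_algebraMap (F := F) g ▸
    Ideal.pow_mem_of_mem _ (Ideal.mem_map_of_mem _ hg) _ Fintype.card_pos

theorem mem_of_expand_mem [Algebra.IsAlgebraic k F] {J : Ideal (MvPolynomial (Fin (n + 1)) k)}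
    [(extend F J).IsPrime] {h : MvPolynomial (Fin (n + 1)) F}
    (hh : expand (Fintype.card k) h ∈ extend F J) : h ∈ extend F J := by
  let e := FiniteField.frobeniusAlgEquivOfAlgebraic k F
  have he : map (FiniteField.frobeniusAlgHom k F : F →+* F)
      (map (e.symm : F →+* F) h) = h := by
    rw [map_map]
    have : (FiniteField.frobeniusAlgHom k F : F →+* F).comp (e.symm : F →+* F) = RingHom.id F :=
      RingHom.ext fun c => e.apply_symm_apply c
    rw [this, map_id]
  rw [← he] at hh ⊢
  rw [expand_map_frobenius] at hh
  exact map_frobenius_mem (Ideal.IsPrime.mem_of_pow_mem ‹_› _ hh)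

/-- The Frobenius map `v ↦ (vᵢ ^ q)ᵢ` on `Fⁿ⁺¹`, as a semilinear map. -/
def frobeniusVec (k F : Type*) [Field k] [Fintype k] [Field F] [Algebra k F] (n : ℕ) :
    (Fin (n + 1) → F) →ₛₗ[(FiniteField.frobeniusAlgHom k F : F →+* F)] (Fin (n + 1) → F) where
  toFun v i := v i ^ Fintype.card k
  map_add' _ _ := funext fun _ => map_add (FiniteField.frobeniusAlgHom k F) _ _
  map_smul' c v := funext fun i => map_mul (FiniteField.frobeniusAlgHom k F) c (v i)

theorem frobeniusVec_injective : Function.Injective (frobeniusVec k F n) := fun v w h =>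
  funext fun i => (FiniteField.frobeniusAlgHom k F : F →+* F).injective congr($h i)

/-- The Frobenius map `(a₀ : … : aₙ) ↦ (a₀ ^ q : … : aₙ ^ q)` of `ℙⁿ(F)`. -/
def frobeniusProj (k : Type*) {F : Type*} [Field k] [Fintype k] [Field F] [Algebra k F] {n : ℕ} :
    ℙ F (Fin (n + 1) → F) → ℙ F (Fin (n + 1) → F) :=
  Projectivization.map (frobeniusVec k F n) frobeniusVec_injective

theorem frobeniusProj_mem {J : Ideal (MvPolynomial (Fin (n + 1)) k)}
    (hJ : ∀ g ∈ J, ∀ d, homogeneousComponent d g ∈ J) {P : ℙ F (Fin (n + 1) → F)}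
    (hP : P ∈ zeroLocus (extend F J)) : frobeniusProj k P ∈ zeroLocus (extend F J) := by
  obtain ⟨a, ha⟩ := Projectivization.exists_smul_eq_mk_rep F (frobeniusVec k F n P.rep)
    (map_zero (frobeniusVec k F n) ▸ frobeniusVec_injective.ne P.rep_nonzero)
  have hrep : (frobeniusProj k P).rep = (a : F) • frobeniusVec k F n P.rep := by
    conv_lhs => rw [← P.mk_rep]
    exact ha.symm
  suffices hle : extend F J ≤ RingHom.ker (eval (frobeniusProj k P).rep) from
    fun g hg => hle hg
  refine Ideal.map_le_iff_le_comap.mpr fun g hg => ?_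
  rw [Ideal.mem_comap, RingHom.mem_ker, ← sum_homogeneousComponent g, map_sum, map_sum]
  refine Finset.sum_eq_zero fun d _ => ?_
  rw [hrep, eval_smul_of_isHomogeneous ((homogeneousComponent_isHomogeneous d g).map _)]
  have h0 := hP _ (Ideal.mem_map_of_mem (MvPolynomial.map (algebraMap k F)) (hJ g hg d))
  have h1 : eval (frobeniusVec k F n P.rep) (map (algebraMap k F) (homogeneousComponent d g)) =
      eval P.rep (map (algebraMap k F) (homogeneousComponent d g)) ^ Fintype.card k := by
    rw [← map_pow, ← expand_map_algebraMap, eval_expand]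
    rfl
  rw [h1, h0, zero_pow Fintype.card_ne_zero, mul_zero]

variable [Algebra.IsAlgebraic k F] (J : Ideal (MvPolynomial (Fin (n + 1)) k))
  [(extend F J).IsPrime]

/-- The endomorphism of the homogeneous coordinate ring that sends each `xᵢ` to `xᵢ ^ q` and is the
identity on `F`. -/
noncomputable def frobeniusCoord : (MvPolynomial (Fin (n + 1)) F ⧸ extend F J) →ₐ[F]
    (MvPolynomial (Fin (n + 1)) F ⧸ extend F J) :=
  Ideal.quotientMapₐ _ (expand (Fintype.card k)) expand_mem

theorem frobeniusCoord_injective : Function.Injective (frobeniusCoord (F := F) J) := by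
  rw [injective_iff_map_eq_zero]
  intro a
  obtain ⟨g, rfl⟩ := Ideal.Quotient.mk_surjective a
  intro h
  rw [Ideal.Quotient.eq_zero_iff_mem]
  refine mem_of_expand_mem ?_
  rw [← Ideal.Quotient.eq_zero_iff_mem]
  exact h

theorem algHom_comp_frobeniusCoord_injective : Function.Injective
    ((Algebra.algHom F (MvPolynomial (Fin (n + 1)) F ⧸ extend F J)
      (FractionRing (MvPolynomial (Fin (n + 1)) F ⧸ extend F J))).comp (frobeniusCoord J)) :=
  (IsFractionRing.injective (MvPolynomial (Fin (n + 1)) F ⧸ extend F J)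
    (FractionRing (MvPolynomial (Fin (n + 1)) F ⧸ extend F J))).comp (frobeniusCoord_injective J)

/-- The extension of `frobeniusCoord` to the fraction field. -/
noncomputable def frobeniusFrac :
    FractionRing (MvPolynomial (Fin (n + 1)) F ⧸ extend F J) →ₐ[F]
      FractionRing (MvPolynomial (Fin (n + 1)) F ⧸ extend F J) :=
  IsFractionRing.liftAlgHom (algHom_comp_frobeniusCoord_injective J)

theorem frobeniusFrac_frac (G H : MvPolynomial (Fin (n + 1)) F) :
    frobeniusFrac J (frac (extend F J) G H) =
      frac (extend F J) (expand (Fintype.card k) G) (expand (Fintype.card k) H) := by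
  have key : ∀ G : MvPolynomial (Fin (n + 1)) F, frobeniusFrac J
      (algebraMap _ (FractionRing (MvPolynomial (Fin (n + 1)) F ⧸ extend F J))
        (Ideal.Quotient.mk (extend F J) G)) =
      algebraMap _ _ (Ideal.Quotient.mk (extend F J) (expand (Fintype.card k) G)) := fun G =>
    IsFractionRing.lift_algebraMap (algHom_comp_frobeniusCoord_injective (F := F) J) _
  rw [frac, map_div₀, key, key, frac]

/-- Composition `f ↦ f ∘ Φ` of rational functions with the Frobenius morphism: it sends `G / H` to
`G(x₀ ^ q, …, xₙ ^ q) / H(x₀ ^ q, …, xₙ ^ q)`. -/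
noncomputable def frobeniusPullback :
    functionField (extend F J) →ₐ[F] functionField (extend F J) :=
  ((frobeniusFrac J).comp (functionField (extend F J)).val).codRestrict
    (functionField (extend F J)).toSubalgebra (by
      rintro ⟨_, d, G, H, hG, hH, h, rfl⟩
      have hom : ∀ {G : MvPolynomial (Fin (n + 1)) F}, G.IsHomogeneous d →
          (expand (Fintype.card k) G).IsHomogeneous (Fintype.card k * d) := fun hG =>
        hG.aeval _ fun i => by simpa using (isHomogeneous_X F i).pow (Fintype.card k)
      exact ⟨_, _, _, hom hG, hom hH, fun hm => h (mem_of_expand_mem hm), frobeniusFrac_frac J G H⟩)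

end Frobenius

section Curve

variable (k F : Type*) [Field k] [Field F] [Algebra k F] (n : ℕ)

/-- A projective, irreducible, non-singular curve in `ℙⁿ` over `F` that is defined over the subfield
`k`: it is given by a homogeneous ideal of `k[x₀, …, xₙ]` whose extension to `F[x₀, …, xₙ]` is prime,
its dimension (the transcendence degree of its function field over `F`) is one, and its local rings
at all points are regular, i.e. discrete valuation rings. -/
structure Curve where
  ideal : Ideal (MvPolynomial (Fin (n + 1)) k)
  homogeneous : ∀ g ∈ ideal, ∀ d, MvPolynomial.homogeneousComponent d g ∈ ideal
  [isPrime : (extend F ideal).IsPrime]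
  trdeg_eq_one : Algebra.trdeg F (functionField (extend F ideal)) = 1
  nonsingular : ∀ P : zeroLocus (extend F ideal),
    IsDiscreteValuationRing (localRing (extend F ideal) P)

namespace Curve

attribute [instance] Curve.isPrime

variable {k F n} (X : Curve k F n)

/-- The points of the curve, with coordinates in `F`. -/
abbrev Point : Type _ := zeroLocus (extend F X.ideal)

/-- The field `F(X)` of rational functions on the curve. -/
abbrev Func : Type _ := functionField (extend F X.ideal)

instance (P : X.Point) : IsDiscreteValuationRing (localRing (extend F X.ideal) P) :=
  X.nonsingular P

noncomputable section

/-- The valuation of `F(X)` with valuation ring the local ring at `P`, written multiplicatively. -/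
def valuation (P : X.Point) : Valuation X.Func (WithZero (Multiplicative ℤ)) :=
  (IsDiscreteValuationRing.maximalIdeal (localRing (extend F X.ideal) P)).valuation X.Func

/-- The order `v_P(f)` of a nonzero rational function `f` at `P` (its value at `f = 0` is
irrelevant). -/
def ord (P : X.Point) (f : X.Func) : ℤ := -WithZero.log (X.valuation P f)

/-- Divisors on the curve. -/
abbrev Div : Type _ := X.Point →₀ ℤ

/-- The degree of a divisor. -/
def degree (D : X.Div) : ℤ := D.sum fun _ m => m

theorem ord_iff (P : X.Point) (f : X.Func) (m : ℤ) :
    (f ≠ 0 → 0 ≤ m + X.ord P f) ↔ X.valuation P f ≤ WithZero.exp m := by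
  by_cases hf : f = 0
  · simp [hf]
  · have h0 : X.valuation P f ≠ 0 := (Valuation.ne_zero_iff _).mpr hf
    rw [← WithZero.log_le_iff_le_exp h0, ord]
    constructor
    · intro h
      linarith [h hf]
    · intro h _
      linarith

theorem valuation_algebraMap_le_one (P : X.Point) (c : F) :
    X.valuation P (algebraMap F X.Func c) ≤ 1 :=
  (IsDiscreteValuationRing.maximalIdeal (localRing (extend F X.ideal) P)).valuation_le_one
    (algebraMap F (localRing (extend F X.ideal) P) c)

/-- The space `L(D) = {f ≠ 0 : D + div f ≥ 0} ∪ {0}`. -/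
def riemannRochSpace (D : X.Div) : Submodule F X.Func where
  carrier := {f | f ≠ 0 → ∀ P, 0 ≤ D P + X.ord P f}
  zero_mem' h := (h rfl).elim
  add_mem' {f g} hf hg := by
    intro h P
    refine (X.ord_iff P _ _).mpr ((X.valuation P).map_add_le ?_ ?_) h
    · exact (X.ord_iff P _ _).mp fun h => hf h P
    · exact (X.ord_iff P _ _).mp fun h => hg h P
  smul_mem' c f hf := by
    intro h P
    refine (X.ord_iff P _ _).mpr ?_ h
    rw [Algebra.smul_def, map_mul]
    exact (mul_le_of_le_one_left' (X.valuation_algebraMap_le_one P c)).trans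
      ((X.ord_iff P _ _).mp fun h => hf h P)

/-- The genus of `X`: the largest value of `deg D + 1 - ℓ(D)` over all divisors `D`. -/
def genus : ℤ := ⨆ D : X.Div, (X.degree D + 1 - Module.finrank F (X.riemannRochSpace D))

/-- The set `X(k)` of the points that have homogeneous coordinates in `k`. -/
def rationalPoints : Set X.Point :=
  {P | ∃ (v : Fin (n + 1) → k) (hv : (fun i => algebraMap k F (v i)) ≠ 0),
    P.1 = Projectivization.mk F (fun i => algebraMap k F (v i)) hv}

theorem rationalPoints_finite [Finite k] : X.rationalPoints.Finite := by
  refine Set.Finite.of_injOn (f := Subtype.val)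
    (t := {Q | ∃ (v : Fin (n + 1) → k) (hv : (fun i => algebraMap k F (v i)) ≠ 0),
      Q = Projectivization.mk F (fun i => algebraMap k F (v i)) hv})
    (fun P hP => hP) Subtype.val_injective.injOn ?_
  let S := {v : Fin (n + 1) → k // (fun i => algebraMap k F (v i)) ≠ 0}
  refine (Set.finite_range fun v : S => Projectivization.mk F _ v.2).subset ?_
  rintro _ ⟨v, hv, rfl⟩
  exact ⟨⟨v, hv⟩, rfl⟩

/-- The field `k(X)`, as a subset of `F(X)`: the rational functions `G / H` with `G`, `H` homogeneous of
the same degree with coefficients in `k`. -/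
def rationalFunctions : Set X.Func :=
  {f | ∃ (d : ℕ) (G H : MvPolynomial (Fin (n + 1)) k), G.IsHomogeneous d ∧ H.IsHomogeneous d ∧
    MvPolynomial.map (algebraMap k F) H ∉ extend F X.ideal ∧
    (f : FractionRing (MvPolynomial (Fin (n + 1)) F ⧸ extend F X.ideal)) =
      frac (extend F X.ideal) (MvPolynomial.map (algebraMap k F) G)
        (MvPolynomial.map (algebraMap k F) H)}

/-- The set of divisors `E + div f` with `f` a nonzero element of `V`. -/
def linearSeries (E : X.Div) (V : Submodule F X.Func) : Set X.Div :=
  {D | ∃ f ∈ V, f ≠ 0 ∧ ∀ P, D P = E P + X.ord P f}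

/-- `𝒟` is a linear series of (projective) dimension `r` and degree `d`. -/
def IsLinearSeries (𝒟 : Set X.Div) (r : ℕ) (d : ℤ) : Prop :=
  ∃ (E : X.Div) (V : Submodule F X.Func), V ≤ X.riemannRochSpace E ∧ X.degree E = d ∧
    Module.finrank F V = r + 1 ∧ 𝒟 = X.linearSeries E V

/-- No point lies in the support of all the divisors in `𝒟`. -/
def BasePointFree (𝒟 : Set X.Div) : Prop := ∀ P, ∃ D ∈ 𝒟, D P = 0

section Frobenius

variable [Fintype k]

/-- The Frobenius morphism `Φ` of `X` relative to `k`, which raises homogeneous coordinates to the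
`q`-th power, where `q` is the number of elements of `k`. -/
def frobenius (P : X.Point) : X.Point := ⟨frobeniusProj k P.1, frobeniusProj_mem X.homogeneous P.2⟩

/-- `𝒟` is defined over `k`: it is stable under `Φ_* : ∑ n_P P ↦ ∑ n_P Φ(P)`. -/
def IsDefinedOver (𝒟 : Set X.Div) : Prop := ∀ D ∈ 𝒟, D.mapDomain X.frobenius ∈ 𝒟

variable [Algebra.IsAlgebraic k F]

/-- The matrix with first row `f₀ ∘ Φ, …, f_r ∘ Φ` and further rows `D^{m_i} f₀, …, D^{m_i} f_r` for
`i = 0, …, r - 1`, where `D` denotes the Hasse derivatives with respect to `x`. -/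
def frobeniusMatrix {r : ℕ} (x : X.Func) (hx : IsSeparatingVariable F x)
    (f : Fin (r + 1) → X.Func) (m : Fin r → ℕ) : Matrix (Fin (r + 1)) (Fin (r + 1)) X.Func :=
  Matrix.of (Fin.cons (fun j => frobeniusPullback X.ideal (f j))
    (fun i j => hasseDeriv F x hx (m i) (f j)))

/-- The set of all `m₀ < … < m_{r-1}` for which `frobeniusMatrix` has nonzero determinant, with the
lexicographic order. -/
def frobeniusOrderSet {r : ℕ} (x : X.Func) (hx : IsSeparatingVariable F x)
    (f : Fin (r + 1) → X.Func) : Set (Lex (Fin r → ℕ)) :=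
  {m | StrictMono (ofLex m) ∧ (X.frobeniusMatrix x hx f (ofLex m)).det ≠ 0}

/-- `ν₀, …, ν_{r-1}` are the Frobenius orders of `𝒟`: for a basis `f₀, …, f_r` in `k(X)` of the space of
functions that defines `𝒟`, and a separating variable `x`, the tuple `ν` is the lexicographic minimum
of `frobeniusOrderSet`. (It does not depend on the choice of `f` and `x`.) -/
def IsFrobeniusOrders (𝒟 : Set X.Div) {r : ℕ} (ν : Fin r → ℕ) : Prop :=
  ∃ (E : X.Div) (f : Fin (r + 1) → X.Func) (x : X.Func) (hx : IsSeparatingVariable F x),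
    (∀ j, f j ∈ X.rationalFunctions) ∧ LinearIndependent F f ∧
    Submodule.span F (Set.range f) ≤ X.riemannRochSpace E ∧
    𝒟 = X.linearSeries E (Submodule.span F (Set.range f)) ∧
    IsLeast (X.frobeniusOrderSet x hx f) (toLex ν)

end Frobenius

end

end Curve

end Curve

end StohrVoloch

open scoped WithZero IntermediateField

namespace StohrVoloch

open WithZero Polynomial

/-! ### Orders with respect to an integer-valued valuation -/

section Ord

variable {K : Type*} [Field K] (v : Valuation K ℤᵐ⁰)

/-! Let `Δ` be the determinant that belongs to the Frobenius orders and `W` the divisor of `dx`. The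
proof bounds the degree of `div Δ + (q + r) E + (∑ νᵢ) W`. Principal divisors have degree zero and
`deg W ≤ 2g - 2`, so this degree is at most `(∑ νᵢ)(2g - 2) + (q + r) d`. It remains to see that the
divisor is effective and has coefficient at least `r` at every rational point (`vOrd_minor_nonneg`,
`le_vOrd_minor`).

Local part. At a point `P`, divide all `f_j` by one of minimal order and replace `x` by a
uniformizer `t`. By the product and chain rules the derivative rows undergo a triangular
substitution. Lexicographic minimality of `ν` puts every row of order `m < ν_j` into the span of the
Frobenius row and the rows before `ν_j` (`mem_span_of_isLeast`), so only the diagonal of the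
substitution affects `Δ` (`IsTriangular.det_eq`). Hasse derivatives with respect to `t` preserve the
local ring (`taylor_regular`), hence the coefficient at `P` is nonnegative. At a rational point `t`
can be taken in `k(X)`, so that the Frobenius pullback `φ` sends `t` to `t ^ q` and `a = t ^ q - t`
has order one. By Taylor's formula `∑_{i ≤ m} aⁱ Dⁱ g` agrees with `φ g` to order `m + 1`
(`taylor_congr`), and the values `φ f_j = f_j ^ q` form the first row. So each derivative row may be
replaced by this difference divided by `a ^ (m + 1)`, which gains one order per row, `r` in all.

Global part. The genus is the supremum of `deg D + 1 - ℓ(D)`. Counting zeros by `[K : F(x)]` gives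
`degree_divisor` and Riemann's inequality. For `deg W ≤ 2g - 2` (`degree_canonical_le`), traces to
`F(x)` of products with a reduced basis embed `L(W + (x)_∞)` into a space of polynomials in `x` of
known dimension; comparison with the genus then bounds `deg W`.

All this is done for an abstract family of valuations, `IsPlaceSystem`; the points of the curve form
one by `Curve.isPlaceSystem`. -/

/-- `f` has order at least `m` with respect to `v`. -/
def OrdGE (m : ℤ) (f : K) : Prop := v f ≤ exp (-m)

/-- The order of `f` with respect to `v` (a junk value at `f = 0`). -/
noncomputable def vOrd (f : K) : ℤ := -log (v f)

variable {v}

theorem ordGE_iff {m : ℤ} {f : K} (hf : f ≠ 0) : OrdGE v m f ↔ m ≤ vOrd v f := by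
  rw [OrdGE, vOrd, ← log_le_iff_le_exp ((Valuation.ne_zero_iff v).mpr hf)]
  constructor <;> intro h <;> linarith

theorem exp_neg_vOrd {f : K} (hf : f ≠ 0) : v f = exp (-vOrd v f) := by
  rw [vOrd, neg_neg, exp_log ((Valuation.ne_zero_iff v).mpr hf)]

theorem vOrd_eq_of {m : ℤ} {f : K} (h : v f = exp (-m)) : vOrd v f = m := by
  rw [vOrd, h, log_exp, neg_neg]

theorem ne_zero_of_eq_exp {m : ℤ} {f : K} (h : v f = exp m) : f ≠ 0 := by
  rintro rfl
  rw [map_zero] at h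
  exact exp_ne_zero h.symm

theorem vOrd_mul {f g : K} (hf : f ≠ 0) (hg : g ≠ 0) : vOrd v (f * g) = vOrd v f + vOrd v g := by
  rw [vOrd, map_mul, log_mul ((Valuation.ne_zero_iff v).mpr hf) ((Valuation.ne_zero_iff v).mpr hg),
    vOrd, vOrd]
  ring

theorem vOrd_inv (f : K) : vOrd v f⁻¹ = -vOrd v f := by
  rw [vOrd, map_inv₀, log_inv, vOrd]

theorem vOrd_one : vOrd v 1 = 0 := by simp [vOrd]

theorem vOrd_neg (f : K) : vOrd v (-f) = vOrd v f := by simp [vOrd]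

theorem vOrd_div {f g : K} (hf : f ≠ 0) (hg : g ≠ 0) : vOrd v (f / g) = vOrd v f - vOrd v g := by
  rw [div_eq_mul_inv, vOrd_mul hf (inv_ne_zero hg), vOrd_inv, sub_eq_add_neg]

theorem vOrd_pow (f : K) (n : ℕ) : vOrd v (f ^ n) = n * vOrd v f := by
  simp [vOrd, log_pow]

theorem vOrd_zpow (f : K) (n : ℤ) : vOrd v (f ^ n) = n * vOrd v f := by
  simp [vOrd, log_zpow]

namespace OrdGE

theorem zero (m : ℤ) : OrdGE v m (0 : K) := by simp [OrdGE]

theorem self (f : K) : OrdGE v (vOrd v f) f := by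
  by_cases hf : f = 0
  · exact hf ▸ zero _
  · exact (ordGE_iff hf).mpr le_rfl

theorem mono {m n : ℤ} {f : K} (h : OrdGE v m f) (hnm : n ≤ m) : OrdGE v n f :=
  h.trans (exp_le_exp.mpr (neg_le_neg hnm))

theorem add {m : ℤ} {f g : K} (hf : OrdGE v m f) (hg : OrdGE v m g) : OrdGE v m (f + g) :=
  v.map_add_le hf hg

theorem neg {m : ℤ} {f : K} (hf : OrdGE v m f) : OrdGE v m (-f) := by
  rwa [OrdGE, Valuation.map_neg]

theorem sub {m : ℤ} {f g : K} (hf : OrdGE v m f) (hg : OrdGE v m g) : OrdGE v m (f - g) :=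
  v.map_sub_le hf hg

theorem mul {m n : ℤ} {f g : K} (hf : OrdGE v m f) (hg : OrdGE v n g) : OrdGE v (m + n) (f * g) := by
  rw [OrdGE, map_mul, neg_add, exp_add]
  exact mul_le_mul' hf hg

theorem one : OrdGE v 0 (1 : K) := by simp [OrdGE]

theorem pow {m : ℤ} {f : K} (hf : OrdGE v m f) (n : ℕ) : OrdGE v (n * m) (f ^ n) := by
  induction n with
  | zero => simpa using one
  | succ n ih => rw [pow_succ]; exact (ih.mul hf).mono (by push_cast; linarith)

theorem sum {α : Type*} {s : Finset α} {m : ℤ} {f : α → K} (h : ∀ i ∈ s, OrdGE v m (f i)) :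
    OrdGE v m (∑ i ∈ s, f i) := v.map_sum_le h

theorem mul_left {m : ℤ} {f g : K} (hf : OrdGE v 0 f) (hg : OrdGE v m g) : OrdGE v m (f * g) := by
  simpa using hf.mul hg

theorem mul_right {m : ℤ} {f g : K} (hf : OrdGE v m f) (hg : OrdGE v 0 g) : OrdGE v m (f * g) := by
  simpa using hf.mul hg

theorem prod {α : Type*} {s : Finset α} {f : α → K} (h : ∀ i ∈ s, OrdGE v 0 (f i)) :
    OrdGE v 0 (∏ i ∈ s, f i) := by
  induction s using Finset.cons_induction with
  | empty => simpa using one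
  | cons a s ha ih =>
    rw [Finset.prod_cons]
    exact (h a (by simp)).mul_left (ih fun i hi => h i (by simp [hi]))

theorem eq_zero_of_forall {f : K} (h : ∀ m : ℕ, OrdGE v m f) : f = 0 := by
  by_contra hf
  have := (ordGE_iff hf).mp (h ((vOrd v f).toNat + 1))
  push_cast at this
  have := Int.self_le_toNat (vOrd v f)
  omega

theorem mul_iff {m : ℤ} {f g : K} (hf : f ≠ 0) :
    OrdGE v m (f * g) ↔ OrdGE v (m - vOrd v f) g := by
  by_cases hg : g = 0
  · simp [hg, zero]
  · rw [ordGE_iff (mul_ne_zero hf hg), ordGE_iff hg, vOrd_mul hf hg]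
    constructor <;> intro h <;> linarith

theorem div {m : ℤ} {f g : K} (hf : OrdGE v m f) (hg : g ≠ 0) :
    OrdGE v (m - vOrd v g) (f / g) := by
  rw [← mul_iff hg, mul_div_cancel₀ _ hg]; exact hf

end OrdGE

theorem ordGE_zero_iff {f : K} : OrdGE v 0 f ↔ v f ≤ 1 := by simp [OrdGE]

theorem ordGE_one_iff {f : K} : OrdGE v 1 f ↔ v f < 1 := by
  by_cases hf : f = 0
  · simp [hf, OrdGE]
  · rw [OrdGE, exp_neg_vOrd hf, ← exp_zero, exp_le_exp, exp_lt_exp]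
    constructor <;> intro h <;> linarith

theorem eq_exp_neg_iff {m : ℤ} {f : K} :
    v f = exp (-m) ↔ OrdGE v m f ∧ ¬ OrdGE v (m + 1) f := by
  by_cases hf : f = 0
  · simp [hf, OrdGE, exp_ne_zero.symm]
  · rw [ordGE_iff hf, ordGE_iff hf, exp_neg_vOrd hf, exp_inj]
    constructor
    · intro h; constructor <;> linarith
    · intro h; linarith

theorem ordGE_det {n : ℕ} (M : Matrix (Fin n) (Fin n) K) (h : ∀ i j, OrdGE v 0 (M i j)) :
    OrdGE v 0 M.det := by
  rw [Matrix.det_apply]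
  refine OrdGE.sum fun σ _ => ?_
  rcases Int.units_eq_one_or (Equiv.Perm.sign σ) with hs | hs <;> rw [hs]
  · simpa using OrdGE.prod fun i _ => h _ _
  · simpa using (OrdGE.prod fun i _ => h _ _).neg

end Ord
/-! ### Systems of places -/

/-- The properties of the family of valuations that belong to the points of a complete nonsingular
curve over `F` with function field `K`. -/
structure IsPlaceSystem (F : Type*) {K ι : Type*} [Field F] [Field K] [Algebra F K]
    (v : ι → Valuation K ℤᵐ⁰) : Prop where
  const : ∀ P (c : F), OrdGE (v P) 0 (algebraMap F K c)
  residue : ∀ P f, OrdGE (v P) 0 f → ∃ c : F, OrdGE (v P) 1 (f - algebraMap F K c)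
  uniformizer : ∀ P, ∃ t, v P t = exp (-1)
  separate : ∀ (S : Finset ι), ∀ P ∈ S, ∃ e, v P e = 1 ∧ ∀ Q ∈ S, Q ≠ P → OrdGE (v Q) 1 e
  mem_range : ∀ f, (∀ P, OrdGE (v P) 0 f) → f ∈ Set.range (algebraMap F K)
  finite : ∀ x : K, Transcendental F x → FiniteDimensional F⟮x⟯ K
  -- One finite set serves all places. Derivations and Taylor homomorphisms are controlled by their
  -- values on it, so their poles on a local ring are bounded.
  generators : ∃ T : Finset K, ∀ P f, OrdGE (v P) 0 f →
    ∃ a ∈ Algebra.adjoin F {u | u ∈ T ∧ OrdGE (v P) 0 u},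
    ∃ b ∈ Algebra.adjoin F {u | u ∈ T ∧ OrdGE (v P) 0 u}, v P b = 1 ∧ f = a / b

namespace IsPlaceSystem

variable {F K ι : Type*} [Field F] [Field K] [Algebra F K] {v : ι → Valuation K ℤᵐ⁰}
  (h : IsPlaceSystem F v)

include h

theorem const_eq_one (P : ι) {c : F} (hc : c ≠ 0) : v P (algebraMap F K c) = 1 := by
  refine le_antisymm (ordGE_zero_iff.mp (h.const P c)) ?_
  have h2 := ordGE_zero_iff.mp (h.const P c⁻¹)
  have h3 : v P (algebraMap F K c) * v P (algebraMap F K c⁻¹) = 1 := by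
    rw [← map_mul, ← map_mul, mul_inv_cancel₀ hc, map_one, map_one]
  calc 1 = v P (algebraMap F K c) * v P (algebraMap F K c⁻¹) := h3.symm
    _ ≤ v P (algebraMap F K c) * 1 := by gcongr
    _ = _ := mul_one _

theorem const_eq_zero (P : ι) {c : F} (hc : OrdGE (v P) 1 (algebraMap F K c)) : c = 0 := by
  by_contra h0
  have := ordGE_one_iff.mp hc
  rw [h.const_eq_one P h0] at this
  exact lt_irrefl _ this

theorem vOrd_const (P : ι) {c : F} (hc : c ≠ 0) : vOrd (v P) (algebraMap F K c) = 0 :=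
  vOrd_eq_of (by simpa using h.const_eq_one P hc)

theorem aeval_regular (P : ι) {y : K} (hy : OrdGE (v P) 0 y) (p : F[X]) : OrdGE (v P) 0 (aeval y p) := by
  rw [aeval_eq_sum_range]
  refine OrdGE.sum fun i _ => ?_
  rw [Algebra.smul_def]
  exact (h.const P _).mul_left (by simpa using hy.pow i)

theorem aeval_sub (P : ι) {y : K} (hy : OrdGE (v P) 0 y) (p : F[X]) (c : F) {m : ℤ}
    (hc : OrdGE (v P) m (y - algebraMap F K c)) :
    OrdGE (v P) m (aeval y p - algebraMap F K (p.eval c)) := by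
  obtain ⟨r, hr⟩ := X_sub_C_dvd_sub_C_eval (p := p) (a := c)
  have : aeval y p - algebraMap F K (p.eval c) =
      (y - algebraMap F K c) * aeval y r := by
    have := congr(aeval y $hr)
    simpa using this
  rw [this]
  exact hc.mul_right (h.aeval_regular P hy r)

theorem aeval_sub_coeff (P : ι) {s : K} (hs : OrdGE (v P) 0 s) (p : F[X]) :
    OrdGE (v P) (vOrd (v P) s) (aeval s p - algebraMap F K (p.coeff 0)) := by
  rw [coeff_zero_eq_eval_zero]
  refine h.aeval_sub P hs p 0 ?_
  simpa using OrdGE.self s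

/-- The order of `p(s)` at a zero of `s`, for `p(0) ≠ 0`. -/
theorem aeval_unit (P : ι) {s : K} (hs : OrdGE (v P) 1 s) {p : F[X]} (hp : p.coeff 0 ≠ 0) :
    v P (aeval s p) = 1 := by
  have h1 := h.aeval_sub P (hs.mono (by norm_num)) p 0 (m := 1) (by simpa using hs)
  rw [← coeff_zero_eq_eval_zero] at h1
  have h2 := h.const_eq_one P hp
  have h3 : v P (aeval s p - algebraMap F K (p.coeff 0)) <
      v P (algebraMap F K (p.coeff 0)) := by rw [h2]; exact ordGE_one_iff.mp h1
  have := Valuation.map_add_eq_of_lt_left (v P) h3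
  simpa [h2] using this

/-- If `e` is near `1` at `P` and vanishes at the other places, then `1 - (1 - e ^ N) ^ N` is near
`1` to order `N` at `P`, because `1 - e ^ N` vanishes there, and is divisible by `e ^ N` elsewhere.
-/
theorem exists_approx_one (S : Finset ι) {P : ι} (hP : P ∈ S) (N : ℕ) :
    ∃ e, OrdGE (v P) N (e - 1) ∧ ∀ Q ∈ S, Q ≠ P → OrdGE (v Q) N e := by
  obtain ⟨e0, h0, h1⟩ := h.separate S P hP
  obtain ⟨c, hc⟩ := h.residue P e0 (ordGE_zero_iff.mpr h0.le)
  have hc0 : c ≠ 0 := by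
    rintro rfl
    rw [map_zero, sub_zero, ordGE_one_iff, h0] at hc
    exact lt_irrefl _ hc
  have hcK : algebraMap F K c ≠ 0 := by simpa using hc0
  set e := e0 / algebraMap F K c with he
  have hQ : ∀ Q ∈ S, Q ≠ P → OrdGE (v Q) 1 e := fun Q hQ hne => by
    have := (h1 Q hQ hne).div hcK
    rwa [h.vOrd_const Q hc0, sub_zero] at this
  have hPe : OrdGE (v P) 1 (1 - e) := by
    have := (hc.div hcK).neg
    rw [h.vOrd_const P hc0, sub_zero] at this
    convert this using 1
    rw [he]; field_simp; ring
  have hPe0 : OrdGE (v P) 0 e := by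
    have := OrdGE.one.sub (hPe.mono zero_le_one)
    simpa using this
  have geom : ∀ (u : K) (n : ℕ), 1 - u ^ n = (1 - u) * ∑ i ∈ Finset.range n, u ^ i :=
    fun u n => (mul_neg_geom_sum u n).symm
  refine ⟨1 - (1 - e ^ N) ^ N, ?_, fun Q hQ' hne => ?_⟩
  · have : OrdGE (v P) 1 (1 - e ^ N) := by
      rw [geom]
      exact hPe.mul_right (OrdGE.sum fun i _ => by simpa using hPe0.pow i)
    simpa using (this.pow N).neg
  · have h2 : OrdGE (v Q) N (e ^ N) := by simpa using (hQ Q hQ' hne).pow N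
    rw [geom, sub_sub_cancel]
    refine h2.mul_right (OrdGE.sum fun i _ => ?_)
    have : OrdGE (v Q) 0 (1 - e ^ N) := OrdGE.one.sub (h2.mono (by simp))
    simpa using this.pow i

/-- Weak approximation. -/
theorem exists_approx (S : Finset ι) (z : ι → K) (N : ℤ) :
    ∃ y, ∀ P ∈ S, OrdGE (v P) N (y - z P) := by
  classical
  -- The approximate idempotent of `P` must outweigh the poles of `z P` at every place of `S`, not
  -- only at `P`.
  obtain ⟨M, hM⟩ : ∃ M : ℕ, ∀ P ∈ S, ∀ Q ∈ S, N ≤ vOrd (v Q) (z P) + M := by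
    refine ⟨∑ P ∈ S, ∑ Q ∈ S, (N - vOrd (v Q) (z P)).toNat, fun P hP Q hQ => ?_⟩
    have h1 : (N - vOrd (v Q) (z P)).toNat ≤ ∑ Q ∈ S, (N - vOrd (v Q) (z P)).toNat :=
      Finset.single_le_sum (f := fun Q => (N - vOrd (v Q) (z P)).toNat) (by simp) hQ
    have h2 := Finset.single_le_sum (f := fun P => ∑ Q ∈ S, (N - vOrd (v Q) (z P)).toNat)
      (by simp) hP
    have := h1.trans h2
    omega
  choose e he1 he2 using fun P : S => h.exists_approx_one S P.2 M
  refine ⟨∑ P : S, z P * e P, fun Q hQ => ?_⟩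
  have : ∑ P : S, z P * e P - z Q = ∑ P : S, if P.1 = Q then z P * (e P - 1) else z P * e P := by
    have : ∀ P : S, (if P.1 = Q then z P * (e P - 1) else z P * e P) =
        z P * e P - (if P = ⟨Q, hQ⟩ then z Q else 0) := by
      rintro ⟨P, hP⟩
      by_cases hPQ : P = Q
      · subst hPQ; simp [mul_sub]
      · simp [hPQ]
    simp [this]
  rw [this]
  refine OrdGE.sum fun P _ => ?_
  split_ifs with hPQ
  · subst hPQ
    exact ((OrdGE.self _).mul (he1 P)).mono (hM _ P.2 _ P.2)
  · exact ((OrdGE.self _).mul (he2 P Q hQ (Ne.symm hPQ))).mono (hM _ P.2 _ hQ)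

/-- There is a function with distinct values at the points of a finite set, and simple there. -/
theorem exists_parameter [Infinite F] (S : Finset ι) :
    ∃ (y : K) (c : ι → F), Set.InjOn c S ∧ ∀ P ∈ S, v P (y - algebraMap F K (c P)) = exp (-1) := by
  classical
  choose t ht using h.uniformizer
  let c : ι → F := fun P => if hP : P ∈ S then Infinite.natEmbedding F (S.equivFin ⟨P, hP⟩) else 0
  have hc : Set.InjOn c S := by
    intro P hP Q hQ hPQ
    have hP' : P ∈ S := hP
    have hQ' : Q ∈ S := hQ
    simp only [c, hP', hQ', dite_true] at hPQ
    have := (Infinite.natEmbedding F).injective hPQ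
    simpa using S.equivFin.injective (Fin.ext this)
  -- Agreement to order 2 leaves `y - c P` with the order of `t P`, which is one.
  obtain ⟨y, hy⟩ := h.exists_approx S (fun P => algebraMap F K (c P) + t P) 2
  refine ⟨y, c, hc, fun P hP => ?_⟩
  have h1 : v P (y - (algebraMap F K (c P) + t P)) < v P (t P) := by
    refine (hy P hP).trans_lt ?_
    rw [ht, exp_lt_exp]; norm_num
  have := Valuation.map_add_eq_of_lt_left (v P) h1
  rw [ht] at this
  rw [← this]; congr 1; ring

/-- Split off the full power of `X - c` from `p`: the cofactor takes a unit value at `y`, so the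
order of `p(y)` is the multiplicity of the root `c`. -/
theorem X_sub_C_pow_dvd (P : ι) {y : K} {c : F} (hy : v P (y - algebraMap F K c) = exp (-1))
    {p : F[X]} {e : ℕ} (hp : OrdGE (v P) e (aeval y p)) : (X - C c) ^ e ∣ p := by
  by_cases hp0 : p = 0
  · simp [hp0]
  obtain ⟨p1, h1, h2⟩ := exists_eq_pow_rootMultiplicity_mul_and_not_dvd p hp0 c
  rw [← le_rootMultiplicity_iff hp0]
  have hy1 : OrdGE (v P) 1 (y - algebraMap F K c) := hy.le
  have hu : v P (aeval y p1) = 1 := by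
    have := h.aeval_unit P hy1 (p := p1.comp (X + C c)) (by
      rw [coeff_zero_eq_eval_zero]
      simpa [dvd_iff_isRoot] using h2)
    rwa [aeval_comp, map_add, aeval_X, aeval_C, sub_add_cancel] at this
  have hval : v P (aeval y p) = exp (-(p.rootMultiplicity c : ℤ)) := by
    conv_lhs => rw [h1]
    rw [map_mul, map_mul, hu, mul_one, map_pow, map_pow, map_sub, aeval_X, aeval_C, hy, ← exp_nsmul]
    simp
  rw [OrdGE, hval, exp_le_exp] at hp
  omega

/-- A relation between the powers of `y` modulo `s` is trivial modulo `s`. -/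
theorem coeff_zero_eq_zero (S : Finset ι) {y s : K} {c : ι → F} (hc : Set.InjOn c S)
    (hy : ∀ P ∈ S, v P (y - algebraMap F K (c P)) = exp (-1)) {e : ι → ℕ}
    (hs : ∀ P ∈ S, OrdGE (v P) 0 s) (he : ∀ P ∈ S, vOrd (v P) s = e P) {N : ℕ}
    (hN : N ≤ ∑ P ∈ S, e P) (r : Fin N → F[X])
    (hr : ∀ P ∈ S, OrdGE (v P) (e P) (∑ i, aeval s (r i) * y ^ (i : ℕ))) (i : Fin N) :
    (r i).coeff 0 = 0 := by
  -- Modulo `s` only the constant terms survive. They form a polynomial of degree less than `N` that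
  -- is divisible by the coprime factors `(X - c_P) ^ e_P`, whose degrees add up to at least `N`.
  set p : F[X] := ∑ i : Fin N, C ((r i).coeff 0) * X ^ (i : ℕ) with hp
  have hpy : ∀ P ∈ S, OrdGE (v P) (e P) (aeval y p) := by
    intro P hP
    have hy0 : OrdGE (v P) 0 y := by
      have : OrdGE (v P) 0 (y - algebraMap F K (c P)) :=
        OrdGE.mono (m := 1) (hy P hP).le zero_le_one
      simpa using this.add (h.const P (c P))
    have : aeval y p = ∑ i, aeval s (r i) * y ^ (i : ℕ) -
        ∑ i, (aeval s (r i) - algebraMap F K ((r i).coeff 0)) * y ^ (i : ℕ) := by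
      simp [hp, sub_mul]
    rw [this]
    refine (hr P hP).sub (OrdGE.sum fun i _ => ?_)
    rw [← he P hP]
    exact (h.aeval_sub_coeff P (hs P hP) _).mul_right (by simpa using hy0.pow (i : ℕ))
  have hdvd : ∏ P ∈ S, (X - C (c P)) ^ e P ∣ p := by
    refine Finset.prod_dvd_of_coprime (fun P hP Q hQ hne => ?_) fun P hP =>
      h.X_sub_C_pow_dvd P (hy P hP) (hpy P hP)
    exact (isCoprime_X_sub_C_of_isUnit_sub
      (sub_ne_zero.mpr fun heq => hne (hc hP hQ heq)).isUnit).pow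
  have hdeg : p.degree < N := by
    rw [hp]
    simpa only [← C_mul_X_pow_eq_monomial, ← Fin.sum_univ_eq_sum_range] using
      (degree_sum_fin_lt fun i : Fin N => (r i).coeff 0)
  have hp0 : p = 0 := by
    refine eq_zero_of_dvd_of_degree_lt hdvd (hdeg.trans_le ?_)
    rw [degree_prod]
    simp only [degree_pow, degree_X_sub_C, nsmul_eq_mul, mul_one]
    exact_mod_cast hN
  have := congr(coeff $hp0 (i : ℕ))
  rw [hp, finsetSum_coeff] at this
  simpa [coeff_C_mul, coeff_X_pow, Fin.val_inj] using this

end IsPlaceSystem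

/-! ### Primitive relations over a rational function field -/

section Adjoin

variable {F K : Type*} [Field F] [Field K] [Algebra F K]

/-- Clear denominators and divide by the gcd. The nonzero constant term is what keeps a relation
over `F(s)` nontrivial after reduction modulo `s`. -/
theorem exists_primitive_multiple {s : K} (hs : Transcendental F s) {N : ℕ} (a : Fin N → F⟮s⟯)
    (ha : a ≠ 0) : ∃ (u : F⟮s⟯) (r : Fin N → F[X]), u ≠ 0 ∧
      (∀ i, ((u * a i : F⟮s⟯) : K) = aeval s (r i)) ∧ ∃ i, (r i).coeff 0 ≠ 0 := by
  classical
  choose p d hpd using fun i => (IntermediateField.mem_adjoin_simple_iff F (a i : K)).mp (a i).2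
  have hinj : ∀ f : F[X], aeval s f = 0 → f = 0 := fun f hf =>
    by_contra fun hne => hs ⟨f, hne, hf⟩
  -- The fraction `p / d` is allowed to have `d = 0` and then has value `0`; it is rewritten as `0 /
  -- 1`.
  let d' : Fin N → F[X] := fun i => if d i = 0 then 1 else d i
  let p' : Fin N → F[X] := fun i => if d i = 0 then 0 else p i
  have hd' : ∀ i, d' i ≠ 0 := fun i => by simp only [d']; split_ifs <;> simp [*]
  have hpd' : ∀ i, (a i : K) * aeval s (d' i) = aeval s (p' i) := fun i => by
    rw [hpd i]
    by_cases h0 : d i = 0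
    · simp [p', h0]
    · have : aeval s (d i) ≠ 0 := fun h => h0 (hinj _ h)
      simp [d', p', h0, div_mul_cancel₀ _ this]
  let R : Fin N → F[X] := fun i => p' i * ∏ j ∈ Finset.univ.erase i, d' j
  have hR : ∀ i, (a i : K) * aeval s (∏ j, d' j) = aeval s (R i) := fun i => by
    rw [← Finset.mul_prod_erase _ _ (Finset.mem_univ i), map_mul, ← mul_assoc, hpd', ← map_mul]
  have hD : aeval s (∏ j, d' j) ≠ 0 := fun h0 =>
    (Finset.prod_ne_zero_iff.mpr fun i _ => hd' i) (hinj _ h0)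
  have hR0 : ∃ i, R i ≠ 0 := by
    by_contra! hc
    refine ha (funext fun i => Subtype.ext ?_)
    have := hR i
    rw [hc i, map_zero] at this
    exact (mul_eq_zero.mp this).resolve_right hD
  let := UniqueFactorizationMonoid.toNormalizedGCDMonoid F[X]
  obtain ⟨r, hr1, hr2⟩ := Finset.extract_gcd R (s := Finset.univ)
    ⟨hR0.choose, Finset.mem_univ _⟩
  set g := Finset.univ.gcd R
  have hg : g ≠ 0 := fun hg0 => by
    obtain ⟨i, hi⟩ := hR0
    exact hi (by rw [hr1 i (Finset.mem_univ i), hg0, zero_mul])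
  have hgs : aeval s g ≠ 0 := fun h0 => hg (hinj _ h0)
  have mem : ∀ f : F[X], aeval s f ∈ F⟮s⟯ := fun f =>
    (IntermediateField.mem_adjoin_simple_iff F _).mpr ⟨f, 1, by simp⟩
  refine ⟨⟨aeval s (∏ j, d' j) / aeval s g, div_mem (mem _) (mem _)⟩, r, ?_, fun i => ?_, ?_⟩
  · intro h0
    exact div_ne_zero hD hgs congr(($h0 : K))
  · have := hR i
    rw [hr1 i (Finset.mem_univ i), map_mul] at this
    push_cast
    rw [div_mul_eq_mul_div, mul_comm, this, mul_div_cancel_left₀ _ hgs]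
  · by_contra! hc
    have : X ∣ Finset.univ.gcd r := Finset.dvd_gcd fun i _ => X_dvd_iff.mpr (hc i)
    rw [hr2] at this
    exact not_isUnit_X (isUnit_of_dvd_one this)

end Adjoin

theorem transcendental_or_mem_range {F K : Type*} [Field F] [IsAlgClosed F] [Field K] [Algebra F K]
    (f : K) : Transcendental F f ∨ f ∈ Set.range (algebraMap F K) := by
  by_cases hf : IsAlgebraic F f
  · exact Or.inr (minpoly.mem_range_of_degree_eq_one F f
      (IsAlgClosed.degree_eq_one_of_irreducible F (minpoly.irreducible hf.isIntegral)))
  · exact Or.inl hf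

theorem adjoin_simple_inv {F K : Type*} [Field F] [Field K] [Algebra F K] (x : K) :
    F⟮x⁻¹⟯ = F⟮x⟯ := by
  apply le_antisymm
  · rw [IntermediateField.adjoin_simple_le_iff]
    exact inv_mem (IntermediateField.mem_adjoin_simple_self F x)
  · rw [IntermediateField.adjoin_simple_le_iff]
    simpa using inv_mem (IntermediateField.mem_adjoin_simple_self F x⁻¹)

theorem transcendental_inv {F K : Type*} [Field F] [Field K] [Algebra F K] {x : K}
    (hx : Transcendental F x) : Transcendental F x⁻¹ := fun ha => hx (inv_inv x ▸ ha.inv)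

theorem ne_zero_of_transcendental {F K : Type*} [Field F] [Field K] [Algebra F K] {x : K}
    (hx : Transcendental F x) : x ≠ 0 := by
  rintro rfl; exact hx isAlgebraic_zero

/-! ### Zeros of a function and the degree of the extension it generates -/

namespace IsPlaceSystem

variable {F K ι : Type*} [Field F] [Field K] [Algebra F K] {v : ι → Valuation K ℤᵐ⁰}
  (h : IsPlaceSystem F v)

include h

/-- The order of an element of `F(s)` at the zeros of `s`. -/
theorem exists_vOrd_eq_mul {s : K} (hs0 : s ≠ 0) {u : K} (hu : u ∈ F⟮s⟯) (hu0 : u ≠ 0) :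
    ∃ m : ℤ, ∀ P, OrdGE (v P) 1 s → vOrd (v P) u = m * vOrd (v P) s := by
  obtain ⟨p, q, rfl⟩ := (IntermediateField.mem_adjoin_simple_iff F u).mp hu
  have key : ∀ p : F[X], aeval s p ≠ 0 → ∃ m : ℤ, ∀ P, OrdGE (v P) 1 s →
      vOrd (v P) (aeval s p) = m * vOrd (v P) s := by
    intro p hp
    have hp0 : p ≠ 0 := by rintro rfl; simp at hp
    -- Only the power of `s` that divides `p(s)` counts, since the cofactor is a unit at every zero
    -- of `s`.
    obtain ⟨p1, h1, h2⟩ := exists_eq_pow_rootMultiplicity_mul_and_not_dvd p hp0 0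
    rw [map_zero, sub_zero] at h1 h2
    rw [X_dvd_iff] at h2
    refine ⟨p.rootMultiplicity 0, fun P hP => ?_⟩
    have hu := h.aeval_unit P hP h2
    have hne : aeval s p1 ≠ 0 := (Valuation.ne_zero_iff (v P)).mp (by simp [hu])
    conv_lhs => rw [h1]
    rw [map_mul, map_pow, aeval_X, vOrd_mul (pow_ne_zero _ hs0) hne, vOrd_pow,
      vOrd_eq_of (m := 0) (f := aeval s p1) (by simpa using hu), add_zero]
  obtain ⟨hp, hq⟩ := div_ne_zero_iff.mp hu0
  obtain ⟨m, hm⟩ := key p hp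
  obtain ⟨m', hm'⟩ := key q hq
  exact ⟨m - m', fun P hP => by rw [vOrd_div hp hq, hm P hP, hm' P hP]; ring⟩

section Powers

variable {s : K} (hs : Transcendental F s) {S : Finset ι} {y : K} {c : ι → F}
  (hc : Set.InjOn c S) (hy : ∀ P ∈ S, v P (y - algebraMap F K (c P)) = exp (-1)) {e : ι → ℕ}
  (hsS : ∀ P ∈ S, OrdGE (v P) 1 s) (he : ∀ P ∈ S, vOrd (v P) s = e P)

include hs hc hy hsS he

/-- A relation over `F(s)`, made primitive, would survive modulo `s` against `coeff_zero_eq_zero`.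
Thus the number of zeros of `s`, with multiplicity, is at most `[K : F(s)]`. -/
theorem linearIndependent_pow :
    LinearIndependent F⟮s⟯ fun i : Fin (∑ P ∈ S, e P) => y ^ (i : ℕ) := by
  rw [Fintype.linearIndependent_iff]
  intro g hg
  by_contra! hne
  obtain ⟨u, r, -, h1, i, hi⟩ := exists_primitive_multiple hs g (fun h0 => by simp [h0] at hne)
  refine hi (h.coeff_zero_eq_zero S hc hy (fun P hP => (hsS P hP).mono zero_le_one) he le_rfl r
    (fun P _ => ?_) i)
  have : ∑ i, aeval s (r i) * y ^ (i : ℕ) = 0 := by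
    simp only [← h1]
    have := congr((u : K) * $hg)
    simpa [Finset.mul_sum, mul_assoc, Algebra.smul_def] using this
  rw [this]
  exact OrdGE.zero _

/-- If the powers of `y` generate, their coefficients in a function that is regular at the zeros of
`s` are regular there. -/
theorem regular_coeff (a : Fin (∑ P ∈ S, e P) → F⟮s⟯)
    (ha : ∀ P ∈ S, OrdGE (v P) 0 (∑ i, (a i : K) * y ^ (i : ℕ))) (i) {P : ι} (hP : P ∈ S) :
    OrdGE (v P) 0 (a i : K) := by
  by_cases ha0 : a = 0
  · simpa [ha0] using OrdGE.zero _
  have hs0 : s ≠ 0 := ne_zero_of_transcendental hs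
  obtain ⟨u, r, hu, h1, j, hj⟩ := exists_primitive_multiple hs a ha0
  have hu0 : (u : K) ≠ 0 := fun h0 => hu (Subtype.ext h0)
  obtain ⟨m, hm⟩ := h.exists_vOrd_eq_mul hs0 u.2 hu0
  have hpos : ∀ P ∈ S, 1 ≤ vOrd (v P) s := fun P hP => (ordGE_iff hs0).mp (hsS P hP)
  -- If the multiplier `u` vanished at the zeros of `s`, then `u` times the regular function would
  -- vanish there to the order of `s`, and all constant terms of the primitive relation would be
  -- zero.
  have hm0 : m ≤ 0 := by
    by_contra! hm1
    refine hj (h.coeff_zero_eq_zero S hc hy (fun P hP => (hsS P hP).mono zero_le_one) he le_rfl r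
      (fun Q hQ => ?_) j)
    have : ∑ i, aeval s (r i) * y ^ (i : ℕ) = u * ∑ i, (a i : K) * y ^ (i : ℕ) := by
      simp only [← h1, Finset.mul_sum]
      refine Finset.sum_congr rfl fun i _ => ?_
      push_cast; ring
    rw [this, ← he Q hQ, OrdGE.mul_iff hu0, hm Q (hsS Q hQ)]
    refine (ha Q hQ).mono ?_
    have := hpos Q hQ
    nlinarith
  have : OrdGE (v P) 0 ((u : K) * a i) := by
    have := h1 i
    push_cast at this
    rw [this]
    exact h.aeval_regular P ((hsS P hP).mono zero_le_one) _
  rw [OrdGE.mul_iff hu0, hm P (hsS P hP)] at this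
  refine this.mono ?_
  have := hpos P hP
  nlinarith

end Powers

theorem sum_vOrd_le_finrank [Infinite F] {s : K} (hs : Transcendental F s) (S : Finset ι)
    (hS : ∀ P ∈ S, OrdGE (v P) 1 s) : ∑ P ∈ S, vOrd (v P) s ≤ Module.finrank F⟮s⟯ K := by
  have := h.finite s hs
  have hs0 : s ≠ 0 := ne_zero_of_transcendental hs
  obtain ⟨y, c, hc, hy⟩ := h.exists_parameter S
  have he : ∀ P ∈ S, vOrd (v P) s = (vOrd (v P) s).toNat := fun P hP => by
    have := (ordGE_iff hs0).mp (hS P hP)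
    omega
  have := (h.linearIndependent_pow hs hc hy hS (e := fun P => (vOrd (v P) s).toNat)
    he).fintype_card_le_finrank
  rw [Finset.sum_congr rfl he]
  simpa using (Nat.cast_le (α := ℤ)).mpr this

theorem finite_zeros [Infinite F] {s : K} (hs : Transcendental F s) :
    {P | OrdGE (v P) 1 s}.Finite := by
  have hs0 : s ≠ 0 := ne_zero_of_transcendental hs
  by_contra hinf
  obtain ⟨S, hS, hcard⟩ := (show Set.Infinite {P | OrdGE (v P) 1 s} from hinf).exists_subset_card_eq
    (Module.finrank F⟮s⟯ K + 1)
  have := h.sum_vOrd_le_finrank hs S fun P hP => hS hP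
  have h2 : ∑ P ∈ S, (1 : ℤ) ≤ ∑ P ∈ S, vOrd (v P) s :=
    Finset.sum_le_sum fun P hP => (ordGE_iff hs0).mp (hS hP)
  simp [hcard] at h2
  omega

variable [IsAlgClosed F]

theorem finite_support (f : K) : {P | vOrd (v P) f ≠ 0}.Finite := by
  rcases transcendental_or_mem_range (F := F) f with hf | ⟨c, rfl⟩
  · have hf0 : f ≠ 0 := ne_zero_of_transcendental hf
    refine ((h.finite_zeros hf).union (h.finite_zeros (transcendental_inv hf))).subset fun P hP => ?_
    simp only [Set.mem_union, Set.mem_ofPred_eq, ordGE_iff hf0, ordGE_iff (inv_ne_zero hf0), vOrd_inv]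
    have : vOrd (v P) f ≠ 0 := hP
    omega
  · by_cases hc : c = 0
    · convert Set.finite_empty
      ext P; simp [hc, vOrd]
    · convert Set.finite_empty
      ext P; simp [h.vOrd_const P hc]

end IsPlaceSystem

theorem degree_nonneg {ι : Type*} {D : ι →₀ ℤ} (hD : 0 ≤ D) : 0 ≤ D.degree :=
  Finset.sum_nonneg fun P _ => hD P

theorem degree_mono_int {ι : Type*} {D D' : ι →₀ ℤ} (h : D ≤ D') : D.degree ≤ D'.degree := by
  have := degree_nonneg (sub_nonneg.mpr h)
  rw [map_sub] at this
  linarith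

theorem eq_zero_of_degree_eq_zero {ι : Type*} {D : ι →₀ ℤ} (hD : 0 ≤ D) (h0 : D.degree = 0) :
    D = 0 := by
  ext P
  by_contra hP
  exact hP ((Finset.sum_eq_zero_iff_of_nonneg fun Q _ => hD Q).mp h0 P (by simpa using hP))

theorem finrank_le_add_one {F K : Type*} [Field F] [AddCommGroup K] [Module F K]
    {A B : Submodule F K} (hA : Module.Finite F A) (b : K) (hb : ∀ f ∈ B, ∃ c : F, f - c • b ∈ A) :
    Module.Finite F B ∧ Module.finrank F B ≤ Module.finrank F A + 1 := by
  have hle : B ≤ A ⊔ Submodule.span F {b} := fun f hf => by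
    obtain ⟨c, hc⟩ := hb f hf
    exact Submodule.mem_sup.mpr ⟨_, hc, c • b, Submodule.smul_mem _ _
      (Submodule.mem_span_singleton_self b), by abel⟩
  have : Module.Finite F (A ⊔ Submodule.span F {b} : Submodule F K) := inferInstance
  refine ⟨Submodule.finiteDimensional_of_le hle, (Submodule.finrank_mono hle).trans
    ((Submodule.finrank_add_le_finrank_add_finrank _ _).trans ?_)⟩
  gcongr
  simpa using finrank_span_le_card (R := F) ({b} : Set K)

theorem linearIndependent_gen_pow {F K : Type*} [Field F] [Field K] [Algebra F K] {x : K}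
    (hx : Transcendental F x) (l : ℕ) : LinearIndependent F
      fun j : Fin l => (IntermediateField.AdjoinSimple.gen F x) ^ (j : ℕ) := by
  rw [Fintype.linearIndependent_iff]
  intro a ha i
  have h1 : aeval x (∑ j : Fin l, C (a j) * X ^ (j : ℕ)) = 0 := by
    have := congr(($ha : K))
    simpa [Algebra.smul_def] using this
  have h2 : (∑ j : Fin l, C (a j) * X ^ (j : ℕ)) = 0 :=
    by_contra fun hne => hx ⟨_, hne, h1⟩
  have := congr(coeff $h2 (i : ℕ))
  rw [finsetSum_coeff] at this
  simpa [coeff_C_mul, coeff_X_pow, Fin.val_inj] using this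

/-! ### Riemann–Roch spaces, degrees of divisors and Riemann's inequality -/

namespace IsPlaceSystem

variable {F K ι : Type*} [Field F] [Field K] [Algebra F K] {v : ι → Valuation K ℤᵐ⁰}
  (h : IsPlaceSystem F v)

/-- The Riemann–Roch space of a divisor. -/
def rr (D : ι →₀ ℤ) : Submodule F K where
  carrier := {f | ∀ P, OrdGE (v P) (-D P) f}
  zero_mem' _ := OrdGE.zero _
  add_mem' hf hg P := (hf P).add (hg P)
  smul_mem' c f hf P := by rw [Algebra.smul_def]; exact (h.const P c).mul_left (hf P)

theorem mem_rr {D : ι →₀ ℤ} {f : K} : f ∈ h.rr D ↔ ∀ P, OrdGE (v P) (-D P) f := Iff.rfl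

theorem rr_mono {D D' : ι →₀ ℤ} (hD : D ≤ D') : h.rr D ≤ h.rr D' :=
  fun _ hf P => (hf P).mono (neg_le_neg (hD P))

theorem rr_zero_le : h.rr 0 ≤ Submodule.span F {1} := by
  intro f hf
  obtain ⟨c, rfl⟩ := h.mem_range f fun P => by simpa using hf P
  rw [Algebra.algebraMap_eq_smul_one]
  exact Submodule.smul_mem _ _ (Submodule.mem_span_singleton_self _)

theorem finite_rr_zero : Module.Finite F (h.rr 0) ∧ Module.finrank F (h.rr 0) ≤ 1 := by
  refine ⟨Submodule.finiteDimensional_of_le h.rr_zero_le,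
    (Submodule.finrank_mono h.rr_zero_le).trans ?_⟩
  simpa using finrank_span_le_card (R := F) ({1} : Set K)

/-- A new function `b` has order exactly `-(D P + 1)` at `P`. For any other `f` the quotient `f / b`
is regular at `P`, and subtracting its residue times `b` brings `f` back into `L(D)`. -/
theorem finrank_rr_add_single {D : ι →₀ ℤ} (P : ι) (hfin : Module.Finite F (h.rr D)) :
    Module.Finite F (h.rr (D + .single P 1)) ∧
      Module.finrank F (h.rr (D + .single P 1)) ≤ Module.finrank F (h.rr D) + 1 := by
  classical
  by_cases hle : h.rr (D + .single P 1) ≤ h.rr D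
  · exact ⟨Submodule.finiteDimensional_of_le hle, (Submodule.finrank_mono hle).trans (by omega)⟩
  obtain ⟨b, hb, hbD⟩ := Set.not_subset.mp hle
  have hbP : OrdGE (v P) (-(D P + 1)) b := by simpa using hb P
  have hother : ∀ f ∈ h.rr (D + .single P 1), ∀ Q ≠ P, OrdGE (v Q) (-D Q) f := fun f hf Q hQ => by
    simpa [Finsupp.single_apply, hQ.symm] using hf Q
  have hbP' : ¬ OrdGE (v P) (-D P) b := fun hc => hbD fun Q => by
    by_cases hQ : Q = P
    · exact hQ ▸ hc
    · exact hother b hb Q hQ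
  have hb0 : b ≠ 0 := by rintro rfl; exact hbP' (OrdGE.zero _)
  have hord : vOrd (v P) b = -(D P + 1) := by
    rw [ordGE_iff hb0] at hbP hbP'
    omega
  refine finrank_le_add_one hfin b fun f hf => ?_
  have hfb : OrdGE (v P) 0 (f / b) := by
    have := OrdGE.div (m := -(D P + 1)) (by simpa using hf P) hb0
    rwa [hord, sub_self] at this
  obtain ⟨c, hc⟩ := h.residue P _ hfb
  refine ⟨c, fun Q => ?_⟩
  by_cases hQ : Q = P
  · subst hQ
    have := (OrdGE.self (v := v Q) b).mul hc
    rw [hord] at this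
    convert this using 1
    · ring
    · rw [Algebra.smul_def]; field_simp
  · rw [Algebra.smul_def]
    exact (hother f hf Q hQ).sub ((h.const Q c).mul_left (hother b hb Q hQ))

theorem finrank_rr_le_add {D D' : ι →₀ ℤ} (hD : D ≤ D') (hfin : Module.Finite F (h.rr D)) :
    Module.Finite F (h.rr D') ∧
      (Module.finrank F (h.rr D') : ℤ) ≤ Module.finrank F (h.rr D) + (D'.degree - D.degree) := by
  classical
  obtain ⟨n, hn⟩ := Int.eq_ofNat_of_zero_le (sub_nonneg.mpr (degree_mono_int hD))
  induction n generalizing D' with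
  | zero =>
    have : D' - D = 0 := eq_zero_of_degree_eq_zero (sub_nonneg.mpr hD) (by rw [map_sub, hn]; rfl)
    obtain rfl := sub_eq_zero.mp this
    simpa using hfin
  | succ n ih =>
    obtain ⟨P, hP⟩ : ∃ P, D P < D' P := by
      by_contra! hc
      have : D' = D := le_antisymm hc hD
      simp [this] at hn
      omega
    have hle : D ≤ D' - .single P 1 := fun Q => by
      by_cases hQ : P = Q
      · subst hQ; simp; omega
      · simpa [Finsupp.single_apply, hQ] using hD Q
    obtain ⟨h1, h2⟩ := ih hle (by simp; push_cast at hn; linarith)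
    obtain ⟨h3, h4⟩ := h.finrank_rr_add_single P h1
    rw [sub_add_cancel] at h3 h4
    refine ⟨h3, ?_⟩
    rw [map_sub, Finsupp.degree_single] at h2
    omega

instance finite_rr (D : ι →₀ ℤ) : Module.Finite F (h.rr D) := by
  have := (h.finrank_rr_le_add (le_sup_right : (0 : ι →₀ ℤ) ≤ D ⊔ 0) h.finite_rr_zero.1).1
  exact Submodule.finiteDimensional_of_le (h.rr_mono (le_sup_left : D ≤ D ⊔ 0))

theorem finrank_rr_le {D : ι →₀ ℤ} (hD : 0 ≤ D) :
    (Module.finrank F (h.rr D) : ℤ) ≤ 1 + D.degree := by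
  have := (h.finrank_rr_le_add hD h.finite_rr_zero.1).2
  have h1 := h.finite_rr_zero.2
  simp at this
  omega

theorem sub_finrank_rr_mono {D D' : ι →₀ ℤ} (hD : D ≤ D') :
    D.degree - Module.finrank F (h.rr D) ≤ D'.degree - Module.finrank F (h.rr D') := by
  have := (h.finrank_rr_le_add hD (h.finite_rr D)).2
  linarith

theorem mul_mem_rr {D D' : ι →₀ ℤ} {f g : K} (hf : f ∈ h.rr D) (hg : g ∈ h.rr D') :
    f * g ∈ h.rr (D + D') := fun P => ((hf P).mul (hg P)).mono (by simp [add_comm])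

theorem pow_mem_rr {D : ι →₀ ℤ} {f : K} (hf : f ∈ h.rr D) (n : ℕ) : f ^ n ∈ h.rr (n • D) :=
  fun P => ((hf P).pow n).mono (by simp)

variable [IsAlgClosed F]

/-- The divisor of a function (zero for the function `0`). -/
noncomputable def divisor (f : K) : ι →₀ ℤ :=
  Finsupp.ofSupportFinite (fun P => vOrd (v P) f) (h.finite_support f)

@[simp] theorem divisor_apply (f : K) (P : ι) : h.divisor f P = vOrd (v P) f := rfl

/-- The divisor of poles of a function. -/
noncomputable def poles (f : K) : ι →₀ ℤ := -h.divisor f ⊔ 0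

@[simp] theorem poles_apply (f : K) (P : ι) : h.poles f P = max (-vOrd (v P) f) 0 := rfl

theorem poles_nonneg (f : K) : 0 ≤ h.poles f := le_sup_right

theorem self_mem_rr_poles (f : K) : f ∈ h.rr (h.poles f) := fun P =>
  (OrdGE.self f).mono (by rw [poles_apply]; have := le_max_left (-vOrd (v P) f) 0; linarith)

theorem finrank_rr_add_divisor_le (D : ι →₀ ℤ) {f : K} (hf : f ≠ 0) :
    Module.finrank F (h.rr (D + h.divisor f)) ≤ Module.finrank F (h.rr D) := by
  let φ : h.rr (D + h.divisor f) →ₗ[F] h.rr D :=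
    (LinearMap.mulLeft F f).restrict fun g hg P => by
      rw [LinearMap.mulLeft_apply, OrdGE.mul_iff hf]
      exact (hg P).mono (by simp; linarith)
  refine LinearMap.finrank_le_finrank_of_injective (f := φ) fun a b hab => ?_
  exact Subtype.ext (mul_left_cancel₀ hf congr(($hab : K)))

/-- Every function becomes regular outside the poles of `x` after multiplication by a polynomial in
`x`. -/
theorem exists_aeval_mul_mem_rr {x : K} (hx : Transcendental F x) (z : K) :
    ∃ (p : F[X]) (m : ℕ), p ≠ 0 ∧ aeval x p * z ∈ h.rr (m • h.poles x) := by
  classical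
  have hx0 := ne_zero_of_transcendental hx
  let S := (h.finite_support z).toFinset
  let T := (h.finite_support x).toFinset
  choose! c hc using fun P (hP : OrdGE (v P) 0 x) => h.residue P x hP
  -- The factor `x - x(P)` vanishes at `P`; its power cancels the pole of `z` there.
  let p : F[X] := ∏ P ∈ S.filter fun P => OrdGE (v P) 0 x, (X - C (c P)) ^ (-vOrd (v P) z).toNat
  have hp : p ≠ 0 := Finset.prod_ne_zero_iff.mpr fun P _ => pow_ne_zero _ (X_sub_C_ne_zero _)
  have hreg : ∀ P, OrdGE (v P) 0 x → OrdGE (v P) 0 (aeval x p * z) := by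
    intro P hP
    by_cases hPS : P ∈ S
    · have hmem : P ∈ S.filter fun P => OrdGE (v P) 0 x := Finset.mem_filter.mpr ⟨hPS, hP⟩
      have hpd : p = (X - C (c P)) ^ (-vOrd (v P) z).toNat *
        ∏ Q ∈ (S.filter fun P => OrdGE (v P) 0 x).erase P,
          (X - C (c Q)) ^ (-vOrd (v Q) z).toNat := (Finset.mul_prod_erase _ _ hmem).symm
      rw [hpd, map_mul, map_pow, map_sub, aeval_X, aeval_C]
      refine ((((hc P hP).pow _).mul_right (h.aeval_regular P hP _)).mul (OrdGE.self z)).mono ?_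
      omega
    · have : vOrd (v P) z = 0 := by simpa [S] using hPS
      exact (h.aeval_regular P hP p).mul_left (this ▸ OrdGE.self z)
  -- At a pole of `x` the divisor `(x)_∞` has coefficient at least one, so the total pole order over
  -- the support of `x` is a sufficient multiple.
  refine ⟨p, ∑ P ∈ T, (-vOrd (v P) (aeval x p * z)).toNat, hp, fun P => ?_⟩
  by_cases hP : OrdGE (v P) 0 x
  · refine (hreg P hP).mono ?_
    simp only [Finsupp.smul_apply, poles_apply, nsmul_eq_mul, Left.neg_nonpos_iff]
    positivity
  · rw [ordGE_iff hx0] at hP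
    have hPT : P ∈ T := by simp [T]; omega
    refine (OrdGE.self _).mono ?_
    have h1 := Finset.single_le_sum (f := fun P => (-vOrd (v P) (aeval x p * z)).toNat)
      (by simp) hPT
    simp only [Finsupp.smul_apply, poles_apply, nsmul_eq_mul]
    have h2 : (1 : ℤ) ≤ max (-vOrd (v P) x) 0 := by omega
    have h3 : (-vOrd (v P) (aeval x p * z)) ≤
      (∑ P ∈ T, (-vOrd (v P) (aeval x p * z)).toNat : ℕ) := by omega
    nlinarith

theorem exists_basis_mem_rr {x : K} (hx : Transcendental F x) :
    ∃ (b : Module.Basis (Fin (Module.finrank F⟮x⟯ K)) F⟮x⟯ K) (m : ℕ),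
      ∀ i, b i ∈ h.rr (m • h.poles x) := by
  have := h.finite x hx
  let b := Module.finBasis F⟮x⟯ K
  choose p m hp hm using fun i => h.exists_aeval_mul_mem_rr hx (b i)
  let u : Fin (Module.finrank F⟮x⟯ K) → F⟮x⟯ := fun i =>
    aeval (IntermediateField.AdjoinSimple.gen F x) (p i)
  have hu : ∀ i, (u i : K) = aeval x (p i) := fun i => by
    have := aeval_algHom_apply (F⟮x⟯.val) (IntermediateField.AdjoinSimple.gen F x) (p i)
    exact this.symm
  have hu0 : ∀ i, u i ≠ 0 := fun i h0 => hx ⟨p i, hp i, by rw [← hu, h0]; rfl⟩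
  refine ⟨b.unitsSMul fun i => Units.mk0 (u i) (hu0 i), ∑ i, m i, fun i => ?_⟩
  rw [Module.Basis.unitsSMul_apply]
  have : (Units.mk0 (u i) (hu0 i)) • b i = aeval x (p i) * b i := by
    rw [← hu]; rfl
  rw [this]
  refine h.rr_mono ?_ (hm i)
  exact nsmul_le_nsmul_left (h.poles_nonneg x)
    (Finset.single_le_sum (f := m) (by simp) (Finset.mem_univ i))

/-- The products `x ^ j * b i` with `j ≤ l` are independent over `F`, and `m` absorbs the poles of
the basis. So `ℓ(l (x)_∞)` grows at least like `l [K : F(x)]`. -/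
theorem finrank_mul_le {x : K} (hx : Transcendental F x) : ∃ m : ℕ, ∀ l : ℕ,
    Module.finrank F⟮x⟯ K * (l + 1) ≤ Module.finrank F (h.rr ((l + m) • h.poles x)) := by
  obtain ⟨b, m, hb⟩ := h.exists_basis_mem_rr hx
  refine ⟨m, fun l => ?_⟩
  have hli := linearIndependent_smul (linearIndependent_gen_pow hx (l + 1)) b.linearIndependent
  have hmem : ∀ p : Fin (l + 1) × Fin (Module.finrank F⟮x⟯ K),
      (IntermediateField.AdjoinSimple.gen F x) ^ (p.1 : ℕ) • b p.2 ∈ h.rr ((l + m) • h.poles x) := by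
    rintro ⟨j, i⟩
    have h1 : (IntermediateField.AdjoinSimple.gen F x) ^ (j : ℕ) • b i = x ^ (j : ℕ) * b i := rfl
    rw [h1, add_smul]
    refine h.mul_mem_rr (h.rr_mono ?_ (h.pow_mem_rr (h.self_mem_rr_poles x) j)) (hb i)
    exact nsmul_le_nsmul_left (h.poles_nonneg x) (by omega)
  have h2 : LinearIndependent F fun p => (⟨_, hmem p⟩ : h.rr ((l + m) • h.poles x)) :=
    LinearIndependent.of_comp (Submodule.subtype _) hli
  have := h2.fintype_card_le_finrank
  simpa [mul_comm] using this

/-- The upper bound counts the zeros of `x⁻¹`. For the lower bound, `ℓ(l (x)_∞)` grows at least like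
`l [K : F(x)]` and at most like `l deg (x)_∞`. -/
theorem degree_poles {x : K} (hx : Transcendental F x) :
    (h.poles x).degree = Module.finrank F⟮x⟯ K := by
  have hx0 := ne_zero_of_transcendental hx
  apply le_antisymm
  · have := h.sum_vOrd_le_finrank (transcendental_inv hx) (h.poles x).support fun P hP => by
      rw [ordGE_iff (inv_ne_zero hx0), vOrd_inv]
      have : max (-vOrd (v P) x) 0 ≠ 0 := by simpa using hP
      omega
    rw [adjoin_simple_inv] at this
    refine le_of_eq_of_le (Finset.sum_congr rfl fun P hP => ?_) this
    have : max (-vOrd (v P) x) 0 ≠ 0 := by simpa using hP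
    rw [vOrd_inv, poles_apply]
    omega
  · obtain ⟨m, hm⟩ := h.finrank_mul_le hx
    by_contra! hlt
    have hd := degree_nonneg (h.poles_nonneg x)
    set δ := (h.poles x).degree
    set n := Module.finrank F⟮x⟯ K
    have key : ∀ l : ℕ, (n : ℤ) * (l + 1) ≤ 1 + (l + m) * δ := fun l => by
      have h1 := h.finrank_rr_le (D := (l + m) • h.poles x) (nsmul_nonneg (h.poles_nonneg x) _)
      rw [map_nsmul, nsmul_eq_mul] at h1
      have h2 : ((n * (l + 1) : ℕ) : ℤ) ≤ _ := Nat.cast_le.mpr (hm l)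
      push_cast at h1 h2
      exact h2.trans h1
    -- For `l > m δ` a slope of at least `δ + 1` beats the upper bound `1 + (l + m) δ`.
    have := key (1 + m * δ).toNat
    rw [Int.toNat_of_nonneg (by positivity)] at this
    have h1 : (δ + 1) * (1 + m * δ + 1) ≤ n * (1 + m * δ + 1) := by
      gcongr
      exact hlt
    linarith

/-- The zeros of `f` are the poles of `f⁻¹`, and `F(f⁻¹) = F(f)`, so zeros and poles are counted by
the same field degree. -/
theorem degree_divisor {f : K} (hf : f ≠ 0) : (h.divisor f).degree = 0 := by
  rcases transcendental_or_mem_range (F := F) f with hf' | ⟨c, rfl⟩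
  · have : h.divisor f = h.poles f⁻¹ - h.poles f := by
      ext P
      simp only [divisor_apply, Finsupp.sub_apply, poles_apply, vOrd_inv]
      omega
    rw [this, map_sub, h.degree_poles hf', h.degree_poles (transcendental_inv hf'),
      adjoin_simple_inv, sub_self]
  · have : h.divisor (algebraMap F K c) = 0 := by
      ext P
      exact h.vOrd_const P (by rintro rfl; simp at hf)
    rw [this, map_zero]

/-- Riemann's inequality: `deg D - ℓ(D)` is bounded. -/
theorem riemann {x : K} (hx : Transcendental F x) :
    ∃ C : ℤ, ∀ D : ι →₀ ℤ, D.degree - Module.finrank F (h.rr D) ≤ C := by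
  obtain ⟨m, hm⟩ := h.finrank_mul_le hx
  have := h.finite x hx
  have hn : 0 < Module.finrank F⟮x⟯ K := Module.finrank_pos
  refine ⟨(m - 1) * Module.finrank F⟮x⟯ K, fun D => ?_⟩
  have hdeg := degree_nonneg (le_sup_right : (0 : ι →₀ ℤ) ≤ D ⊔ 0)
  -- With this `l`, the dimension of `L(B - D⁺)` is at least `n (l + 1) - l > 0`, where `n = [K :
  -- F(x)]`. A nonzero `f` in it gives `D ≤ B + div f`, so `deg D - ℓ(D)` is at most `deg B - ℓ(B)`,
  -- which no longer depends on `D` after the estimate `ℓ(B) ≥ n (l + 1)`.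
  set l := (D ⊔ 0).degree.toNat
  set B := (l + m) • h.poles x with hB
  have h1 := (h.finrank_rr_le_add (show B - (D ⊔ 0) ≤ B by simp) (h.finite_rr _)).2
  have hBd : B.degree = (l + m) * Module.finrank F⟮x⟯ K := by
    rw [hB, map_nsmul, h.degree_poles hx]; simp
  have h2 : (Module.finrank F⟮x⟯ K : ℤ) * (l + 1) ≤ Module.finrank F (h.rr B) := by
    exact_mod_cast hm l
  have h3 : 0 < Module.finrank F (h.rr (B - (D ⊔ 0))) := by
    rw [map_sub] at h1
    have h4 : (D ⊔ 0).degree = l := by omega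
    zify
    nlinarith
  obtain ⟨⟨f, hf⟩, hf0⟩ := Module.finrank_pos_iff_exists_ne_zero.mp h3
  have hf0' : f ≠ 0 := fun h0 => hf0 (Subtype.ext h0)
  have hle : D ≤ B + h.divisor f := fun P => by
    have h5 := (ordGE_iff hf0').mp (hf P)
    have h6 : D P ≤ (D ⊔ 0) P := le_max_left _ _
    simp only [Finsupp.add_apply, divisor_apply, Finsupp.sub_apply] at h5 ⊢
    linarith
  have h7 := h.sub_finrank_rr_mono hle
  rw [map_add, h.degree_divisor hf0', add_zero, hBd] at h7
  have h8 := h.finrank_rr_add_divisor_le (B + h.divisor f) (inv_ne_zero hf0')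
  have h9 : B + h.divisor f + h.divisor f⁻¹ = B := by
    ext P; simp [vOrd_inv]
  rw [h9] at h8
  have h10 : (Module.finrank F (h.rr B) : ℤ) ≤ Module.finrank F (h.rr (B + h.divisor f)) := by
    exact_mod_cast h8
  linarith

end IsPlaceSystem

/-! ### Derivations and Taylor homomorphisms -/

section Separating

variable {F K : Type*} [Field F] [Field K] [Algebra F K]

theorem derivation_adjoin_eq_zero {M : Type*} [AddCommGroup M] [Module F M] [Module K M]
    [IsScalarTower F K M] (d : Derivation F K M) {x : K} (hd : d x = 0) {z : K} (hz : z ∈ F⟮x⟯) :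
    d z = 0 := by
  obtain ⟨p, q, rfl⟩ := (IntermediateField.mem_adjoin_simple_iff F z).mp hz
  have h1 : ∀ p : F[X], d (aeval x p) = 0 := fun p => by
    induction p using Polynomial.induction_on' with
    | add p q hp hq => rw [map_add, map_add, hp, hq, add_zero]
    | monomial n a => simp [aeval_monomial, Derivation.leibniz_pow, hd]
  rw [Derivation.leibniz_div, h1, h1]
  simp

/-- A derivation that vanishes at a separating variable is zero. -/
theorem derivation_eq_zero {M : Type*} [AddCommGroup M] [Module F M] [Module K M]
    [IsScalarTower F K M] (d : Derivation F K M) {x : K} (hx : IsSeparatingVariable F x)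
    (hd : d x = 0) (z : K) : d z = 0 := by
  have := hx.separable
  -- Since `d` kills `F(x)` it is linear over that field, hence factors through the differentials of
  -- a separable extension, which are zero.
  let d' : Derivation F⟮x⟯ K M :=
    { toFun := d
      map_add' := map_add d
      map_smul' := fun c z => by
        rw [Algebra.smul_def, Derivation.leibniz, derivation_adjoin_eq_zero d hd (z := algebraMap _ K c) c.2,
          smul_zero, add_zero]
        rfl
      map_one_eq_zero' := d.map_one_eq_zero
      leibniz' := d.leibniz }
  have : Algebra.FormallyUnramified F⟮x⟯ K := Algebra.FormallyUnramified.of_isSeparable _ _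
  have h1 : d' z = d'.liftKaehlerDifferential (KaehlerDifferential.D F⟮x⟯ K z) :=
    (d'.liftKaehlerDifferential_comp_D z).symm
  have h2 : KaehlerDifferential.D F⟮x⟯ K z = 0 := Subsingleton.elim _ _
  rw [h2, map_zero] at h1
  exact h1

/-- The universal derivation `d` over `F(t)` equals `z ↦ D z • d x`, because both agree at `x`. From
`d t = 0` and `D t ≠ 0` it follows that `d x = 0`, so all differentials vanish and the extension is
separable. -/
theorem isSeparatingVariable_of_derivation {x : K} (hx : IsSeparatingVariable F x)
    (D : Derivation F K K) (hD : D x = 1) {t : K} (ht : Transcendental F t)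
    [FiniteDimensional F⟮t⟯ K] (hDt : D t ≠ 0) : IsSeparatingVariable F t := by
  refine ⟨ht, ?_⟩
  rw [← Algebra.FormallyUnramified.iff_isSeparable, Algebra.formallyUnramified_iff]
  let d : Derivation F K Ω[K⁄F⟮t⟯] := (KaehlerDifferential.D F⟮t⟯ K).restrictScalars F
  let e : Derivation F K Ω[K⁄F⟮t⟯] :=
    (LinearMap.toSpanSingleton K Ω[K⁄F⟮t⟯] (d x)).compDer D
  have he : ∀ z, e z = D z • d x := fun z => rfl
  have h1 : ∀ z, d z = D z • d x := fun z => by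
    have := derivation_eq_zero (d - e) hx (by simp [he, hD]) z
    rw [← he]
    exact sub_eq_zero.mp this
  have h2 : d t = 0 :=
    (KaehlerDifferential.D F⟮t⟯ K).map_algebraMap (IntermediateField.AdjoinSimple.gen F t)
  have h3 : d x = 0 := (smul_eq_zero.mp ((h1 t).symm.trans h2)).resolve_left hDt
  have h4 : ∀ z, KaehlerDifferential.D F⟮t⟯ K z = 0 := fun z => by
    have := h1 z
    rw [h3, smul_zero] at this
    exact this
  have h5 : (⊤ : Submodule K Ω[K⁄F⟮t⟯]) = ⊥ := by
    rw [← KaehlerDifferential.span_range_derivation, Submodule.span_eq_bot]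
    rintro _ ⟨z, rfl⟩
    exact h4 z
  exact (Submodule.subsingleton_iff K).mp (subsingleton_of_bot_eq_top h5.symm)

/-- The derivation `D¹` of a Taylor homomorphism. -/
noncomputable def taylorDeriv (η : K →ₐ[F] PowerSeries K)
    (hη : ∀ f, PowerSeries.constantCoeff (η f) = f) : Derivation F K K :=
  Derivation.mk' (((PowerSeries.coeff (R := K) 1).restrictScalars F : PowerSeries K →ₗ[F] K) ∘ₗ
    η.toLinearMap) fun a b => by
    have : Finset.HasAntidiagonal.antidiagonal 1 = {((0 : ℕ), 1), (1, 0)} := rfl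
    simp [PowerSeries.coeff_mul, this, hη, mul_comm]

theorem taylorDeriv_apply (η : K →ₐ[F] PowerSeries K)
    (hη : ∀ f, PowerSeries.constantCoeff (η f) = f) (f : K) :
    taylorDeriv η hη f = PowerSeries.coeff 1 (η f) := rfl

theorem IsTaylorHom.taylorDeriv_self {x : K} {η : K →ₐ[F] PowerSeries K} (hη : IsTaylorHom F x η) :
    taylorDeriv η hη.constantCoeff x = 1 := by
  rw [taylorDeriv_apply, hη.apply_self]
  simp

/-- Taylor homomorphisms are determined by their value at a separating variable. -/
theorem taylorHom_unique {x : K} (hx : IsSeparatingVariable F x) {η η' : K →ₐ[F] PowerSeries K}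
    (hη : ∀ f, PowerSeries.constantCoeff (η f) = f)
    (hη' : ∀ f, PowerSeries.constantCoeff (η' f) = f) (hxx : η x = η' x) : η = η' := by
  have := hx.separable
  have h1 : ∀ p : F[X], η (aeval x p) = η' (aeval x p) := fun p => by
    rw [← aeval_algHom_apply, ← aeval_algHom_apply, hxx]
  have h2 : ∀ z ∈ F⟮x⟯, η z = η' z := by
    intro z hz
    obtain ⟨p, q, rfl⟩ := (IntermediateField.mem_adjoin_simple_iff F z).mp hz
    by_cases hq : aeval x q = 0
    · simp [hq]
    · have hq' : η (aeval x q) ≠ 0 := (map_ne_zero_iff η η.injective).mpr hq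
      apply mul_right_cancel₀ hq'
      rw [← map_mul, div_mul_cancel₀ _ hq, h1 q, ← map_mul, div_mul_cancel₀ _ hq, h1]
  ext1 z
  set p := minpoly F⟮x⟯ z
  let i : F⟮x⟯ →+* PowerSeries K := (η : K →+* PowerSeries K).comp (algebraMap F⟮x⟯ K)
  let i' : F⟮x⟯ →+* PowerSeries K := (η' : K →+* PowerSeries K).comp (algebraMap F⟮x⟯ K)
  have hii : i = i' := RingHom.ext fun c => h2 _ c.2
  have hz : eval₂ (algebraMap F⟮x⟯ K) z p = 0 := minpoly.aeval F⟮x⟯ z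
  have e1 : (p.map i).eval (η z) = 0 := by
    rw [eval_map]
    have := congr(η $hz)
    rwa [map_zero, ← RingHom.coe_coe, Polynomial.hom_eval₂] at this
  have e2 : (p.map i).eval (η' z) = 0 := by
    rw [eval_map, hii]
    have := congr(η' $hz)
    rwa [map_zero, ← RingHom.coe_coe, Polynomial.hom_eval₂] at this
  -- Uniqueness as in Hensel's lemma: `η z` and `η' z` are roots of one polynomial with the same
  -- constant term `z`. Their difference is multiplied by a series whose constant term is the
  -- derivative of the minimal polynomial at `z`, nonzero by separability.
  obtain ⟨k, hk⟩ := (p.map i).binomExpansion (η z) (η' z - η z)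
  rw [add_sub_cancel, e1, e2, zero_add, sq, ← mul_assoc, ← add_mul] at hk
  have hne : (p.map i).derivative.eval (η z) + k * (η' z - η z) ≠ 0 := by
    intro h0
    have := congr(PowerSeries.constantCoeff $h0)
    rw [map_add, map_mul, map_sub, hη, hη', sub_self, mul_zero, add_zero, map_zero, derivative_map,
      eval_map, Polynomial.hom_eval₂, hη] at this
    have hi : (PowerSeries.constantCoeff (R := K)).comp i = algebraMap F⟮x⟯ K :=
      RingHom.ext fun c => hη _
    rw [hi] at this
    exact (Algebra.IsSeparable.isSeparable F⟮x⟯ z).aeval_derivative_ne_zero (minpoly.aeval _ z) this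
  have := (mul_eq_zero.mp hk.symm).resolve_left hne
  exact (sub_eq_zero.mp this).symm

/-- The chain rule for Hasse derivatives. -/
theorem exists_chain_rule {x t : K} (hx : IsSeparatingVariable F x) {η η' : K →ₐ[F] PowerSeries K}
    (hη : IsTaylorHom F x η) (hη' : IsTaylorHom F t η') : ∃ c : ℕ → ℕ → K,
      (∀ m, c m m = PowerSeries.coeff 1 (η' x) ^ m) ∧ ∀ m f, PowerSeries.coeff m (η' f) =
        ∑ i ∈ Finset.range (m + 1), c m i * PowerSeries.coeff i (η f) := by
  -- Substituting `τ` for the variable in `η` gives a homomorphism with the same value at `x` as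
  -- `η'`, hence `η'` itself. As `τ` has no constant term, `τ ^ i` contributes only to coefficients
  -- of index at least `i`.
  set τ : PowerSeries K := η' x - PowerSeries.C x with hτ
  have hτ0 : PowerSeries.constantCoeff τ = 0 := by simp [hτ, hη'.constantCoeff]
  obtain ⟨ρ, hρ⟩ := PowerSeries.X_dvd_iff.mpr hτ0
  have hτs : PowerSeries.HasSubst τ := PowerSeries.HasSubst.of_constantCoeff_zero' hτ0
  have hcomp : ((PowerSeries.substAlgHom hτs).restrictScalars F).comp η = η' := by
    refine taylorHom_unique hx (fun f => ?_) hη'.constantCoeff ?_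
    · have h1 : η f = PowerSeries.C f + PowerSeries.X *
          PowerSeries.mk fun i => PowerSeries.coeff (i + 1) (η f) := by
        conv_lhs => rw [PowerSeries.eq_X_mul_shift_add_const (η f)]
        rw [hη.constantCoeff, add_comm]
      change PowerSeries.constantCoeff (PowerSeries.substAlgHom hτs (η f)) = f
      rw [h1, map_add, map_mul, PowerSeries.substAlgHom_X]
      have h2 : PowerSeries.substAlgHom hτs (PowerSeries.C f) = PowerSeries.C f :=
        (PowerSeries.substAlgHom hτs).commutes f
      rw [h2, map_add, map_mul, hτ0, zero_mul, add_zero]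
      simp
    · change PowerSeries.substAlgHom hτs (η x) = η' x
      rw [hη.apply_self, map_add, PowerSeries.substAlgHom_X]
      have h2 : PowerSeries.substAlgHom hτs (PowerSeries.C x) = PowerSeries.C x :=
        (PowerSeries.substAlgHom hτs).commutes x
      rw [h2, hτ]; ring
  refine ⟨fun m i => PowerSeries.coeff m (τ ^ i), fun m => ?_, fun m f => ?_⟩
  · have h1 : PowerSeries.coeff 1 (η' x) = PowerSeries.constantCoeff ρ := by
      have : η' x = PowerSeries.C x + PowerSeries.X * ρ := by rw [← hρ, hτ]; ring
      rw [this, map_add, PowerSeries.coeff_C]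
      simp
    change PowerSeries.coeff m (τ ^ m) = _
    rw [hρ, mul_pow]
    have := PowerSeries.coeff_X_pow_mul (ρ ^ m) m 0
    rw [zero_add] at this
    rw [this, h1, PowerSeries.coeff_zero_eq_constantCoeff_apply, map_pow]
  · have h1 : η' f = PowerSeries.subst τ (η f) := by
      rw [← hcomp]
      exact congr($(PowerSeries.coe_substAlgHom hτs) (η f))
    rw [h1, PowerSeries.coeff_subst' hτs, finsum_eq_sum_of_support_subset (s := Finset.range (m + 1))]
    · exact Finset.sum_congr rfl fun i _ => by rw [smul_eq_mul, mul_comm]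
    · intro i hi
      by_contra hlt
      have hlt' : m < i := by simpa using hlt
      refine hi ?_
      change _ • PowerSeries.coeff m (τ ^ i) = 0
      rw [hρ, mul_pow, PowerSeries.coeff_X_pow_mul', if_neg (by omega), smul_zero]

end Separating

/-! ### Orders of derivatives at a place -/

namespace IsPlaceSystem

variable {F K ι : Type*} [Field F] [Field K] [Algebra F K] {v : ι → Valuation K ℤᵐ⁰}
  (h : IsPlaceSystem F v)

include h

theorem exists_expansion (P : ι) {t : K} (ht : v P t = exp (-1)) {f : K} (hf : OrdGE (v P) 0 f)
    (N : ℕ) : ∃ (p : F[X]) (g : K), OrdGE (v P) 0 g ∧ f = aeval t p + t ^ N * g := by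
  have ht0 : t ≠ 0 := ne_zero_of_eq_exp ht
  induction N with
  | zero => exact ⟨0, f, hf, by simp⟩
  | succ N ih =>
    obtain ⟨p, g, hg, hfg⟩ := ih
    obtain ⟨c, hc⟩ := h.residue P g hg
    refine ⟨p + C c * X ^ N, (g - algebraMap F K c) / t, ?_, ?_⟩
    · simpa [vOrd_eq_of ht] using hc.div ht0
    · rw [hfg]
      simp
      field_simp
      ring

/-- The product rule carries the bound from the generators to the algebra they generate, and the
quotient rule to fractions with unit denominator. This crude bound makes approximation by
polynomials in `t` legitimate. -/
theorem derivation_bound (P : ι) (D : Derivation F K K) {T : Finset K}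
    (hT : ∀ f, OrdGE (v P) 0 f →
      ∃ a ∈ Algebra.adjoin F {u | u ∈ T ∧ OrdGE (v P) 0 u},
      ∃ b ∈ Algebra.adjoin F {u | u ∈ T ∧ OrdGE (v P) 0 u}, v P b = 1 ∧ f = a / b)
    {m : ℤ} (hm : ∀ u ∈ T, OrdGE (v P) m (D u)) {f : K} (hf : OrdGE (v P) 0 f) :
    OrdGE (v P) m (D f) := by
  have key : ∀ a ∈ Algebra.adjoin F {u | u ∈ T ∧ OrdGE (v P) 0 u},
      OrdGE (v P) 0 a ∧ OrdGE (v P) m (D a) := fun a ha => by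
    induction ha using Algebra.adjoin_induction with
    | mem u hu => exact ⟨hu.2, hm u hu.1⟩
    | algebraMap c => exact ⟨h.const P c, by rw [D.map_algebraMap]; exact OrdGE.zero _⟩
    | add a b _ _ ha hb => exact ⟨ha.1.add hb.1, by rw [map_add]; exact ha.2.add hb.2⟩
    | mul a b _ _ ha hb =>
      refine ⟨by simpa using ha.1.mul hb.1, ?_⟩
      rw [D.leibniz]
      exact (ha.1.mul_left hb.2).add (hb.1.mul_left ha.2)
  obtain ⟨a, ha, b, hb, hb1, rfl⟩ := hT f hf
  have hb0 : b ≠ 0 := (Valuation.ne_zero_iff (v P)).mp (by simp [hb1])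
  have hbo : vOrd (v P) b = 0 := vOrd_eq_of (by simpa using hb1)
  have h1 : D (a / b) = (b * D a - a * D b) / (b * b) := by
    rw [Derivation.leibniz_div]
    simp only [smul_eq_mul]
    field_simp
  rw [h1]
  have := (((key b hb).1.mul_left (key a ha).2).sub ((key a ha).1.mul_left (key b hb).2)).div
    (mul_ne_zero hb0 hb0)
  rwa [vOrd_mul hb0 hb0, hbo, add_zero, sub_zero] at this

/-- The order of `D f`, for `f` regular at `P`, is at least the order of `D t`. -/
theorem ordGE_derivation (P : ι) (D : Derivation F K K) {t : K} (ht : v P t = exp (-1)) {m : ℤ}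
    (hm : OrdGE (v P) m (D t)) {f : K} (hf : OrdGE (v P) 0 f) : OrdGE (v P) m (D f) := by
  have ht1 : OrdGE (v P) 1 t := ht.le
  have ht0' : OrdGE (v P) 0 t := ht1.mono zero_le_one
  obtain ⟨T, hT⟩ := h.generators
  let C : ℕ := ∑ u ∈ T, (-vOrd (v P) (D u)).toNat
  have hC : ∀ u ∈ T, OrdGE (v P) (-C) (D u) := fun u hu => by
    refine (OrdGE.self _).mono ?_
    have : (-vOrd (v P) (D u)).toNat ≤ C :=
      Finset.single_le_sum (f := fun u => (-vOrd (v P) (D u)).toNat) (by simp) hu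
    omega
  -- The precision is chosen so that the term `t ^ (N + 1) * D g` is harmless even if `D g` has a
  -- pole of order `C`. In all other terms `D t` is a factor.
  obtain ⟨p, g, hg, rfl⟩ := h.exists_expansion P ht hf ((m + C).toNat + 1)
  set N := (m + C).toNat
  have hbg := h.derivation_bound P D (hT P) hC hg
  have h1 : D (aeval t p) = aeval t (derivative p) * D t := by
    rw [D.map_aeval, smul_eq_mul]
  rw [map_add, D.leibniz, D.leibniz_pow, h1]
  simp only [smul_eq_mul, nsmul_eq_mul, add_tsub_cancel_right]
  refine ((h.aeval_regular P ht0' _).mul_left hm).add (OrdGE.add ?_ ?_)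
  · refine ((ht1.pow (N + 1)).mul hbg).mono ?_
    push_cast; omega
  · refine hg.mul_left ?_
    have h2 : OrdGE (v P) 0 (((N + 1 : ℕ) : K)) := by
      simpa using h.const P ((N + 1 : ℕ) : F)
    exact h2.mul_left (OrdGE.mul_left (by simpa using ht0'.pow N) hm)

/-- If `D t = 0`, then `ordGE_derivation` holds for every `m`, so `D` kills the local ring. One of
`x`, `x⁻¹` lies in it, so `D x = 0`. -/
theorem derivation_uniformizer_ne_zero (P : ι) (D : Derivation F K K) {x : K} (hD : D x ≠ 0) {t : K}
    (ht : v P t = exp (-1)) : D t ≠ 0 := by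
  intro h0
  have key : ∀ f, OrdGE (v P) 0 f → D f = 0 := fun f hf => OrdGE.eq_zero_of_forall (v := v P)
    fun m => h.ordGE_derivation P D ht (by rw [h0]; exact OrdGE.zero _) hf
  have hx0 : x ≠ 0 := by rintro rfl; simp at hD
  by_cases hx : OrdGE (v P) 0 x
  · exact hD (key x hx)
  · have hx' : OrdGE (v P) 0 x⁻¹ := by
      rw [ordGE_iff hx0] at hx
      rw [ordGE_iff (inv_ne_zero hx0), vOrd_inv]
      omega
    have := key _ hx'
    rw [Derivation.leibniz_inv] at this
    simp [hx0, hD] at this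

/-- Each of the two uniformizers is regular, so `ordGE_derivation` applies in both directions. This
makes the order of `dx` at `P` well defined. -/
theorem vOrd_derivation_eq (P : ι) (D : Derivation F K K) {x : K} (hD : D x ≠ 0) {t t' : K}
    (ht : v P t = exp (-1)) {c : F} (ht' : v P (t' - algebraMap F K c) = exp (-1)) :
    vOrd (v P) (D t') = vOrd (v P) (D t) := by
  have hc : D (t' - algebraMap F K c) = D t' := by simp
  have hn := h.derivation_uniformizer_ne_zero P D hD ht
  have hn' := h.derivation_uniformizer_ne_zero P D hD ht'
  have h1 : OrdGE (v P) 0 t := OrdGE.mono (m := 1) ht.le zero_le_one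
  have h2 : OrdGE (v P) 0 (t' - algebraMap F K c) := OrdGE.mono (m := 1) ht'.le zero_le_one
  apply le_antisymm
  · rw [← ordGE_iff hn, ← hc]
    exact h.ordGE_derivation P D ht' (OrdGE.self _) h1
  · rw [hc] at hn'
    rw [← ordGE_iff hn', ← hc]
    exact h.ordGE_derivation P D ht (OrdGE.self _) h2

end IsPlaceSystem

/-! ### Regularity of traces -/

/-- Applied to the minimal polynomial of `y`, this expresses its derivative at `y`, times `D y`, by
derivatives of coefficients only. -/
theorem derivation_aeval_sub {F K : Type*} [Field F] [Field K] [Algebra F K]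
    (D : Derivation F K K) (L : IntermediateField F K) (p : L[X]) (y : K) :
    D (aeval y p) - aeval y (derivative p) * D y = p.sum fun i c => D (c : K) * y ^ i := by
  induction p using Polynomial.induction_on' with
  | add p q hp hq =>
    rw [sum_add_index p q _ (by simp) (by simp [add_mul]), ← hp, ← hq]
    simp only [map_add]; ring
  | monomial n a =>
    rw [sum_monomial_index _ _ (by simp), derivative_monomial, aeval_monomial, aeval_monomial,
      D.leibniz, D.leibniz_pow]
    have : algebraMap L K (a * n) = (a : K) * n := by simp
    rw [this]
    simp only [smul_eq_mul, nsmul_eq_mul, IntermediateField.algebraMap_apply]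
    ring

namespace IsPlaceSystem

variable {F K ι : Type*} [Field F] [Field K] [Algebra F K] {v : ι → Valuation K ℤᵐ⁰}
  (h : IsPlaceSystem F v)

include h

/-- Make the pair `(c, 1)` primitive as `(p, q)`. If `q(0) = 0`, then `p(0) ≠ 0`, and a unit `p(s)`
would be `c` times the vanishing `q(s)`. The resulting form does not mention `P`, so regularity at
one zero of `s` passes to all zeros. -/
theorem exists_eq_div_of_regular {s : K} (hs : Transcendental F s) {P : ι} (hP : OrdGE (v P) 1 s)
    {c : K} (hc : c ∈ F⟮s⟯) (hcP : OrdGE (v P) 0 c) :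
    ∃ p q : F[X], q.coeff 0 ≠ 0 ∧ c = aeval s p / aeval s q := by
  obtain ⟨u, r, hu, hr, j, hj⟩ := exists_primitive_multiple hs ![(⟨c, hc⟩ : F⟮s⟯), 1] (fun h0 => by
    simpa using congrFun h0 1)
  have hr0 : (u : K) * c = aeval s (r 0) := by simpa using hr 0
  have hr1 : (u : K) = aeval s (r 1) := by simpa using hr 1
  have hu0 : (u : K) ≠ 0 := fun h0 => hu (Subtype.ext h0)
  refine ⟨r 0, r 1, fun h1 => ?_, by rw [← hr0, ← hr1, mul_div_cancel_left₀ _ hu0]⟩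
  have h0 : (r 0).coeff 0 ≠ 0 := by
    fin_cases j
    · exact hj
    · exact absurd h1 hj
  have e0 := h.aeval_unit P hP h0
  have e1 := h.aeval_sub P (hP.mono zero_le_one) (r 1) 0 (m := 1) (by simpa using hP)
  rw [← coeff_zero_eq_eval_zero, h1, map_zero, sub_zero, ← hr1] at e1
  have := e1.mul_right hcP
  rw [hr0, ordGE_one_iff, e0] at this
  exact lt_irrefl _ this

theorem derivation_regular {s : K} (D : Derivation F K K) (hD : D s = 1) {Q : ι}
    (hQ : OrdGE (v Q) 1 s) {p q : F[X]} (hq : q.coeff 0 ≠ 0) :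
    OrdGE (v Q) 0 (aeval s p / aeval s q) ∧
      OrdGE (v Q) 0 (D (aeval s p / aeval s q)) := by
  have hs := hQ.mono zero_le_one
  have e := h.aeval_unit Q hQ hq
  have hq0 : aeval s q ≠ 0 := (Valuation.ne_zero_iff (v Q)).mp (by simp [e])
  have hqo : vOrd (v Q) (aeval s q) = 0 := vOrd_eq_of (by simpa using e)
  constructor
  · simpa [hqo] using (h.aeval_regular Q hs p).div hq0
  · have h1 : D (aeval s p / aeval s q) =
        aeval s (q * derivative p - p * derivative q) /
          (aeval s q * aeval s q) := by
      rw [Derivation.leibniz_div, D.map_aeval, D.map_aeval, hD]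
      simp only [smul_eq_mul, map_sub, map_mul]
      field_simp
    rw [h1]
    have := (h.aeval_regular Q hs (q * derivative p - p * derivative q)).div (mul_ne_zero hq0 hq0)
    rwa [vOrd_mul hq0 hq0, hqo, add_zero, sub_zero] at this

variable [IsAlgClosed F]

theorem sum_zeros_eq_finrank {s : K} (hs : Transcendental F s) :
    ∑ P ∈ (h.finite_zeros hs).toFinset, (vOrd (v P) s).toNat = Module.finrank F⟮s⟯ K := by
  have hs0 := ne_zero_of_transcendental hs
  have h1 := h.degree_poles (transcendental_inv hs)
  rw [adjoin_simple_inv] at h1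
  zify
  classical
  rw [← h1, Finsupp.degree_apply]
  symm
  refine Finset.sum_subset_zero_on_sdiff (fun P hP => ?_) (fun P hP => ?_) fun P hP => ?_
  · have : max (vOrd (v P) s) 0 ≠ 0 := by simpa [vOrd_inv] using hP
    simp only [Set.Finite.mem_toFinset, Set.mem_ofPred_eq, ordGE_iff hs0]
    omega
  · have : ¬ (h.poles s⁻¹ P ≠ 0) := by simpa [-poles_apply] using (Finset.mem_sdiff.mp hP).2
    simp only [poles_apply, vOrd_inv, neg_neg] at this
    omega
  · simp only [poles_apply, vOrd_inv]
    omega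

/-- Let `A` be the local ring of `F(s)` at `s = 0` and `φ` the minimal polynomial of `y`. The
functions regular at all zeros of `s` lie in `A[y]`, whose dual for the trace form is `φ'(y)⁻¹ A[y]`
by Euler's formula. So it suffices that `φ'(y) z` is regular at these zeros. Differentiating `φ(y) =
0` shows that `φ'(y) D y` is regular, and by hypothesis the order of `z` is at least that of `D y`.
-/
theorem trace_regular_aux {s : K} (hs : IsSeparatingVariable F s) (D : Derivation F K K)
    (hD : D s = 1) {z : K} (hz : ∀ Q, OrdGE (v Q) 1 s → ∃ t, v Q t = exp (-1) ∧
      OrdGE (v Q) (vOrd (v Q) (D t)) z) {P : ι} (hP : OrdGE (v P) 1 s) :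
    OrdGE (v P) 0 (Algebra.trace F⟮s⟯ K z : K) := by
  classical
  have hst := hs.transcendental
  have := hs.separable
  have := h.finite s hst
  have hs0 := ne_zero_of_transcendental hst
  set S := (h.finite_zeros hst).toFinset with hSdef
  have hS : ∀ Q ∈ S, OrdGE (v Q) 1 s := fun Q hQ => by simpa [S] using hQ
  have hPS : P ∈ S := by simpa [S] using hP
  obtain ⟨y, c, hc, hy⟩ := h.exists_parameter S
  have he : ∀ Q ∈ S, vOrd (v Q) s = (vOrd (v Q) s).toNat := fun Q hQ => by
    have := (ordGE_iff hs0).mp (hS Q hQ)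
    omega
  have hyreg : ∀ Q ∈ S, OrdGE (v Q) 0 y := fun Q hQ => by
    have h1 : OrdGE (v Q) 0 (y - algebraMap F K (c Q)) :=
      OrdGE.mono (m := 1) (hy Q hQ).le zero_le_one
    simpa using h1.add (h.const Q (c Q))
  set n := ∑ Q ∈ S, (vOrd (v Q) s).toNat with hn
  have hli : LinearIndependent F⟮s⟯ fun i : Fin n => y ^ (i : ℕ) :=
    h.linearIndependent_pow hst hc hy hS he
  have hcard : Fintype.card (Fin n) = Module.finrank F⟮s⟯ K := by
    rw [Fintype.card_fin]; exact h.sum_zeros_eq_finrank hst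
  have hspan : ∀ w : K, ∃ a : Fin n → F⟮s⟯, w = ∑ i, (a i : K) * y ^ (i : ℕ) := fun w => by
    have : w ∈ Submodule.span F⟮s⟯ (Set.range fun i : Fin n => y ^ (i : ℕ)) := by
      rw [hli.span_eq_top_of_card_eq_finrank' hcard]; trivial
    obtain ⟨a, ha⟩ := (Submodule.mem_span_range_iff_exists_fun _).mp this
    exact ⟨a, ha.symm⟩
  let A := ((v P).comap (algebraMap F⟮s⟯ K)).valuationSubring
  have hA : ∀ a : F⟮s⟯, a ∈ A ↔ OrdGE (v P) 0 (a : K) := fun a => by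
    rw [ordGE_zero_iff]; rfl
  have : IsScalarTower A F⟮s⟯ K := IsScalarTower.of_algebraMap_eq fun _ => rfl
  have hadj : ∀ w, (∀ Q ∈ S, OrdGE (v Q) 0 w) →
      ∃ a : Fin n → A, w = ∑ i, ((a i : F⟮s⟯) : K) * y ^ (i : ℕ) := fun w hw => by
    obtain ⟨a, rfl⟩ := hspan w
    exact ⟨fun i => ⟨a i, (hA _).mpr (h.regular_coeff hst hc hy hS he a hw i hPS)⟩, rfl⟩
  have hint : IsIntegral A y := by
    -- Expanding `y ^ n` in lower powers over `A` is a monic equation for `y`.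
    obtain ⟨a, ha⟩ := hadj (y ^ n) fun Q hQ => by simpa using (hyreg Q hQ).pow n
    refine ⟨X ^ n - ∑ i : Fin n, C (a i) * X ^ (i : ℕ), monic_X_pow_sub (degree_sum_fin_lt a), ?_⟩
    have : ∀ b : A, algebraMap A K b = ((b : F⟮s⟯) : K) := fun _ => rfl
    simp [eval₂_finsetSum, this, ← ha]
  have htop : Algebra.adjoin F⟮s⟯ {y} = ⊤ := by
    rw [eq_top_iff]
    intro w _
    obtain ⟨a, rfl⟩ := hspan w
    exact Subalgebra.sum_mem _ fun i _ => Subalgebra.mul_mem _ (Subalgebra.algebraMap_mem _ (a i))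
      (Subalgebra.pow_mem _ (Algebra.self_mem_adjoin_singleton _ y) _)
  set φ := minpoly F⟮s⟯ y with hφ
  have hφA : φ = (minpoly A y).map (algebraMap A F⟮s⟯) :=
    minpoly.isIntegrallyClosed_eq_field_fractions F⟮s⟯ K hint
  have hφ0 : aeval y (derivative φ) ≠ 0 :=
    (Algebra.IsSeparable.isSeparable F⟮s⟯ y).aeval_derivative_ne_zero (minpoly.aeval _ y)
  have hreg : ∀ Q ∈ S, OrdGE (v Q) 0 (aeval y (derivative φ) * z) := by
    intro Q hQ
    obtain ⟨t, ht, hzt⟩ := hz Q (hS Q hQ)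
    have hDs : D s ≠ 0 := by simp [hD]
    rw [← h.vOrd_derivation_eq Q D hDs ht (hy Q hQ)] at hzt
    have hDy : D y ≠ 0 := by simpa using h.derivation_uniformizer_ne_zero Q D hDs (hy Q hQ)
    have h1 := derivation_aeval_sub D _ φ y
    rw [hφ, minpoly.aeval, map_zero, zero_sub, ← hφ] at h1
    have h2 : OrdGE (v Q) 0 (D y * aeval y (derivative φ)) := by
      rw [mul_comm, ← neg_neg (aeval y (derivative φ) * D y), h1]
      refine (OrdGE.sum fun i _ => ?_).neg
      refine OrdGE.mul_left ?_ (by simpa using (hyreg Q hQ).pow i)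
      -- The coefficients of `φ` are regular at `P`; in the form `p(s) / q(s)` with `q(0) ≠ 0` they
      -- and their derivatives are regular at every zero `Q` of `s`.
      have h3 : OrdGE (v P) 0 ((φ.coeff i : F⟮s⟯) : K) := by
        rw [hφA, coeff_map]
        exact (hA _).mp ((minpoly A y).coeff i).2
      obtain ⟨p, q, hq, hpq⟩ := h.exists_eq_div_of_regular hst hP (φ.coeff i).2 h3
      rw [hpq]
      exact (h.derivation_regular D hD (hS Q hQ) hq).2
    rw [OrdGE.mul_iff hDy] at h2
    exact (h2.mul hzt).mono (by simp)
  obtain ⟨a, ha⟩ := hadj _ hreg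
  have hmem : z ∈ (Algebra.traceForm F⟮s⟯ K).dualSubmodule
      (Subalgebra.toSubmodule (Algebra.adjoin A {y})) := by
    rw [traceForm_dualSubmodule_adjoin A F⟮s⟯ htop hint, Submodule.mem_smul_pointwise_iff_exists]
    refine ⟨aeval y (derivative φ) * z, ?_, ?_⟩
    · rw [ha]
      exact Subalgebra.sum_mem _ fun i _ => Subalgebra.mul_mem _
        (Subalgebra.algebraMap_mem _ (a i))
        (Subalgebra.pow_mem _ (Algebra.self_mem_adjoin_singleton _ y) _)
    · rw [smul_eq_mul, inv_mul_cancel_left₀ hφ0]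
  have h1 := (LinearMap.BilinForm.mem_dualSubmodule _).mp hmem 1 (Subalgebra.one_mem _)
  rw [Algebra.traceForm_apply, mul_one] at h1
  obtain ⟨b, hb⟩ := Submodule.mem_one.mp h1
  rw [← hb]
  exact (hA _).mp b.2

/-- If `z ds` is regular at the zeros of `s` then so is the trace of `z`. -/
theorem trace_regular {s : K} (hs : IsSeparatingVariable F s) {E : IntermediateField F K}
    (hE : F⟮s⟯ = E) (D : Derivation F K K) (hD : D s = 1) {z : K}
    (hz : ∀ Q, OrdGE (v Q) 1 s → ∃ t, v Q t = exp (-1) ∧ OrdGE (v Q) (vOrd (v Q) (D t)) z)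
    {P : ι} (hP : OrdGE (v P) 1 s) : OrdGE (v P) 0 (Algebra.trace E K z : K) := by
  -- The field `E` is kept apart from `F⟮s⟯` because the applications have `s = x - c` and `s =
  -- x⁻¹`, which generate the same field as `x`.
  subst hE
  exact h.trace_regular_aux hs D hD hz hP

end IsPlaceSystem

/-! ### The degree of the divisor of a differential -/

theorem adjoin_simple_sub_algebraMap {F K : Type*} [Field F] [Field K] [Algebra F K] (x : K)
    (c : F) : F⟮x - algebraMap F K c⟯ = F⟮x⟯ := by
  apply le_antisymm
  · rw [IntermediateField.adjoin_simple_le_iff]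
    exact sub_mem (IntermediateField.mem_adjoin_simple_self F x) (F⟮x⟯.algebraMap_mem c)
  · rw [IntermediateField.adjoin_simple_le_iff]
    simpa using add_mem (IntermediateField.mem_adjoin_simple_self F (x - algebraMap F K c))
      (F⟮x - algebraMap F K c⟯.algebraMap_mem c)

theorem isSeparatingVariable_sub_algebraMap {F K : Type*} [Field F] [Field K] [Algebra F K] {x : K}
    (hx : IsSeparatingVariable F x) (c : F) : IsSeparatingVariable F (x - algebraMap F K c) := by
  refine ⟨fun ha => hx.transcendental ?_, ?_⟩
  · simpa using ha.add (isAlgebraic_algebraMap (A := K) c)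
  · rw [adjoin_simple_sub_algebraMap]; exact hx.separable

theorem isSeparatingVariable_inv {F K : Type*} [Field F] [Field K] [Algebra F K] {x : K}
    (hx : IsSeparatingVariable F x) : IsSeparatingVariable F x⁻¹ := by
  refine ⟨transcendental_inv hx.transcendental, ?_⟩
  rw [adjoin_simple_inv]; exact hx.separable

namespace IsPlaceSystem

variable {F K ι : Type*} [Field F] [Field K] [Algebra F K] {v : ι → Valuation K ℤᵐ⁰}
  (h : IsPlaceSystem F v)

include h in
theorem exists_pole {x : K} (hx : Transcendental F x) :
    ∃ P, ¬ OrdGE (v P) 0 x := by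
  by_contra! hc
  obtain ⟨c, rfl⟩ := h.mem_range x hc
  exact hx (isAlgebraic_algebraMap c)

variable [IsAlgClosed F]

/-- Where `x` and all `D u`, for `u` among the generators, have order zero, `D` preserves the local
ring, so `D t` is regular; conversely `1 = D x` has order at least that of `D t`. -/
theorem finite_support_derivation (D : Derivation F K K) {x : K} (hD : D x = 1) :
    {P | -vOrd (v P) (D (h.uniformizer P).choose) ≠ 0}.Finite := by
  obtain ⟨T, hT⟩ := h.generators
  have hfin : ((⋃ u ∈ T, {P | vOrd (v P) (D u) ≠ 0}) ∪ {P | vOrd (v P) x ≠ 0}).Finite :=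
    (T.finite_toSet.biUnion fun u _ => h.finite_support (D u)).union (h.finite_support x)
  refine hfin.subset fun P hP => ?_
  by_contra hc
  have hc1 : ∀ u ∈ T, vOrd (v P) (D u) = 0 := fun u hu => by
    by_contra hne
    exact hc (Or.inl (Set.mem_biUnion hu hne))
  have hc2 : vOrd (v P) x = 0 := by
    by_contra hne
    exact hc (Or.inr hne)
  have ht := (h.uniformizer P).choose_spec
  set t := (h.uniformizer P).choose
  have hDt : D t ≠ 0 := h.derivation_uniformizer_ne_zero P D (x := x) (by simp [hD]) ht
  have h1 := h.derivation_bound P D (hT P) (m := 0) (fun u hu => hc1 u hu ▸ OrdGE.self _)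
    (f := t) (OrdGE.mono (m := 1) ht.le zero_le_one)
  have h2 := h.ordGE_derivation P D ht (OrdGE.self (D t)) (f := x) (hc2 ▸ OrdGE.self x)
  rw [hD, ordGE_iff one_ne_zero, vOrd_one] at h2
  rw [ordGE_iff hDt] at h1
  refine hP ?_
  change -vOrd (v P) (D t) = 0
  omega

/-- The divisor of the differential `dx`, given by the derivation `D = d/dx`. -/
noncomputable def canonical (D : Derivation F K K) {x : K} (hD : D x = 1) : ι →₀ ℤ :=
  Finsupp.ofSupportFinite (fun P => -vOrd (v P) (D (h.uniformizer P).choose))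
    (h.finite_support_derivation D hD)

theorem canonical_apply (D : Derivation F K K) {x : K} (hD : D x = 1) {P : ι} {t : K}
    (ht : v P t = exp (-1)) : h.canonical D hD P = -vOrd (v P) (D t) := by
  change -vOrd (v P) (D (h.uniformizer P).choose) = _
  rw [h.vOrd_derivation_eq P D (x := x) (by simp [hD]) ht (c := 0) (t' := (h.uniformizer P).choose)]
  simpa using (h.uniformizer P).choose_spec

/-- Where `x` is regular, use `s = x - x(P)`. At a pole use `s = x⁻¹`, whose derivation is `-x² D`:
the square accounts for the `2` in `k + 2`, and the factor `x ^ (-k)`, which commutes with the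
trace, accounts for `k`. -/
theorem trace_mem_rr {x : K} (hx : IsSeparatingVariable F x) (D : Derivation F K K) (hD : D x = 1)
    (k : ℤ) {z : K} (hz : z ∈ h.rr (h.canonical D hD + (k + 2) • h.poles x)) :
    (Algebra.trace F⟮x⟯ K z : K) ∈ h.rr (k • h.poles x) := by
  have hx0 := ne_zero_of_transcendental hx.transcendental
  intro P
  choose t ht using h.uniformizer
  by_cases hP : OrdGE (v P) 0 x
  · obtain ⟨c, hc⟩ := h.residue P x hP
    have hpol : ∀ Q, OrdGE (v Q) 1 (x - algebraMap F K c) → h.poles x Q = 0 := fun Q hQ => by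
      have := (hQ.mono zero_le_one).add (h.const Q c)
      rw [sub_add_cancel, ordGE_iff hx0] at this
      simpa using this
    have := h.trace_regular (isSeparatingVariable_sub_algebraMap hx c)
      (adjoin_simple_sub_algebraMap x c) D (by simp [hD]) (z := z) (fun Q hQ => ⟨t Q, ht Q, ?_⟩) hc
    · simpa [-poles_apply, hpol P hc] using this
    · have := hz Q
      simpa [-poles_apply, hpol Q hQ, h.canonical_apply D hD (ht Q)] using this
  · let D' : Derivation F K K := (-x ^ 2) • D
    have hD' : D' x⁻¹ = 1 := by
      simp only [D', Derivation.smul_apply, Derivation.leibniz_inv, hD, smul_eq_mul]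
      field_simp
    have hpol : ∀ Q, OrdGE (v Q) 1 x⁻¹ → h.poles x Q = -vOrd (v Q) x := fun Q hQ => by
      rw [ordGE_iff (inv_ne_zero hx0), vOrd_inv] at hQ
      rw [poles_apply]; omega
    have hP' : OrdGE (v P) 1 x⁻¹ := by
      rw [ordGE_iff hx0] at hP
      rw [ordGE_iff (inv_ne_zero hx0), vOrd_inv]
      omega
    have hxk := zpow_ne_zero (-k) hx0
    have := h.trace_regular (isSeparatingVariable_inv hx) (adjoin_simple_inv x) D' hD'
      (z := x ^ (-k) * z) (fun Q hQ => ⟨t Q, ht Q, ?_⟩) hP'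
    · have h1 : x ^ (-k) * z = ((IntermediateField.AdjoinSimple.gen F x) ^ (-k) : F⟮x⟯) • z := by
        rw [Algebra.smul_def]; simp
      rw [h1, map_smul, smul_eq_mul] at this
      have h2 : (((IntermediateField.AdjoinSimple.gen F x) ^ (-k) * Algebra.trace F⟮x⟯ K z : F⟮x⟯) : K)
          = x ^ (-k) * (Algebra.trace F⟮x⟯ K z : K) := by
        rw [IntermediateField.coe_mul]
        congr 1
      rw [h2, OrdGE.mul_iff hxk, vOrd_zpow] at this
      refine this.mono ?_
      rw [Finsupp.smul_apply, hpol P hP', smul_eq_mul]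
      linarith
    · have hDt : D (t Q) ≠ 0 := h.derivation_uniformizer_ne_zero Q D (x := x) (by simp [hD]) (ht Q)
      have h2 : vOrd (v Q) (D' (t Q)) = 2 * vOrd (v Q) x + vOrd (v Q) (D (t Q)) := by
        simp only [D', Derivation.smul_apply, smul_eq_mul]
        rw [vOrd_mul (neg_ne_zero.mpr (pow_ne_zero 2 hx0)) hDt, vOrd_neg, vOrd_pow]
        norm_num
      rw [OrdGE.mul_iff hxk, vOrd_zpow, h2]
      refine (hz Q).mono ?_
      rw [Finsupp.add_apply, Finsupp.smul_apply, hpol Q hQ, smul_eq_mul,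
        h.canonical_apply D hD (ht Q)]
      linarith

theorem rr_eq_bot_of_neg {x : K} (hx : Transcendental F x) {k : ℤ} (hk : k < 0) :
    h.rr (k • h.poles x) = ⊥ := by
  rw [eq_bot_iff]
  intro f hf
  have hnn := h.poles_nonneg x
  obtain ⟨c, rfl⟩ := h.mem_range f fun P => (hf P).mono (by
    have := hnn P
    simp only [Finsupp.coe_zero, Pi.zero_apply] at this
    rw [Finsupp.smul_apply, smul_eq_mul]
    nlinarith)
  obtain ⟨P, hP⟩ := h.exists_pole hx
  rw [ordGE_iff (ne_zero_of_transcendental hx)] at hP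
  have := h.const_eq_zero P (c := c) ((hf P).mono (by
    rw [Finsupp.smul_apply, smul_eq_mul, poles_apply, max_eq_left (by omega)]
    nlinarith))
  simp [this]

/-- Functions that are independent over `F` modulo functions with smaller poles are independent
over `F(x)`. -/
theorem finrank_rr_inf_le {x : K} (hx : Transcendental F x) (k : ℤ) (U : Submodule F⟮x⟯ K) :
    Module.finrank F (h.rr (k • h.poles x) ⊓ U.restrictScalars F : Submodule F K) ≤
      Module.finrank F (h.rr ((k - 1) • h.poles x) ⊓ U.restrictScalars F : Submodule F K) +
        Module.finrank F⟮x⟯ U := by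
  have hx0 := ne_zero_of_transcendental hx
  have := h.finite x hx
  set B : Submodule F K := h.rr (k • h.poles x) ⊓ U.restrictScalars F with hB
  set A : Submodule F K := h.rr ((k - 1) • h.poles x) ⊓ U.restrictScalars F with hA
  have : Module.Finite F B := Submodule.finiteDimensional_of_le inf_le_left
  have hAB : A ≤ B := inf_le_inf_right _ (h.rr_mono (by
    intro P
    have : 0 ≤ h.poles x P := h.poles_nonneg x P
    simp only [Finsupp.smul_apply, smul_eq_mul]
    nlinarith))
  rw [← Submodule.finrank_quotient_add_finrank (A.submoduleOf B), add_comm,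
    (Submodule.submoduleOfEquivOfLe hAB).finrank_eq]
  gcongr
  let b := Module.finBasis F (B ⧸ A.submoduleOf B)
  choose u hu using fun i => (A.submoduleOf B).mkQ_surjective (b i)
  have hli : LinearIndependent F⟮x⟯ fun i => (⟨(u i : K), (u i).2.2⟩ : U) := by
    rw [Fintype.linearIndependent_iff]
    intro g hg
    have hg' : ∑ i, (g i : K) * (u i : K) = 0 := by
      have := congr(($hg : K))
      simpa [Algebra.smul_def] using this
    by_contra! hne
    obtain ⟨j, hj⟩ := hne
    -- Make the relation primitive in `x⁻¹`. At a pole of `x` the terms divisible by `x⁻¹` have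
    -- smaller poles, and at zeros of `x` the condition does not depend on `k`. So the constant
    -- terms are an `F`-relation modulo `A`.
    obtain ⟨w, r, -, hr, i, hi⟩ := exists_primitive_multiple (transcendental_inv hx)
      (fun i => (⟨g i, (adjoin_simple_inv (F := F) x).symm ▸ (g i).2⟩ : F⟮x⁻¹⟯)) (fun h0 => hj (by
        have := congrArg Subtype.val (congrFun h0 j)
        exact Subtype.ext this))
    have hrel : ∑ i, aeval x⁻¹ (r i) * (u i : K) = 0 := by
      have h1 : ∀ i, aeval x⁻¹ (r i) = (w : K) * g i := fun i => by rw [← hr i]; rfl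
      simp only [h1, mul_assoc]
      rw [← Finset.mul_sum, hg', mul_zero]
    have hmem : ∑ i, (r i).coeff 0 • (u i : K) ∈ A := by
      refine ⟨fun P => ?_, ?_⟩
      · by_cases hP : OrdGE (v P) 0 x⁻¹
        · have h2 : ∑ i, (r i).coeff 0 • (u i : K) =
              -∑ i, (aeval x⁻¹ (r i) - algebraMap F K ((r i).coeff 0)) * (u i : K) := by
            simp only [sub_mul, Finset.sum_sub_distrib, hrel, zero_sub, neg_neg, Algebra.smul_def]
          rw [h2]
          refine (OrdGE.sum fun i _ => ?_).neg
          refine ((h.aeval_sub_coeff P hP (r i)).mul ((u i).2.1 P)).mono ?_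
          rw [ordGE_iff (inv_ne_zero hx0), vOrd_inv] at hP
          simp only [Finsupp.smul_apply, smul_eq_mul, poles_apply, max_eq_left hP, vOrd_inv]
          linarith
        · refine OrdGE.sum fun i _ => ?_
          rw [Algebra.smul_def]
          refine (h.const P _).mul_left (((u i).2.1 P).mono ?_)
          rw [ordGE_iff (inv_ne_zero hx0), vOrd_inv] at hP
          simp [max_eq_right (not_le.mp hP).le]
      · exact Submodule.sum_mem _ fun i _ => Submodule.smul_mem (U.restrictScalars F) _ (u i).2.2
    have hq : ∑ i, (r i).coeff 0 • b i = 0 := by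
      have h3 : ∑ i, (r i).coeff 0 • b i =
          (A.submoduleOf B).mkQ (∑ i, (r i).coeff 0 • u i) := by simp [hu]
      rw [h3, Submodule.mkQ_apply, Submodule.Quotient.mk_eq_zero]
      change ((∑ i, (r i).coeff 0 • u i : B) : K) ∈ A
      simpa using hmem
    exact hi (Fintype.linearIndependent_iff.mp b.linearIndependent _ hq i)
  simpa using hli.fintype_card_le_finrank

/-- These are in effect the polynomials in `x` of degree less than `k`. Each step of the induction
adds at most the dimension of a line over `F(x)`. -/
theorem finrank_rr_inf_span_one_le {x : K} (hx : Transcendental F x) (k : ℕ) :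
    Module.finrank F (h.rr (((k : ℤ) - 1) • h.poles x) ⊓
      (Submodule.span F⟮x⟯ {(1 : K)}).restrictScalars F : Submodule F K) ≤ k := by
  induction k with
  | zero => rw [h.rr_eq_bot_of_neg hx (by norm_num), bot_inf_eq, finrank_bot]
  | succ k ih =>
    refine (h.finrank_rr_inf_le hx _ _).trans ?_
    have h1 : Module.finrank F⟮x⟯ (Submodule.span F⟮x⟯ {(1 : K)}) ≤ 1 := by
      simpa using finrank_span_le_card (R := F⟮x⟯) ({1} : Set K)
    have h2 : (((k + 1 : ℕ) : ℤ) - 1) - 1 = k - 1 := by push_cast; ring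
    rw [h2]
    omega

/-- A basis of `K` over `F(x)` that consists of functions without poles outside the poles of `x`,
with minimal sum of the pole orders. -/
theorem exists_reduced_basis {x : K} (hx : Transcendental F x) :
    ∃ (b : Module.Basis (Fin (Module.finrank F⟮x⟯ K)) F⟮x⟯ K) (δ : Fin (Module.finrank F⟮x⟯ K) → ℕ),
      (∀ i, b i ∈ h.rr (δ i • h.poles x)) ∧ ∀ m : ℕ,
        Module.finrank F (h.rr (m • h.poles x)) ≤
          ∑ j ∈ Finset.range (m + 1), (Finset.univ.filter fun i => δ i ≤ j).card := by
  classical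
  have := h.finite x hx
  set n := Module.finrank F⟮x⟯ K with hn
  have hnpos : 0 < n := Module.finrank_pos
  have : Nonempty (Fin n) := ⟨⟨0, hnpos⟩⟩
  have hex : ∃ N, ∃ (b : Fin n → K) (δ : Fin n → ℕ), LinearIndependent F⟮x⟯ b ∧
      (∀ i, b i ∈ h.rr (δ i • h.poles x)) ∧ ∑ i, δ i = N := by
    obtain ⟨b, m, hb⟩ := h.exists_basis_mem_rr hx
    exact ⟨_, b, fun _ => m, b.linearIndependent, hb, rfl⟩
  obtain ⟨b, δ, hli, hmem, hsum⟩ := Nat.find_spec hex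
  let B := basisOfLinearIndependentOfCardEqFinrank hli (by simp [hn])
  have hB : ⇑B = b := by simp [B]
  refine ⟨B, δ, by rwa [hB], ?_⟩
  -- If a function with poles bounded by `m` involved some `b i` with `δ i > m`, exchanging `b i`
  -- for it would give a basis with a smaller sum.
  have hspan : ∀ m : ℕ, h.rr (m • h.poles x) ≤
      (Submodule.span F⟮x⟯ (B '' {i | δ i ≤ m})).restrictScalars F := by
    intro m u hu
    change u ∈ Submodule.span F⟮x⟯ (B '' {i | δ i ≤ m})
    rw [Module.Basis.mem_span_image]
    intro i hi
    by_contra hlt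
    have hlt' : m < δ i := by simpa using hlt
    have hli' : LinearIndependent F⟮x⟯ (Function.update b i u) := by
      refine hli.update i u ⟨1, one_mem _, B.repr u, ?_, ?_⟩
      · exact mem_nonZeroDivisors_of_ne_zero (Finsupp.mem_support_iff.mp hi)
      · rw [one_smul, ← hB, Module.Basis.linearCombination_repr]
    refine Nat.find_min hex (m := ∑ j, Function.update δ i m j) ?_
      ⟨_, Function.update δ i m, hli', fun j => ?_, rfl⟩
    · rw [← hsum]
      refine Finset.sum_lt_sum (fun j _ => ?_) ⟨i, Finset.mem_univ i, by simpa using hlt'⟩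
      by_cases hj : j = i
      · subst hj; simpa using hlt'.le
      · simp [hj]
    · by_cases hj : j = i
      · subst hj; simpa using hu
      · simpa [hj] using hmem j
  have hstep : ∀ m : ℕ, Module.finrank F (h.rr (m • h.poles x)) ≤
      Module.finrank F (h.rr (((m : ℤ) - 1) • h.poles x)) +
        (Finset.univ.filter fun i => δ i ≤ m).card := fun m => by
    have h1 := h.finrank_rr_inf_le hx m (Submodule.span F⟮x⟯ (B '' {i | δ i ≤ m}))
    rw [natCast_zsmul, inf_eq_left.mpr (hspan m)] at h1
    refine h1.trans (add_le_add (Submodule.finrank_mono inf_le_left) ?_)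
    refine (finrank_span_le_card _).trans ?_
    rw [← Set.ncard_eq_toFinset_card']
    refine (Set.ncard_image_le (Set.toFinite _)).trans ?_
    rw [Set.ncard_eq_toFinset_card']
    simp
  intro m
  induction m with
  | zero =>
    refine (hstep 0).trans ?_
    rw [h.rr_eq_bot_of_neg hx (by norm_num), finrank_bot]
    simp
  | succ m ih =>
    refine (hstep (m + 1)).trans ?_
    have h2 : ((m + 1 : ℕ) : ℤ) - 1 = m := by push_cast; ring
    rw [Finset.sum_range_succ, h2, natCast_zsmul]
    gcongr

/-- The degree of the divisor of a differential is at most `2 g - 2`. -/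
theorem degree_canonical_le {x : K} (hx : IsSeparatingVariable F x) (D : Derivation F K K)
    (hD : D x = 1) {g : ℤ} (hg : ∀ A : ι →₀ ℤ, A.degree + 1 - Module.finrank F (h.rr A) ≤ g) :
    (h.canonical D hD).degree ≤ 2 * g - 2 := by
  have hxt := hx.transcendental
  have := h.finite x hxt
  have := hx.separable
  obtain ⟨b, δ, hb, hcount⟩ := h.exists_reduced_basis hxt
  -- For `m` at least all `δ i`, the count gives `ℓ(m (x)_∞) ≤ n (m + 1) - ∑ δ i`, where `n = [K :
  -- F(x)]`. The genus inequality for `m (x)_∞` turns this into a bound for the sum; `m = ∑ δ i` is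
  -- large enough.
  have hsum : ((∑ i, δ i : ℕ) : ℤ) ≤ Module.finrank F⟮x⟯ K - 1 + g := by
    set m := ∑ i, δ i with hm
    have h1 := hcount m
    have h2 : ∑ j ∈ Finset.range (m + 1), (Finset.univ.filter fun i => δ i ≤ j).card =
        ∑ i, (m + 1 - δ i) := by
      simp only [Finset.card_filter]
      rw [Finset.sum_comm]
      refine Finset.sum_congr rfl fun i _ => ?_
      rw [← Finset.card_filter, Finset.range_eq_Ico, Finset.Ico_filter_le, Nat.card_Ico]
      simp
    have h3 : ((∑ i, (m + 1 - δ i) : ℕ) : ℤ) = Module.finrank F⟮x⟯ K * (m + 1) - m := by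
      have : ∀ i, ((m + 1 - δ i : ℕ) : ℤ) = (m + 1) - δ i := fun i => by
        have : δ i ≤ m := Finset.single_le_sum (f := δ) (by simp) (Finset.mem_univ i)
        omega
      rw [Nat.cast_sum, Finset.sum_congr rfl fun i _ => this i, Finset.sum_sub_distrib, hm]
      simp
    have h4 := hg (m • h.poles x)
    rw [map_nsmul, h.degree_poles hxt, nsmul_eq_mul] at h4
    rw [h2] at h1
    have h5 : (Module.finrank F (h.rr (m • h.poles x)) : ℤ) ≤
        Module.finrank F⟮x⟯ K * (m + 1) - m := by
      rw [← h3]; exact_mod_cast h1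
    linarith
  let V : Fin (Module.finrank F⟮x⟯ K) → Submodule F K := fun i => h.rr (((δ i : ℤ) - 1) • h.poles x) ⊓
    (Submodule.span F⟮x⟯ {(1 : K)}).restrictScalars F
  -- For `f` in `L(W + (x)_∞)` the trace of `f * b i` has poles bounded by `δ i - 1`, hence lies in
  -- a space of dimension at most `δ i`. The trace form is nondegenerate, so `f` is determined by
  -- these traces and the dimension is at most `∑ δ i`; the genus inequality for `W + (x)_∞`
  -- concludes.
  let R := h.rr (h.canonical D hD + h.poles x)
  have hV : ∀ (f : R) (i), (Algebra.trace F⟮x⟯ K ((f : K) * b i) : K) ∈ V i := fun f i => by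
    refine ⟨h.trace_mem_rr hx D hD _ ?_, ?_⟩
    · have := h.mul_mem_rr f.2 (hb i)
      convert this using 2
      rw [add_assoc]
      congr 1
      ext P
      simp only [Finsupp.smul_apply, Finsupp.add_apply, smul_eq_mul, nsmul_eq_mul]
      ring
    · change _ ∈ Submodule.span F⟮x⟯ {(1 : K)}
      exact Submodule.mem_span_singleton.mpr ⟨_, by rw [Algebra.smul_def, mul_one]; rfl⟩
  let T : K →ₗ[F] F⟮x⟯ := (Algebra.trace F⟮x⟯ K).restrictScalars F
  let Φ : R →ₗ[F] (∀ i, V i) := LinearMap.pi fun i =>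
    LinearMap.codRestrict (V i)
      (F⟮x⟯.val.toLinearMap ∘ₗ T ∘ₗ (LinearMap.mulRight F (b i)) ∘ₗ R.subtype) (hV · i)
  have hΦ : Function.Injective Φ := by
    rw [← LinearMap.ker_eq_bot, LinearMap.ker_eq_bot']
    intro f hf
    have h1 : ∀ i, Algebra.traceForm F⟮x⟯ K (f : K) (b i) = 0 := fun i => by
      have := congrArg Subtype.val (congrFun hf i)
      exact Subtype.ext this
    have h2 : Algebra.traceForm F⟮x⟯ K (f : K) = 0 := b.ext fun i => by rw [h1 i]; rfl
    exact Subtype.ext ((LinearMap.separatingLeft_iff_ker_eq_bot.mp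
      (traceForm_nondegenerate F⟮x⟯ K).1).le h2)
  have hVfin : ∀ i, Module.Finite F (V i) := fun i => Submodule.finiteDimensional_of_le inf_le_left
  have h6 := LinearMap.finrank_le_finrank_of_injective hΦ
  rw [Module.finrank_pi_fintype] at h6
  have h7 : Module.finrank F R ≤ ∑ i, δ i :=
    h6.trans (Finset.sum_le_sum fun i _ => h.finrank_rr_inf_span_one_le hxt (δ i))
  have h8 := hg (h.canonical D hD + h.poles x)
  rw [map_add, h.degree_poles hxt] at h8
  have h9 : (Module.finrank F R : ℤ) ≤ ((∑ i, δ i : ℕ) : ℤ) := by exact_mod_cast h7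
  change _ + _ - (Module.finrank F R : ℤ) ≤ g at h8
  linarith

end IsPlaceSystem

/-! ### Lexicographically minimal nonvanishing minors -/

section Minors

/-- At the first index where the tuples differ, the sorted one has the least of the remaining
values. -/
theorem toLex_comp_sort_le {r : ℕ} {f : Fin r → ℕ} (hf : Function.Injective f) :
    toLex (f ∘ Tuple.sort f) ≤ toLex f := by
  by_contra hlt
  obtain ⟨s, hs1, hs2⟩ := not_le.mp hlt
  have hs1' : ∀ t < s, Tuple.sort f t = t := fun t ht => (hf (hs1 t ht)).symm
  have hs2' : f s < f (Tuple.sort f s) := hs2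
  obtain ⟨u, hu⟩ := (Tuple.sort f).surjective s
  have hus : s ≤ u := by
    by_contra hc
    rw [hs1' u (not_le.mp hc)] at hu
    exact (not_le.mp hc).ne hu
  have := Tuple.monotone_sort f hus
  simp only [Function.comp_apply, hu] at this
  exact absurd this (not_le.mpr hs2')

variable {K : Type*} [Field K]

theorem det_eq_prod_mul_det {N : ℕ} (M M' : Fin N → Fin N → K) (g : Fin N → K)
    (h : ∀ a, M' a - g a • M a ∈ Submodule.span K (M '' {b | b < a})) :
    (Matrix.of M').det = (∏ a, g a) * (Matrix.of M).det := by
  classical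
  have h' : ∀ a, ∃ c : Fin N → K, (∀ b, a ≤ b → c b = 0) ∧
      M' a = g a • M a + ∑ b, c b • M b := by
    intro a
    obtain ⟨l, hl, hl'⟩ := (Finsupp.mem_span_image_iff_linearCombination K).mp (h a)
    refine ⟨l, fun b hab => ?_, ?_⟩
    · by_contra hne
      exact absurd ((Finsupp.mem_supported K l).mp hl (Finsupp.mem_support_iff.mpr hne))
        (not_lt.mpr hab)
    · rw [← sub_eq_iff_eq_add', ← hl', Finsupp.linearCombination_apply, Finsupp.sum_fintype]
      simp
  choose c hc hM using h'
  let L : Matrix (Fin N) (Fin N) K := Matrix.of fun a b => (if a = b then g a else 0) + c a b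
  have hL : Matrix.of M' = L * Matrix.of M := by
    ext a j
    rw [Matrix.of_apply, hM a, Matrix.mul_apply]
    simp [L, add_mul, Finset.sum_add_distrib]
  rw [hL, Matrix.det_mul, Matrix.det_of_isLowerTriangular L]
  · congr 1
    refine Finset.prod_congr rfl fun a _ => ?_
    simp [L, hc a a le_rfl]
  · intro a b hab
    have hab' : a < b := hab
    simp [L, hab'.ne, hc a b hab'.le]

variable {r : ℕ}

/-- The vectors `R` and `d (m i)`. -/
def minorRows (R : Fin (r + 1) → K) (d : ℕ → Fin (r + 1) → K) (m : Fin r → ℕ) :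
    Fin (r + 1) → Fin (r + 1) → K :=
  Fin.cons R fun i => d (m i)

theorem det_minorRows_ne_zero_iff (R : Fin (r + 1) → K) (d : ℕ → Fin (r + 1) → K) (m : Fin r → ℕ) :
    (Matrix.of (minorRows R d m)).det ≠ 0 ↔ LinearIndependent K (minorRows R d m) := by
  rw [← isUnit_iff_ne_zero, ← Matrix.isUnit_iff_isUnit_det, ← Matrix.linearIndependent_rows_iff_isUnit]
  rfl

/-- The set of increasing tuples for which the minor does not vanish. -/
def minorSet (R : Fin (r + 1) → K) (d : ℕ → Fin (r + 1) → K) : Set (Lex (Fin r → ℕ)) :=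
  {m | StrictMono (ofLex m) ∧ (Matrix.of (minorRows R d (ofLex m))).det ≠ 0}

/-- Exchange argument: if the expansion of `d m` in the rows involved a row `ν i` with `i ≥ j`,
replacing `ν i` by `m` would keep the rows independent, and the sorted new tuple would be
lexicographically smaller than `ν`. -/
theorem mem_span_of_isLeast {R : Fin (r + 1) → K} {d : ℕ → Fin (r + 1) → K} {ν : Fin r → ℕ}
    (hν : IsLeast (minorSet R d) (toLex ν)) (j : Fin r) {m : ℕ} (hm : m < ν j) :
    d m ∈ Submodule.span K (minorRows R d ν '' {b | b < j.succ}) := by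
  classical
  have hli := (det_minorRows_ne_zero_iff R d ν).mp hν.1.2
  let B := basisOfLinearIndependentOfCardEqFinrank hli (by simp)
  have hB : ⇑B = minorRows R d ν := by simp [B]
  rw [← hB, Module.Basis.mem_span_image]
  by_contra hns
  obtain ⟨a, ha, haj⟩ := Set.not_subset.mp hns
  have haj' : j.succ ≤ a := not_lt.mp haj
  -- Index `0` is the row `R`, which is always allowed in the span; the offending index is a
  -- derivative row.
  obtain ⟨i, rfl⟩ := Fin.exists_succ_eq.mpr (ne_of_gt (lt_of_lt_of_le (Fin.succ_pos j) haj'))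
  have hji : j ≤ i := Fin.succ_le_succ_iff.mp haj'
  have hli' : LinearIndependent K (Function.update (minorRows R d ν) i.succ (d m)) := by
    refine hli.update i.succ (d m) ⟨1, one_mem _, B.repr (d m), ?_, ?_⟩
    · exact mem_nonZeroDivisors_of_ne_zero (Finsupp.mem_support_iff.mp ha)
    · rw [one_smul, ← hB, Module.Basis.linearCombination_repr]
  set f := Function.update ν i m with hf
  have hupd : Function.update (minorRows R d ν) i.succ (d m) = minorRows R d f := by
    funext b
    refine Fin.cases ?_ (fun b => ?_) b
    · rw [Function.update_of_ne (Fin.succ_ne_zero i).symm]; rfl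
    · by_cases hb : b = i
      · subst hb
        rw [Function.update_self]
        change _ = d (f b)
        rw [hf, Function.update_self]
      · rw [Function.update_of_ne (fun h => hb (Fin.succ_injective _ h))]
        change d (ν b) = d (f b)
        rw [hf, Function.update_of_ne hb]
  rw [hupd] at hli'
  have hfinj : Function.Injective f := fun b b' hbb => by
    refine Fin.succ_injective _ (hli'.injective ?_)
    change d (f b) = d (f b')
    rw [hbb]
  have hmem : toLex (f ∘ Tuple.sort f) ∈ minorSet R d := by
    refine ⟨(Tuple.monotone_sort f).strictMono_of_injective
      (hfinj.comp (Tuple.sort f).injective), (det_minorRows_ne_zero_iff _ _ _).mpr ?_⟩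
    let g : Fin (r + 1) → Fin (r + 1) := Fin.cons 0 fun i => (Tuple.sort f i).succ
    have hg : Function.Injective g := Fin.cons_injective_iff.mpr
      ⟨fun ⟨i, hi⟩ => Fin.succ_ne_zero _ hi, (Fin.succ_injective _).comp (Tuple.sort f).injective⟩
    have hcomp : minorRows R d (f ∘ Tuple.sort f) = minorRows R d f ∘ g := by
      funext b
      refine Fin.cases ?_ (fun b => ?_) b <;> rfl
    have := hli'.comp g hg
    rw [← hcomp] at this
    exact this
  have h1 := hν.2 hmem
  have h2 : toLex f < toLex ν := Pi.toLex_update_lt_self_iff.mpr (hm.trans_le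
    (hν.1.1.monotone hji))
  exact absurd h1 (not_le.mpr ((toLex_comp_sort_le hfinj).trans_lt h2))

/-- `d'` arises from `d` by a triangular substitution modulo `R`, with diagonal entries `γ`. -/
def IsTriangular (R : Fin (r + 1) → K) (d d' : ℕ → Fin (r + 1) → K) (γ : ℕ → K) : Prop :=
  ∀ m, d' m - γ m • d m ∈ Submodule.span K (insert R (d '' Set.Iio m))

theorem IsTriangular.of_sum {R : Fin (r + 1) → K} {d d' : ℕ → Fin (r + 1) → K} (c : ℕ → ℕ → K)
    (e : ℕ → K) (h : ∀ m, d' m = ∑ i ∈ Finset.range (m + 1), c m i • d i + e m • R) :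
    IsTriangular R d d' fun m => c m m := by
  intro m
  have : d' m - c m m • d m = ∑ i ∈ Finset.range m, c m i • d i + e m • R := by
    rw [h m, Finset.sum_range_succ]; abel
  rw [this]
  refine Submodule.add_mem _ (Submodule.sum_mem _ fun i hi => Submodule.smul_mem _ _
    (Submodule.subset_span (Or.inr ⟨i, Finset.mem_range.mp hi, rfl⟩)))
    (Submodule.smul_mem _ _ (Submodule.subset_span (Or.inl rfl)))

theorem IsTriangular.trans {R : Fin (r + 1) → K} {d d' d'' : ℕ → Fin (r + 1) → K} {γ γ' : ℕ → K}
    (h : IsTriangular R d d' γ) (h' : IsTriangular R d' d'' γ') :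
    IsTriangular R d d'' fun m => γ' m * γ m := by
  intro m
  have hle : Submodule.span K (insert R (d' '' Set.Iio m)) ≤
      Submodule.span K (insert R (d '' Set.Iio m)) := by
    rw [Submodule.span_le]
    rintro _ (rfl | ⟨i, hi, rfl⟩)
    · exact Submodule.subset_span (Or.inl rfl)
    · have h1 : Submodule.span K (insert R (d '' Set.Iio i)) ≤
          Submodule.span K (insert R (d '' Set.Iio m)) :=
        Submodule.span_mono (Set.insert_subset_insert (Set.image_mono
          (Set.Iio_subset_Iio (le_of_lt hi))))
      have h2 := Submodule.add_mem _ (h1 (h i)) (Submodule.smul_mem _ (γ i)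
        (Submodule.subset_span (Or.inr ⟨i, hi, rfl⟩)))
      rwa [sub_add_cancel] at h2
  have := Submodule.add_mem _ (hle (h' m)) (Submodule.smul_mem _ (γ' m) (h m))
  convert this using 1
  rw [smul_sub, smul_smul]
  abel

/-- The substitution brings in rows `d m` that are not among the chosen ones. By minimality of `ν`
they lie in the span of the preceding rows, so the change is triangular on the minor itself. -/
theorem IsTriangular.det_eq {R : Fin (r + 1) → K} {d d' : ℕ → Fin (r + 1) → K} {γ : ℕ → K}
    (h : IsTriangular R d d' γ) {ν : Fin r → ℕ} (hν : IsLeast (minorSet R d) (toLex ν)) (ρ : K) :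
    (Matrix.of (minorRows (ρ • R) d' ν)).det = ρ * (∏ i, γ (ν i)) * (Matrix.of (minorRows R d ν)).det := by
  rw [det_eq_prod_mul_det (minorRows R d ν) (minorRows (ρ • R) d' ν)
    (Fin.cons ρ fun i => γ (ν i)), Fin.prod_univ_succ]
  · simp
  · intro a
    refine Fin.cases ?_ (fun j => ?_) a
    · change ρ • R - ρ • R ∈ _
      rw [sub_self]
      exact Submodule.zero_mem _
    · change d' (ν j) - γ (ν j) • d (ν j) ∈ _
      refine Submodule.span_le.mpr ?_ (h (ν j))
      rintro _ (rfl | ⟨m, hm, rfl⟩)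
      · exact Submodule.subset_span ⟨0, Fin.succ_pos j, rfl⟩
      · exact mem_span_of_isLeast hν j hm

end Minors

/-! ### Local integrality of Hasse derivatives -/

section TaylorGE

variable {K : Type*} [Field K] (v : Valuation K ℤᵐ⁰)

/-- The first coefficients of the power series `a` satisfy `v(a_l) ≥ A - C l`. -/
def TaylorGE (n C : ℕ) (A : ℤ) (a : PowerSeries K) : Prop :=
  ∀ l ≤ n, OrdGE v (A - C * l) (PowerSeries.coeff l a)

variable {v} {n C : ℕ}

theorem TaylorGE.mul {A A' : ℤ} {a a' : PowerSeries K} (h : TaylorGE v n C A a)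
    (h' : TaylorGE v n C A' a') : TaylorGE v n C (A + A') (a * a') := by
  intro l hl
  rw [PowerSeries.coeff_mul]
  refine OrdGE.sum fun p hp => ?_
  have hp' := Finset.HasAntidiagonal.mem_antidiagonal.mp hp
  refine ((h p.1 (by omega)).mul (h' p.2 (by omega))).mono ?_
  rw [← hp']
  push_cast
  linarith

theorem TaylorGE.add {A : ℤ} {a a' : PowerSeries K} (h : TaylorGE v n C A a)
    (h' : TaylorGE v n C A a') : TaylorGE v n C A (a + a') := by
  intro l hl
  rw [map_add]
  exact (h l hl).add (h' l hl)

theorem TaylorGE.C_of {a : K} (ha : OrdGE v 0 a) : TaylorGE v n C 0 (PowerSeries.C a) := by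
  intro l _
  rw [PowerSeries.coeff_C]
  split_ifs with hl
  · simpa [hl] using ha
  · exact OrdGE.zero _

theorem TaylorGE.pow {A : ℤ} {a : PowerSeries K} (h : TaylorGE v n C A a) (N : ℕ) :
    TaylorGE v n C (N * A) (a ^ N) := by
  induction N with
  | zero =>
    have := TaylorGE.C_of (n := n) (C := C) (OrdGE.one (v := v))
    simpa using this
  | succ N ih =>
    have := ih.mul h
    rw [← pow_succ] at this
    convert this using 1
    push_cast; ring

end TaylorGE

namespace IsPlaceSystem

variable {F K ι : Type*} [Field F] [Field K] [Algebra F K] {v : ι → Valuation K ℤᵐ⁰}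
  (h : IsPlaceSystem F v)

include h

theorem algebraMap_taylorGE (P : ι) (n C : ℕ) (c : F) :
    TaylorGE (v P) n C 0 (algebraMap F (PowerSeries K) c) := by
  rw [IsScalarTower.algebraMap_apply F K (PowerSeries K)]
  exact TaylorGE.C_of (h.const P c)

/-- A bound `C l` for the pole of the `l`-th coefficient, linear in `l`, is compatible with
products, so it passes from the generators to their algebra. For a quotient `a / b` the coefficients
are found recursively from `b * (a / b) = a`. -/
theorem exists_taylorGE (P : ι) {η : K →ₐ[F] PowerSeries K}
    (hη : ∀ f, PowerSeries.constantCoeff (η f) = f) (n : ℕ) :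
    ∃ C : ℕ, ∀ f, OrdGE (v P) 0 f → TaylorGE (v P) n C 0 (η f) := by
  obtain ⟨T, hT⟩ := h.generators
  let C : ℕ := ∑ u ∈ T, ∑ l ∈ Finset.range (n + 1), (-vOrd (v P) (PowerSeries.coeff l (η u))).toNat
  have hC : ∀ u ∈ T, ∀ l ≤ n, -vOrd (v P) (PowerSeries.coeff l (η u)) ≤ C := by
    intro u hu l hl
    have h1 := Finset.single_le_sum (f := fun l => (-vOrd (v P) (PowerSeries.coeff l (η u))).toNat)
      (by simp) (Finset.mem_range.mpr (Nat.lt_succ_of_le hl))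
    have h2 := Finset.single_le_sum (f := fun u => ∑ l ∈ Finset.range (n + 1),
      (-vOrd (v P) (PowerSeries.coeff l (η u))).toNat) (by simp) hu
    have := h1.trans h2
    omega
  refine ⟨C, fun f hf => ?_⟩
  have key : ∀ a ∈ Algebra.adjoin F {u | u ∈ T ∧ OrdGE (v P) 0 u}, TaylorGE (v P) n C 0 (η a) :=
    fun a ha => by
    induction ha using Algebra.adjoin_induction with
    | mem u hu =>
      intro l hl
      rcases Nat.eq_zero_or_pos l with rfl | hl0
      · simpa [hη] using hu.2
      · refine (OrdGE.self _).mono ?_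
        have := hC u hu.1 l hl
        have hl1 : (1 : ℤ) ≤ l := by exact_mod_cast hl0
        nlinarith
    | algebraMap c => rw [AlgHom.commutes]; exact h.algebraMap_taylorGE P n C c
    | add a b _ _ ha hb => rw [map_add]; exact ha.add hb
    | mul a b _ _ ha hb => rw [map_mul]; simpa using ha.mul hb
  obtain ⟨a, ha, b, hb, hb1, rfl⟩ := hT P f hf
  have hb0 : b ≠ 0 := (Valuation.ne_zero_iff (v P)).mp (by simp [hb1])
  have hbo : vOrd (v P) b = 0 := vOrd_eq_of (by simpa using hb1)
  have hmul : η b * η (a / b) = η a := by rw [← map_mul, mul_div_cancel₀ _ hb0]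
  intro l
  induction l using Nat.strong_induction_on with
  | _ l ih =>
    intro hl
    have h1 := congr(PowerSeries.coeff l $hmul)
    rw [PowerSeries.coeff_mul, ← Finset.add_sum_erase _ _
      (Finset.HasAntidiagonal.mem_antidiagonal.mpr (zero_add l) : ((0, l) : ℕ × ℕ) ∈ _)] at h1
    simp only [PowerSeries.coeff_zero_eq_constantCoeff, hη] at h1
    have h2 : OrdGE (v P) (0 - C * l) (b * PowerSeries.coeff l (η (a / b))) := by
      rw [eq_sub_of_add_eq h1]
      refine (key a ha l hl).sub (OrdGE.sum fun p hp => ?_)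
      obtain ⟨hp1, hp2⟩ := Finset.mem_erase.mp hp
      have hp3 := Finset.HasAntidiagonal.mem_antidiagonal.mp hp2
      have hp4 : p.2 < l := by
        rcases Nat.eq_zero_or_pos p.1 with h0 | h0
        · exact absurd (Prod.ext h0 (by simpa [h0] using hp3)) hp1
        · omega
      refine ((key b hb p.1 (by omega)).mul (ih p.2 hp4 (by omega))).mono ?_
      rw [← hp3]
      push_cast
      linarith
    rwa [OrdGE.mul_iff hb0, hbo, sub_zero] at h2

/-- Hasse derivatives with respect to a uniformizer preserve regular functions. -/
theorem taylor_regular (P : ι) {t : K} (ht : v P t = exp (-1)) {η : K →ₐ[F] PowerSeries K}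
    (hη : IsTaylorHom F t η) {f : K} (hf : OrdGE (v P) 0 f) (l : ℕ) :
    OrdGE (v P) 0 (PowerSeries.coeff l (η f)) := by
  have ht1 : OrdGE (v P) 1 t := ht.le
  obtain ⟨C, hC⟩ := h.exists_taylorGE P hη.constantCoeff l
  have hX : ∀ l', PowerSeries.coeff l' (η t) =
      if l' = 0 then t else if l' = 1 then 1 else 0 := fun l' => by
    rw [hη.apply_self, map_add, PowerSeries.coeff_C, PowerSeries.coeff_X]
    split_ifs <;> simp_all
  -- The polynomial part is harmless since `η t = t + T` has regular coefficients. The remainder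
  -- loses at most `C + 1` orders per derivative, which `C * l + l` factors `t` make up for.
  obtain ⟨p, g, hg, rfl⟩ := h.exists_expansion P ht hf (C * l + l)
  rw [map_add, map_add]
  refine OrdGE.add ?_ ?_
  · have hη0 : TaylorGE (v P) l 0 0 (η t) := fun l' _ => by
      rw [hX]
      split_ifs
      · simpa using ht1.mono zero_le_one
      · simpa using OrdGE.one
      · exact OrdGE.zero _
    have : ∀ p : F[X], TaylorGE (v P) l 0 0 (η (aeval t p)) := fun p => by
      induction p using Polynomial.induction_on' with
      | add p q hp hq => rw [map_add, map_add]; exact hp.add hq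
      | monomial n a =>
        rw [aeval_monomial, map_mul, AlgHom.commutes, map_pow]
        simpa using (h.algebraMap_taylorGE P l 0 a).mul (hη0.pow n)
    simpa using this p l le_rfl
  · have hη1 : TaylorGE (v P) l (C + 1) 1 (η t) := fun l' _ => by
      rw [hX]
      split_ifs with h0 h1
      · simpa [h0] using ht1
      · refine OrdGE.one.mono ?_
        subst h1; push_cast; linarith
      · exact OrdGE.zero _
    have hg' : TaylorGE (v P) l (C + 1) 0 (η g) := fun l' hl' => (hC g hg l' hl').mono (by
      push_cast; nlinarith)
    rw [map_mul, map_pow]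
    refine ((hη1.pow (C * l + l)).mul hg' l le_rfl).mono ?_
    push_cast; linarith

/-- At a fixed point of `φ`, the Taylor expansion evaluated at `φ t - t` gives `φ`. -/
theorem taylor_congr (P : ι) {t : K} (ht : v P t = exp (-1)) {η : K →ₐ[F] PowerSeries K}
    (hη : IsTaylorHom F t η) (φ : K →ₐ[F] K) (hφ : ∀ f, OrdGE (v P) 0 f → OrdGE (v P) 0 (φ f))
    (hφt : OrdGE (v P) 1 (φ t)) (m : ℕ) {f : K} (hf : OrdGE (v P) 0 f) :
    OrdGE (v P) (m + 1)
      (∑ i ∈ Finset.range (m + 1), (φ t - t) ^ i * PowerSeries.coeff i (η f) - φ f) := by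
  have ht1 : OrdGE (v P) 1 t := ht.le
  have ht0 := ht1.mono (n := 0) zero_le_one
  set a := φ t - t with ha
  have ha1 : OrdGE (v P) 1 a := hφt.sub ht1
  -- This is the Taylor series truncated at degree `m` and evaluated at `a`. Modulo order `m + 1`
  -- both it and `φ` respect sums and products, fix constants and agree at `t`; hence they agree on
  -- polynomials in `t`, and both make `t ^ (m + 1) * g` negligible.
  set ψ : K → K := fun f => ∑ i ∈ Finset.range (m + 1), a ^ i * PowerSeries.coeff i (η f) with hψ
  have hreg : ∀ f, OrdGE (v P) 0 f → ∀ i : ℕ, OrdGE (v P) i (a ^ i * PowerSeries.coeff i (η f)) :=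
    fun f hf i => by
      have := (ha1.pow i).mul (h.taylor_regular P ht hη hf i)
      simpa using this
  have hψreg : ∀ f, OrdGE (v P) 0 f → OrdGE (v P) 0 (ψ f) := fun f hf =>
    OrdGE.sum fun i _ => (hreg f hf i).mono (by positivity)
  have hmul : ∀ f g, OrdGE (v P) 0 f → OrdGE (v P) 0 g →
      OrdGE (v P) (m + 1) (ψ (f * g) - ψ f * ψ g) := by
    intro f g hf hg
    let G : ℕ × ℕ → K := fun p => (a ^ p.1 * PowerSeries.coeff p.1 (η f)) *
      (a ^ p.2 * PowerSeries.coeff p.2 (η g))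
    let S := (Finset.range (m + 1)) ×ˢ (Finset.range (m + 1))
    have h1 : ψ f * ψ g = ∑ p ∈ S, G p := by
      rw [Finset.sum_mul_sum, ← Finset.sum_product']
    have h2 : ψ (f * g) = ∑ p ∈ S.filter fun p => p.1 + p.2 < m + 1, G p := by
      rw [← Finset.sum_fiberwise_of_maps_to (t := Finset.range (m + 1)) (g := fun p : ℕ × ℕ => p.1 + p.2)
        (fun p hp => Finset.mem_range.mpr (Finset.mem_filter.mp hp).2)]
      refine Finset.sum_congr rfl fun l hl => ?_
      rw [map_mul, PowerSeries.coeff_mul, Finset.mul_sum]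
      have hS : ((S.filter fun p => p.1 + p.2 < m + 1).filter fun p => p.1 + p.2 = l) =
          Finset.HasAntidiagonal.antidiagonal l := by
        ext p
        have := Finset.mem_range.mp hl
        simp only [S, Finset.mem_filter, Finset.mem_product, Finset.mem_range,
          Finset.HasAntidiagonal.mem_antidiagonal]
        omega
      rw [hS]
      refine Finset.sum_congr rfl fun p hp => ?_
      rw [← Finset.HasAntidiagonal.mem_antidiagonal.mp hp, pow_add]
      ring
    -- The terms lost by truncation have total degree at least `m + 1` in `a`, which vanishes at
    -- `P`.
    rw [h1, h2, ← Finset.sum_filter_add_sum_filter_not S (fun p => p.1 + p.2 < m + 1), sub_add_cancel_left]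
    refine (OrdGE.sum fun p hp => ?_).neg
    have hp' := (Finset.mem_filter.mp hp).2
    refine ((hreg f hf p.1).mul (hreg g hg p.2)).mono ?_
    have : m + 1 ≤ p.1 + p.2 := not_lt.mp hp'
    exact_mod_cast this
  have hadd : ∀ f g, ψ (f + g) = ψ f + ψ g := fun f g => by
    simp only [hψ, map_add, mul_add, Finset.sum_add_distrib]
  have hconst : ∀ c : F, ψ (algebraMap F K c) = algebraMap F K c := fun c => by
    simp only [hψ]
    rw [Finset.sum_eq_single 0]
    · rw [pow_zero, one_mul, PowerSeries.coeff_zero_eq_constantCoeff_apply, hη.constantCoeff]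
    · intro i _ hi
      rw [AlgHom.commutes, IsScalarTower.algebraMap_apply F K (PowerSeries K)]
      change _ * PowerSeries.coeff i (PowerSeries.C _) = 0
      rw [PowerSeries.coeff_C, if_neg hi, mul_zero]
    · simp
  have hgood : ∀ f g, OrdGE (v P) 0 f → OrdGE (v P) 0 g → OrdGE (v P) (m + 1) (ψ f - φ f) →
      OrdGE (v P) (m + 1) (ψ g - φ g) → OrdGE (v P) (m + 1) (ψ (f * g) - φ (f * g)) := by
    intro f g hf hg h1 h2
    have : ψ (f * g) - φ (f * g) = (ψ (f * g) - ψ f * ψ g) + ((ψ f - φ f) * ψ g +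
        φ f * (ψ g - φ g)) := by rw [map_mul]; ring
    rw [this]
    exact (hmul f g hf hg).add ((h1.mul_right (hψreg g hg)).add ((hφ f hf).mul_left h2))
  have hc : ∀ c : F, OrdGE (v P) (m + 1) (ψ (algebraMap F K c) - φ (algebraMap F K c)) := fun c => by
    rw [hconst, AlgHom.commutes, sub_self]; exact OrdGE.zero _
  have htt : OrdGE (v P) (m + 1) (ψ t - φ t) := by
    -- For `m = 0` the truncation drops the linear term, so `ψ t = t`, and the error `-a` has order
    -- at least one.
    rcases Nat.eq_zero_or_pos m with rfl | hm
    · have : ψ t - φ t = -a := by simp [hψ, ha, hη.constantCoeff]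
      rw [this]
      simpa using ha1.neg
    · have : ψ t - φ t = 0 := by
        simp only [hψ, hη.apply_self, map_add, PowerSeries.coeff_C, PowerSeries.coeff_X, mul_add,
          Finset.sum_add_distrib, mul_ite, mul_zero, mul_one, Finset.sum_ite_eq', Finset.mem_range]
        rw [if_pos (by omega), if_pos (by omega), ha]
        ring
      rw [this]; exact OrdGE.zero _
  have hpow : ∀ n, OrdGE (v P) (m + 1) (ψ (t ^ n) - φ (t ^ n)) := fun n => by
    induction n with
    | zero => simpa using hc 1
    | succ n ih =>
      rw [pow_succ]
      exact hgood _ _ (by simpa using ht0.pow n) ht0 ih htt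
  have hpoly : ∀ p : F[X], OrdGE (v P) (m + 1) (ψ (aeval t p) - φ (aeval t p)) := fun p => by
    induction p using Polynomial.induction_on' with
    | add p q hp hq =>
      rw [map_add, hadd, map_add, add_sub_add_comm]
      exact hp.add hq
    | monomial n c =>
      rw [aeval_monomial]
      exact hgood _ _ (h.const P c) (by simpa using ht0.pow n) (hc c) (hpow n)
  obtain ⟨p, g, hg, rfl⟩ := h.exists_expansion P ht hf (m + 1)
  change OrdGE (v P) (m + 1) (ψ _ - _)
  rw [hadd, map_add, add_sub_add_comm]
  refine (hpoly p).add ?_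
  have htN : OrdGE (v P) 0 (t ^ (m + 1)) := by simpa using ht0.pow (m + 1)
  have hφN : OrdGE (v P) (m + 1) (φ (t ^ (m + 1))) := by
    have := hφt.pow (m + 1)
    rw [map_pow]
    simpa using this
  have hψN : OrdGE (v P) (m + 1) (ψ (t ^ (m + 1))) := by
    have := (hpow (m + 1)).add hφN
    rwa [sub_add_cancel] at this
  have h1 : OrdGE (v P) (m + 1) (ψ (t ^ (m + 1) * g)) := by
    have := (hmul _ g htN hg).add (hψN.mul_right (hψreg g hg))
    rwa [sub_add_cancel] at this
  rw [map_mul]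
  exact h1.sub (hφN.mul_right (hφ g hg))

end IsPlaceSystem

/-! ### The Frobenius divisor -/

namespace IsPlaceSystem

variable {F K ι : Type*} [Field F] [IsAlgClosed F] [Field K] [Algebra F K]
  {v : ι → Valuation K ℤᵐ⁰} (h : IsPlaceSystem F v)

include h

/-- A uniformizer is a separating variable. -/
theorem isSeparatingVariable_uniformizer {x : K} (hx : IsSeparatingVariable F x)
    (D : Derivation F K K) (hD : D x = 1) (P : ι) {t : K} (ht : v P t = exp (-1)) :
    IsSeparatingVariable F t := by
  have hDt : D t ≠ 0 := h.derivation_uniformizer_ne_zero P D (x := x) (by simp [hD]) ht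
  have htt : Transcendental F t := by
    rcases transcendental_or_mem_range (F := F) t with h1 | ⟨c, rfl⟩
    · exact h1
    · simp at hDt
  have := h.finite t htt
  exact isSeparatingVariable_of_derivation hx D hD htt hDt

/-- The data of the local estimates at a point `P`: rows of Hasse derivatives with respect to `x` are
turned into rows of Hasse derivatives with respect to the uniformizer `t`. -/
theorem exists_local_rows {x : K} (hx : IsSeparatingVariable F x) {η : K →ₐ[F] PowerSeries K}
    (hη : IsTaylorHom F x η) {r : ℕ} (f : Fin (r + 1) → K) (R : Fin (r + 1) → K) (u : K)
    (P : ι) {t : K} (ht : v P t = exp (-1)) :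
    ∃ (η' : K →ₐ[F] PowerSeries K) (w : K), IsTaylorHom F t η' ∧ w ≠ 0 ∧
      vOrd (v P) w = -vOrd (v P) (taylorDeriv η hη.constantCoeff t) ∧
      IsTriangular R (fun m j => PowerSeries.coeff m (η (f j)))
        (fun m j => PowerSeries.coeff m (η' (f j / u))) fun m => w ^ m * u⁻¹ := by
  have hD := hη.taylorDeriv_self
  set D := taylorDeriv η hη.constantCoeff with hDdef
  have htsep := h.isSeparatingVariable_uniformizer hx D hD P ht
  have hDt : D t ≠ 0 := h.derivation_uniformizer_ne_zero P D (x := x) (by simp [hD]) ht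
  obtain ⟨η', hη'⟩ := exists_isTaylorHom F t htsep
  obtain ⟨c, hc1, hc2⟩ := exists_chain_rule hx hη hη'
  set D' := taylorDeriv η' hη'.constantCoeff with hD'def
  have hw : D' x * D t = 1 := by
    have h1 := derivation_eq_zero (D' - D' x • D) hx (by simp [hD]) t
    rw [Derivation.sub_apply, Derivation.smul_apply, sub_eq_zero, hη'.taylorDeriv_self] at h1
    exact h1.symm
  have hw0 : D' x ≠ 0 := left_ne_zero_of_mul_eq_one hw
  refine ⟨η', D' x, hη', hw0, ?_, ?_⟩
  · have := congr(vOrd (v P) $hw)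
    rw [vOrd_mul hw0 hDt, vOrd_one] at this
    linarith
  -- Division by `u` is triangular by the product rule, with diagonal `u⁻¹`; the passage from `x` to
  -- `t` is triangular by the chain rule, with diagonal powers of `w = dx/dt`.
  · have h1 : IsTriangular R (fun m j => PowerSeries.coeff m (η (f j)))
        (fun m j => PowerSeries.coeff m (η (f j / u))) fun m => PowerSeries.coeff (m - m) (η u⁻¹) := by
      refine IsTriangular.of_sum (fun m i => PowerSeries.coeff (m - i) (η u⁻¹)) 0 fun m => ?_
      ext j
      rw [div_eq_mul_inv, map_mul, PowerSeries.coeff_mul, Finset.Nat.sum_antidiagonal_eq_sum_range_succ_mk]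
      simp [mul_comm]
    have h2 : IsTriangular R (fun m j => PowerSeries.coeff m (η (f j / u)))
        (fun m j => PowerSeries.coeff m (η' (f j / u))) fun m => c m m := by
      refine IsTriangular.of_sum c 0 fun m => ?_
      ext j
      rw [hc2]
      simp
    have h3 := h1.trans h2
    convert h3 using 2 with m
    rw [hc1, Nat.sub_self, PowerSeries.coeff_zero_eq_constantCoeff_apply, hη.constantCoeff]
    rfl

/-- The local estimate at an arbitrary point. -/
theorem vOrd_minor_nonneg {x : K} (hx : IsSeparatingVariable F x) {η : K →ₐ[F] PowerSeries K}
    (hη : IsTaylorHom F x η) {r q : ℕ} (f : Fin (r + 1) → K) {ν : Fin r → ℕ}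
    (hν : IsLeast (minorSet (fun j => f j ^ q) fun m j => PowerSeries.coeff m (η (f j))) (toLex ν))
    (P : ι) {e : ℤ} (he : ∀ j, OrdGE (v P) (-e) (f j)) (he' : ∃ j, f j ≠ 0 ∧ vOrd (v P) (f j) = -e) :
    0 ≤ vOrd (v P) (Matrix.of (minorRows (fun j => f j ^ q)
      (fun m j => PowerSeries.coeff m (η (f j))) ν)).det + (q + r) * e +
      (∑ i, (ν i : ℤ)) * h.canonical (taylorDeriv η hη.constantCoeff) hη.taylorDeriv_self P := by
  obtain ⟨j₀, hu, hord⟩ := he'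
  obtain ⟨t, ht⟩ := h.uniformizer P
  set R : Fin (r + 1) → K := fun j => f j ^ q
  obtain ⟨η', w, hη', hw0, hw, htri⟩ := h.exists_local_rows hx hη f R (f j₀) P ht
  -- The new minor is `Δ` times `f_{j₀} ^ (-(q + r)) * w ^ ∑ νᵢ`. Its order is exactly the
  -- coefficient in question, and it is nonnegative because all entries are regular.
  have hdet := htri.det_eq hν ((f j₀)⁻¹ ^ q)
  set Δ := (Matrix.of (minorRows R (fun m j => PowerSeries.coeff m (η (f j))) ν)).det
  have hΔ : Δ ≠ 0 := hν.1.2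
  have hg : ∀ j, OrdGE (v P) 0 (f j / f j₀) := fun j => by
    have := (he j).div hu
    rwa [hord, sub_self] at this
  have hint : OrdGE (v P) 0 (Matrix.of (minorRows ((f j₀)⁻¹ ^ q • R)
      (fun m j => PowerSeries.coeff m (η' (f j / f j₀))) ν)).det := by
    refine ordGE_det _ fun i j => ?_
    refine Fin.cases ?_ (fun i => ?_) i
    · change OrdGE (v P) 0 ((f j₀)⁻¹ ^ q * f j ^ q)
      rw [← mul_pow, inv_mul_eq_div]
      simpa using (hg j).pow q
    · exact h.taylor_regular P ht hη' (hg j) _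
  rw [hdet] at hint
  have hprod : ∏ i, (w ^ ν i * (f j₀)⁻¹) ≠ 0 :=
    Finset.prod_ne_zero_iff.mpr fun i _ => mul_ne_zero (pow_ne_zero _ hw0) (inv_ne_zero hu)
  have hp : (f j₀)⁻¹ ^ q ≠ 0 := pow_ne_zero _ (inv_ne_zero hu)
  rw [ordGE_iff (mul_ne_zero (mul_ne_zero hp hprod) hΔ), vOrd_mul (mul_ne_zero hp hprod) hΔ,
    vOrd_mul hp hprod, Finset.prod_mul_distrib, Finset.prod_pow_eq_pow_sum, Finset.prod_const,
    Finset.card_univ, Fintype.card_fin, vOrd_mul (pow_ne_zero _ hw0) (pow_ne_zero _ (inv_ne_zero hu)),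
    vOrd_pow, vOrd_pow, vOrd_pow, vOrd_inv, hord, hw] at hint
  rw [h.canonical_apply _ _ ht]
  push_cast at hint
  linarith

/-- The local estimate at a fixed point of `φ`. -/
theorem le_vOrd_minor {x : K} (hx : IsSeparatingVariable F x) {η : K →ₐ[F] PowerSeries K}
    (hη : IsTaylorHom F x η) {r q : ℕ} (hq : 1 < q) (f : Fin (r + 1) → K) {ν : Fin r → ℕ}
    (hν : IsLeast (minorSet (fun j => f j ^ q) fun m j => PowerSeries.coeff m (η (f j))) (toLex ν))
    (P : ι) {e : ℤ} (he : ∀ j, OrdGE (v P) (-e) (f j)) (he' : ∃ j, f j ≠ 0 ∧ vOrd (v P) (f j) = -e)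
    (φ : K →ₐ[F] K) (hφf : ∀ j, φ (f j) = f j ^ q)
    (hφ : ∀ f, OrdGE (v P) 0 f → OrdGE (v P) 0 (φ f)) {t : K} (ht : v P t = exp (-1))
    (hφt : φ t = t ^ q) :
    r ≤ vOrd (v P) (Matrix.of (minorRows (fun j => f j ^ q)
      (fun m j => PowerSeries.coeff m (η (f j))) ν)).det + (q + r) * e +
      (∑ i, (ν i : ℤ)) * h.canonical (taylorDeriv η hη.constantCoeff) hη.taylorDeriv_self P := by
  obtain ⟨j₀, hu, hord⟩ := he'
  set R : Fin (r + 1) → K := fun j => f j ^ q with hR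
  obtain ⟨η', w, hη', hw0, hw, htri⟩ := h.exists_local_rows hx hη f R (f j₀) P ht
  have hg : ∀ j, OrdGE (v P) 0 (f j / f j₀) := fun j => by
    have := (he j).div hu
    rwa [hord, sub_self] at this
  have ht1 : OrdGE (v P) 1 t := ht.le
  have ht0 : t ≠ 0 := ne_zero_of_eq_exp ht
  -- As `q ≥ 2`, the term `t ^ q` does not affect the order of `t ^ q - t`.
  have htq : OrdGE (v P) 2 (φ t) := by
    rw [hφt]
    refine (ht1.pow q).mono ?_
    have : (1 : ℤ) < q := mod_cast hq
    linarith
  set a := φ t - t with ha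
  have hva : v P a = exp (-1) := by
    rw [eq_exp_neg_iff]
    refine ⟨(htq.mono (by norm_num)).sub ht1, fun hc => ?_⟩
    have h1 := htq.sub hc
    rw [ha, sub_sub_cancel, ordGE_iff ht0, vOrd_eq_of ht] at h1
    norm_num at h1
  have ha0 : a ≠ 0 := ne_zero_of_eq_exp hva
  have hoa : vOrd (v P) a = 1 := vOrd_eq_of hva
  -- The Taylor remainder divided by `a ^ (m + 1)`. It is regular by `taylor_congr`; its `φ` term is
  -- a multiple of `R`; and the diagonal entry is `-a⁻¹`, so each of the `r` rows contributes one
  -- extra order.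
  let d : ℕ → Fin (r + 1) → K := fun m j => -a⁻¹ ^ (m + 1) *
    (∑ i ∈ Finset.range (m + 1), a ^ i * PowerSeries.coeff i (η' (f j / f j₀)) - φ (f j / f j₀))
  have hd : IsTriangular R (fun m j => PowerSeries.coeff m (η' (f j / f j₀))) d
      fun m => -a⁻¹ ^ (m + 1) * a ^ m := by
    refine IsTriangular.of_sum (fun m i => -a⁻¹ ^ (m + 1) * a ^ i)
      (fun m => a⁻¹ ^ (m + 1) * (f j₀)⁻¹ ^ q) fun m => ?_
    ext j
    simp only [d, hR, Pi.add_apply, Finset.sum_apply, Pi.smul_apply, smul_eq_mul, map_div₀, hφf,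
      mul_sub, Finset.mul_sum, mul_assoc]
    rw [div_eq_mul_inv, inv_pow]
    ring
  have htri' := htri.trans hd
  have hdet := htri'.det_eq hν ((f j₀)⁻¹ ^ q)
  set Δ := (Matrix.of (minorRows R (fun m j => PowerSeries.coeff m (η (f j))) ν)).det
  have hΔ : Δ ≠ 0 := hν.1.2
  have hint : OrdGE (v P) 0 (Matrix.of (minorRows ((f j₀)⁻¹ ^ q • R) d ν)).det := by
    refine ordGE_det _ fun i j => ?_
    refine Fin.cases ?_ (fun i => ?_) i
    · change OrdGE (v P) 0 ((f j₀)⁻¹ ^ q * f j ^ q)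
      rw [← mul_pow, inv_mul_eq_div]
      simpa using (hg j).pow q
    · change OrdGE (v P) 0 (d (ν i) j)
      have h1 := h.taylor_congr P ht hη' φ hφ (htq.mono (by norm_num)) (ν i) (hg j)
      have h2 : OrdGE (v P) (-(ν i + 1)) (-a⁻¹ ^ (ν i + 1)) := by
        refine (OrdGE.self (a⁻¹ ^ (ν i + 1))).neg.mono ?_
        rw [vOrd_pow, vOrd_inv, hoa]
        push_cast; linarith
      have h3 := h2.mul h1
      rw [neg_add_cancel] at h3
      exact h3
  rw [hdet] at hint
  have hγ : ∀ m : ℕ, -a⁻¹ ^ (m + 1) * a ^ m = -a⁻¹ := fun m => by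
    rw [pow_succ, inv_pow]
    field_simp
  simp only [hγ] at hint
  have hprod : ∏ i, (-a⁻¹ * (w ^ ν i * (f j₀)⁻¹)) ≠ 0 :=
    Finset.prod_ne_zero_iff.mpr fun i _ => mul_ne_zero (neg_ne_zero.mpr (inv_ne_zero ha0))
      (mul_ne_zero (pow_ne_zero _ hw0) (inv_ne_zero hu))
  have hp : (f j₀)⁻¹ ^ q ≠ 0 := pow_ne_zero _ (inv_ne_zero hu)
  have hp' : (f j₀)⁻¹ ^ r ≠ 0 := pow_ne_zero _ (inv_ne_zero hu)
  have hp'' : (-a⁻¹) ^ r ≠ 0 := pow_ne_zero _ (neg_ne_zero.mpr (inv_ne_zero ha0))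
  have hpw : w ^ ∑ i, ν i ≠ 0 := pow_ne_zero _ hw0
  rw [ordGE_iff (mul_ne_zero (mul_ne_zero hp hprod) hΔ), vOrd_mul (mul_ne_zero hp hprod) hΔ,
    vOrd_mul hp hprod, Finset.prod_mul_distrib, Finset.prod_mul_distrib, Finset.prod_pow_eq_pow_sum,
    Finset.prod_const, Finset.prod_const, Finset.card_univ, Fintype.card_fin,
    vOrd_mul hp'' (mul_ne_zero hpw hp'), vOrd_mul hpw hp', vOrd_pow, vOrd_pow, vOrd_pow, vOrd_pow,
    vOrd_neg, vOrd_inv, vOrd_inv, hoa, hord, hw] at hint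
  rw [h.canonical_apply _ _ ht]
  push_cast at hint
  linarith

/-- The Stöhr–Voloch bound for a system of places. -/
theorem card_fixed_le {x : K} (hx : IsSeparatingVariable F x) {η : K →ₐ[F] PowerSeries K}
    (hη : IsTaylorHom F x η) {r q : ℕ} (hq : 1 < q) (f : Fin (r + 1) → K) {ν : Fin r → ℕ}
    (hν : IsLeast (minorSet (fun j => f j ^ q) fun m j => PowerSeries.coeff m (η (f j))) (toLex ν))
    (E : ι →₀ ℤ) (hE : ∀ P j, OrdGE (v P) (-E P) (f j))
    (hE' : ∀ P, ∃ j, f j ≠ 0 ∧ vOrd (v P) (f j) = -E P)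
    (φ : K →ₐ[F] K) (hφf : ∀ j, φ (f j) = f j ^ q) (N : Finset ι)
    (hN : ∀ P ∈ N, (∀ f, OrdGE (v P) 0 f → OrdGE (v P) 0 (φ f)) ∧
      ∃ t, v P t = exp (-1) ∧ φ t = t ^ q)
    {g : ℤ} (hg : ∀ A : ι →₀ ℤ, A.degree + 1 - Module.finrank F (h.rr A) ≤ g) :
    r * (N.card : ℤ) ≤ (∑ i, (ν i : ℤ)) * (2 * g - 2) + (q + r) * E.degree := by
  classical
  set Δ := (Matrix.of (minorRows (fun j => f j ^ q)
    (fun m j => PowerSeries.coeff m (η (f j))) ν)).det with hΔdef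
  have hΔ : Δ ≠ 0 := hν.1.2
  set W := h.canonical (taylorDeriv η hη.constantCoeff) hη.taylorDeriv_self
  set s := ∑ i, (ν i : ℤ)
  have hs : 0 ≤ s := Finset.sum_nonneg fun i _ => by positivity
  -- The two local estimates as an inequality of divisors, from which degrees are taken.
  have hle : (r : ℤ) • ∑ P ∈ N, Finsupp.single P (1 : ℤ) ≤
      h.divisor Δ + ((q : ℤ) + r) • E + s • W := by
    intro P
    have h1 : (∑ Q ∈ N, Finsupp.single Q (1 : ℤ)) P = if P ∈ N then 1 else 0 := by
      rw [Finsupp.finsetSum_apply]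
      simp [Finsupp.single_apply]
    simp only [Finsupp.smul_apply, h1, Finsupp.add_apply, divisor_apply, smul_eq_mul]
    split_ifs with hP
    · obtain ⟨h2, t, ht, hφt⟩ := hN P hP
      simpa using h.le_vOrd_minor hx hη hq f hν P (hE P) (hE' P) φ hφf h2 ht hφt
    · simpa using h.vOrd_minor_nonneg hx hη f hν P (hE P) (hE' P)
  have hdeg := degree_mono_int hle
  simp only [map_add, map_zsmul, map_sum, Finsupp.degree_single, Finset.sum_const, smul_eq_mul,
    h.degree_divisor hΔ, zero_add, nsmul_eq_mul, mul_one] at hdeg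
  have hW := h.degree_canonical_le hx _ hη.taylorDeriv_self hg
  have := mul_le_mul_of_nonneg_left hW hs
  linarith

end IsPlaceSystem

end StohrVoloch

open scoped WithZero IntermediateField

namespace StohrVoloch

open WithZero

/-! ### The points of a projective curve as a system of places -/

section Fractions

open MvPolynomial

variable {F : Type*} [Field F] {n : ℕ} {I : Ideal (MvPolynomial (Fin (n + 1)) F)} [I.IsPrime]

variable (I) in
/-- The quotient `G / H` of homogeneous polynomials of the same degree as an element of the function
field (zero if `H ∈ I`). -/
noncomputable def ratio {d : ℕ} {G H : MvPolynomial (Fin (n + 1)) F} (hG : G.IsHomogeneous d)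
    (hH : H.IsHomogeneous d) : functionField I :=
  ⟨frac I G H, by
    by_cases h : H ∈ I
    · have : frac I G H = 0 := by simp [frac, Ideal.Quotient.eq_zero_iff_mem.mpr h]
      exact this ▸ zero_mem _
    · exact ⟨d, G, H, hG, hH, h, rfl⟩⟩

theorem frac_eq_frac {G H G' H' : MvPolynomial (Fin (n + 1)) F} (h : H ∉ I) (h' : H' ∉ I) :
    frac I G H = frac I G' H' ↔ G * H' - G' * H ∈ I := by
  rw [frac, frac, div_eq_div_iff (toFrac_ne_zero h) (toFrac_ne_zero h'), ← Ideal.Quotient.eq,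
    ← (IsFractionRing.injective (MvPolynomial (Fin (n + 1)) F ⧸ I)
      (FractionRing (MvPolynomial (Fin (n + 1)) F ⧸ I))).eq_iff]
  simp only [map_mul]

omit [I.IsPrime] in
theorem algebraMap_mk_eq_aeval (G : MvPolynomial (Fin (n + 1)) F) :
    algebraMap _ (FractionRing (MvPolynomial (Fin (n + 1)) F ⧸ I)) (Ideal.Quotient.mk I G) =
      aeval (fun i => algebraMap _ (FractionRing (MvPolynomial (Fin (n + 1)) F ⧸ I))
        (Ideal.Quotient.mk I (X i))) G := by
  have : (Algebra.algHom F (MvPolynomial (Fin (n + 1)) F ⧸ I)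
      (FractionRing (MvPolynomial (Fin (n + 1)) F ⧸ I))).comp (Ideal.Quotient.mkₐ F I) =
      aeval fun i => algebraMap _ (FractionRing (MvPolynomial (Fin (n + 1)) F ⧸ I))
        (Ideal.Quotient.mk I (X i)) := by
    ext i
    simp only [AlgHom.comp_apply, aeval_X]
    rfl
  exact congr($this G)

variable (I) in
/-- The affine coordinate function `xᵢ / xⱼ`. -/
noncomputable def coord (i j : Fin (n + 1)) : functionField I :=
  ratio I (isHomogeneous_X F i) (isHomogeneous_X F j)

theorem coord_self {j : Fin (n + 1)} (hj : X j ∉ I) : coord I j j = 1 :=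
  Subtype.ext (div_self (toFrac_ne_zero hj))

theorem coord_mul_coord (i : Fin (n + 1)) {j : Fin (n + 1)} (hj : X j ∉ I) (l : Fin (n + 1)) :
    coord I i j * coord I j l = coord I i l :=
  Subtype.ext (div_mul_div_cancel₀ (toFrac_ne_zero hj))

theorem coord_eq_zero {i : Fin (n + 1)} (hi : X i ∈ I) (j : Fin (n + 1)) : coord I i j = 0 :=
  Subtype.ext <| by simp [coord, ratio, frac, Ideal.Quotient.eq_zero_iff_mem.mpr hi]

/-- Dehomogenization. -/
theorem aeval_coord {G : MvPolynomial (Fin (n + 1)) F} {d : ℕ} (hG : G.IsHomogeneous d)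
    (j : Fin (n + 1)) :
    (aeval (fun i => coord I i j) G : functionField I).1 = frac I G (X j ^ d) := by
  have h1 : (aeval (fun i => coord I i j) G : functionField I).1 =
      aeval (fun i => (coord I i j).1) G :=
    congr($(comp_aeval (fun i => coord I i j) (functionField I).val) G)
  have h2 : (fun i => (coord I i j).1) =
      (algebraMap _ (FractionRing (MvPolynomial (Fin (n + 1)) F ⧸ I))
        (Ideal.Quotient.mk I (X j)))⁻¹ • fun i => algebraMap _
        (FractionRing (MvPolynomial (Fin (n + 1)) F ⧸ I)) (Ideal.Quotient.mk I (X i)) := by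
    funext i
    exact div_eq_inv_mul _ _
  rw [h1, h2, aeval_def, ← eval_map, eval_smul_of_isHomogeneous (hG.map _), eval_map, ← aeval_def,
    ← algebraMap_mk_eq_aeval, frac, map_pow, map_pow, inv_pow, div_eq_inv_mul]

theorem frac_eq_aeval_div {G H : MvPolynomial (Fin (n + 1)) F} {d : ℕ} (hG : G.IsHomogeneous d)
    (hH : H.IsHomogeneous d) {j : Fin (n + 1)} (hj : X j ∉ I) :
    frac I G H = (aeval (fun i => coord I i j) G / aeval (fun i => coord I i j) H :
      functionField I).1 := by
  have h : (X j ^ d : MvPolynomial (Fin (n + 1)) F) ∉ I :=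
    fun hm => hj (Ideal.IsPrime.mem_of_pow_mem ‹_› _ hm)
  change _ = (aeval (fun i => coord I i j) G : functionField I).1 /
    (aeval (fun i => coord I i j) H : functionField I).1
  rw [aeval_coord hG, aeval_coord hH]
  exact (div_div_div_cancel_right₀ (toFrac_ne_zero h) _ _).symm

/-- If every coordinate lay in `I`, the coordinate ring would consist of constants. A nonconstant
function therefore provides an affine chart. -/
theorem exists_X_notMem {f : functionField I} (hf : f ∉ Set.range (algebraMap F (functionField I))) :
    ∃ j, X j ∉ I := by
  by_contra! hc
  obtain ⟨d, G, H, -, -, -, hz⟩ := f.2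
  have key : ∀ G : MvPolynomial (Fin (n + 1)) F, algebraMap _
      (FractionRing (MvPolynomial (Fin (n + 1)) F ⧸ I)) (Ideal.Quotient.mk I G) =
      algebraMap F _ (aeval (fun _ => (0 : F)) G) := fun G => by
    rw [algebraMap_mk_eq_aeval, ← aeval_algebraMap_apply]
    congr 2
    funext i
    simp [Ideal.Quotient.eq_zero_iff_mem.mpr (hc i)]
  refine hf ⟨aeval (fun _ => (0 : F)) G / aeval (fun _ => (0 : F)) H, Subtype.ext ?_⟩
  refine Eq.trans ?_ hz.symm
  change algebraMap F _ _ = frac I G H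
  rw [frac, key, key, map_div₀]

omit [I.IsPrime] in
theorem exists_rep_ne_zero (P : zeroLocus I) : ∃ j, P.1.rep j ≠ 0 := by
  by_contra! hc
  exact P.1.rep_nonzero (funext hc)

omit [I.IsPrime] in
theorem notMem_of_eval_ne_zero {P : zeroLocus I} {H : MvPolynomial (Fin (n + 1)) F}
    (h : eval P.1.rep H ≠ 0) : H ∉ I := fun hm => h (P.2 _ hm)

omit [I.IsPrime] in
theorem X_notMem {P : zeroLocus I} {j : Fin (n + 1)} (hj : P.1.rep j ≠ 0) : X j ∉ I :=
  notMem_of_eval_ne_zero (P := P) (by simpa using hj)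

end Fractions

namespace Curve

open MvPolynomial

variable {k F : Type*} [Field k] [Field F] [Algebra k F] {n : ℕ} (X : Curve k F n)

theorem valuation_le_one_iff (P : X.Point) (f : X.Func) :
    X.valuation P f ≤ 1 ↔ f ∈ localRing (extend F X.ideal) P := by
  constructor
  · intro h
    obtain ⟨a, rfl⟩ := IsDiscreteValuationRing.exists_lift_of_le_one h
    exact a.2
  · intro h
    exact (IsDiscreteValuationRing.maximalIdeal (localRing (extend F X.ideal) P)).valuation_le_one
      (⟨f, h⟩ : localRing (extend F X.ideal) P)

variable {X} {P : X.Point} {d : ℕ} {G H : MvPolynomial (Fin (n + 1)) F}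

theorem valuation_ratio_le_one (hG : G.IsHomogeneous d) (hH : H.IsHomogeneous d)
    (h : eval P.1.rep H ≠ 0) : X.valuation P (ratio _ hG hH) ≤ 1 :=
  (X.valuation_le_one_iff P _).mpr ⟨d, G, H, hG, hH, h, rfl⟩

theorem valuation_ratio_eq_one (hG : G.IsHomogeneous d) (hH : H.IsHomogeneous d)
    (h : eval P.1.rep H ≠ 0) (h' : eval P.1.rep G ≠ 0) : X.valuation P (ratio _ hG hH) = 1 := by
  refine le_antisymm (valuation_ratio_le_one hG hH h) ?_
  have h1 := valuation_ratio_le_one (X := X) hH hG h'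
  have h2 : ratio (extend F X.ideal) hH hG = (ratio _ hG hH)⁻¹ :=
    Subtype.ext (inv_div _ _).symm
  rw [h2, map_inv₀] at h1
  have h0 : X.valuation P (ratio _ hG hH) ≠ 0 := by
    rw [Valuation.ne_zero_iff]
    exact fun h0 => div_ne_zero (toFrac_ne_zero (notMem_of_eval_ne_zero h'))
      (toFrac_ne_zero (notMem_of_eval_ne_zero h)) congr(($h0).1)
  exact (inv_le_one₀ (zero_lt_iff.mpr h0)).mp h1

/-- Otherwise the inverse is some `G' / H'` with `H'(P) ≠ 0`, and evaluating `G G' - H H' ∈ I` at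
`P` gives `H(P) H'(P) = 0`. -/
theorem valuation_ratio_lt_one (hG : G.IsHomogeneous d) (hH : H.IsHomogeneous d)
    (h : eval P.1.rep H ≠ 0) (h' : eval P.1.rep G = 0) : X.valuation P (ratio _ hG hH) < 1 := by
  refine lt_of_le_of_ne (valuation_ratio_le_one hG hH h) fun heq => ?_
  have h0 : (ratio (extend F X.ideal) hG hH)⁻¹ ∈ localRing (extend F X.ideal) P := by
    rw [← X.valuation_le_one_iff, map_inv₀, heq, inv_one]
  obtain ⟨d', G', H', hG', hH', hH'0, he⟩ := h0
  have hHI := notMem_of_eval_ne_zero h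
  have hHI' := notMem_of_eval_ne_zero hH'0
  have hne : (ratio (extend F X.ideal) hG hH).1 ≠ 0 := fun h0 => by
    have : ratio (extend F X.ideal) hG hH = 0 := Subtype.ext h0
    rw [this, map_zero] at heq
    exact zero_ne_one heq
  have h1 : frac (extend F X.ideal) (G * G') (H * H') = frac (extend F X.ideal) 1 1 := by
    rw [← frac_mul, ← he]
    refine (mul_inv_cancel₀ hne).trans ?_
    simp [frac]
  rw [frac_eq_frac (fun hm => (Ideal.IsPrime.mem_or_mem inferInstance hm).elim hHI hHI')
    one_notMem] at h1
  have := P.2 _ h1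
  simp [h', h, hH'0] at this

theorem exists_ratio_of_valuation_le_one {f : X.Func} (hf : X.valuation P f ≤ 1) :
    ∃ (d : ℕ) (G H : MvPolynomial (Fin (n + 1)) F) (hG : G.IsHomogeneous d)
      (hH : H.IsHomogeneous d), eval P.1.rep H ≠ 0 ∧ f = ratio _ hG hH := by
  obtain ⟨d, G, H, hG, hH, h, he⟩ := (X.valuation_le_one_iff P f).mp hf
  exact ⟨d, G, H, hG, hH, h, Subtype.ext he⟩

end Curve

/-! ### The axioms of a system of places for the points of a curve -/

namespace Curve

open MvPolynomial

variable {k F : Type*} [Field k] [Field F] [Algebra k F] {n : ℕ} (X : Curve k F n)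

theorem residue (P : X.Point) {f : X.Func} (hf : X.valuation P f ≤ 1) :
    ∃ c : F, X.valuation P (f - algebraMap F X.Func c) < 1 := by
  obtain ⟨d, G, H, hG, hH, h, rfl⟩ := exists_ratio_of_valuation_le_one hf
  set c := eval P.1.rep G / eval P.1.rep H with hc
  have hG' : (G - C c * H).IsHomogeneous d := by
    refine hG.sub ?_
    simpa using (isHomogeneous_C _ c).mul hH
  have he : ratio (extend F X.ideal) hG hH - algebraMap F X.Func c = ratio _ hG' hH := by
    refine Subtype.ext ?_
    change frac _ G H - algebraMap F _ c = frac _ _ H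
    have h0 := toFrac_ne_zero (notMem_of_eval_ne_zero h)
    rw [← frac_C, frac, frac, frac, map_one, map_one, div_one, map_sub, map_mul, map_sub, map_mul,
      sub_div, mul_div_cancel_right₀ _ h0]
  refine ⟨c, he ▸ valuation_ratio_lt_one hG' hH h ?_⟩
  simp [hc, h]

theorem exists_uniformizer (P : X.Point) : ∃ t, X.valuation P t = exp (-1) :=
  (IsDiscreteValuationRing.maximalIdeal
    (localRing (extend F X.ideal) P)).valuation_exists_uniformizer X.Func

theorem exists_linear_form_eval_eq_zero {P Q : ℙ F (Fin (n + 1) → F)} (h : Q ≠ P) :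
    ∃ L : MvPolynomial (Fin (n + 1)) F, L.IsHomogeneous 1 ∧ eval Q.rep L = 0 ∧
      eval P.rep L ≠ 0 := by
  by_contra! hc
  have key : ∀ i j, Q.rep j * P.rep i = Q.rep i * P.rep j := fun i j => by
    have hL : (C (Q.rep j) * MvPolynomial.X i - C (Q.rep i) * MvPolynomial.X j).IsHomogeneous 1 := by
      refine IsHomogeneous.sub ?_ ?_ <;>
      simpa using (isHomogeneous_C (Fin (n + 1)) _).mul (isHomogeneous_X F _)
    have := hc _ hL (by simp [mul_comm])
    simpa [sub_eq_zero] using this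
  obtain ⟨i, hi⟩ : ∃ i, P.rep i ≠ 0 := by
    by_contra! h0
    exact P.rep_nonzero (funext h0)
  apply h
  rw [← Q.mk_rep, ← P.mk_rep, Projectivization.mk_eq_mk_iff']
  refine ⟨Q.rep i / P.rep i, funext fun j => ?_⟩
  change Q.rep i / P.rep i * P.rep j = Q.rep j
  rw [div_mul_eq_mul_div, div_eq_iff hi, key]

theorem exists_linear_form_eval_ne_zero [Infinite F] (S : Finset (ℙ F (Fin (n + 1) → F))) :
    ∃ L : MvPolynomial (Fin (n + 1)) F, L.IsHomogeneous 1 ∧ ∀ P ∈ S, eval P.rep L ≠ 0 := by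
  obtain ⟨f, hf⟩ := Module.exists_dual_forall_apply_ne_zero (K := F)
    (fun P : S => P.1.rep) fun P => P.1.rep_nonzero
  refine ⟨∑ i, C (f fun j => if i = j then 1 else 0) * MvPolynomial.X i, ?_, fun P hP => ?_⟩
  · refine IsHomogeneous.sum _ _ _ fun i _ => ?_
    simpa using (isHomogeneous_C (Fin (n + 1)) _).mul (isHomogeneous_X F i)
  · have := hf ⟨P, hP⟩
    rw [LinearMap.pi_apply_eq_sum_univ] at this
    simpa [mul_comm] using this

/-- Multiply the quotients `L_Q / M` over `Q ≠ P`, where the linear form `L_Q` vanishes at `Q` but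
not at `P`, and `M` vanishes nowhere on `S`. -/
theorem separate [Infinite F] (S : Finset X.Point) {P : X.Point} (hP : P ∈ S) :
    ∃ e, X.valuation P e = 1 ∧ ∀ Q ∈ S, Q ≠ P → X.valuation Q e < 1 := by
  classical
  obtain ⟨M, hM, hM0⟩ := exists_linear_form_eval_ne_zero (S.image Subtype.val)
  have hM0 : ∀ Q ∈ S, eval Q.1.rep M ≠ 0 := fun Q hQ => hM0 _ (Finset.mem_image_of_mem _ hQ)
  choose L hL hL0 hLP using fun Q : {Q : X.Point // Q ≠ P} =>
    exists_linear_form_eval_eq_zero (P := P.1) (Q := Q.1.1) fun h => Q.2 (Subtype.ext h)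
  let e : X.Point → X.Func := fun Q => if h : Q ≠ P then ratio _ (hL ⟨Q, h⟩) hM else 1
  have he : ∀ Q, ∀ R ∈ S, X.valuation R (e Q) ≤ 1 := fun Q R hR => by
    by_cases h : Q ≠ P
    · simpa only [e, dif_pos h] using valuation_ratio_le_one _ _ (hM0 R hR)
    · simp only [e, dif_neg h, map_one, le_refl]
  refine ⟨∏ Q ∈ S, e Q, ?_, fun Q hQ hne => ?_⟩
  · rw [map_prod]
    refine Finset.prod_eq_one fun Q _ => ?_
    by_cases h : Q ≠ P
    · simpa only [e, dif_pos h] using valuation_ratio_eq_one _ _ (hM0 P hP) (hLP ⟨Q, h⟩)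
    · simp only [e, dif_neg h, map_one]
  · rw [← Finset.mul_prod_erase S e hQ, map_mul, map_prod]
    have h1 : X.valuation Q (e Q) < 1 := by
      simpa only [e, dif_pos hne] using valuation_ratio_lt_one _ _ (hM0 Q hQ) (hL0 ⟨Q, hne⟩)
    have h2 : ∏ R ∈ S.erase Q, X.valuation Q (e R) ≤ 1 :=
      Finset.prod_le_one' fun R _ => he R Q hQ
    exact mul_lt_one_of_lt_of_le h1 h2

theorem adjoin_coord_eq_top {j : Fin (n + 1)} (hj : MvPolynomial.X j ∉ extend F X.ideal) :
    IntermediateField.adjoin F (Set.range fun i => coord (extend F X.ideal) i j) = ⊤ := by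
  rw [eq_top_iff]
  intro f _
  obtain ⟨d, G, H, hG, hH, -, hf⟩ := f.2
  have hf' : f = aeval (fun i => coord (extend F X.ideal) i j) G /
      aeval (fun i => coord (extend F X.ideal) i j) H :=
    Subtype.ext (hf.trans (frac_eq_aeval_div hG hH hj))
  have key : ∀ G : MvPolynomial (Fin (n + 1)) F, aeval (fun i => coord (extend F X.ideal) i j) G ∈
      IntermediateField.adjoin F (Set.range fun i => coord (extend F X.ideal) i j) := fun G => by
    apply IntermediateField.algebra_adjoin_le_adjoin
    rw [Algebra.adjoin_range_eq_range_aeval]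
    exact ⟨G, rfl⟩
  rw [hf']
  exact div_mem (key G) (key H)

/-- The function field is generated by the affine coordinates and has transcendence degree one, so
it is finitely generated and algebraic over `F(x)`. -/
theorem finiteDimensional {x : X.Func} (hx : Transcendental F x) : FiniteDimensional F⟮x⟯ X.Func := by
  obtain ⟨j, hj⟩ := exists_X_notMem (I := extend F X.ideal) (f := x) (by
    rintro ⟨c, rfl⟩
    exact hx (isAlgebraic_algebraMap c))
  have h1 : Algebra.EssFiniteType F X.Func := by
    rw [← IntermediateField.fg_top_iff, ← X.adjoin_coord_eq_top hj]
    exact IntermediateField.fg_adjoin_of_finite (Set.finite_range _)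
  have h2 : Algebra.EssFiniteType F⟮x⟯ X.Func := .of_comp F _ _
  have h3 : IsTranscendenceBasis F (fun _ : Unit => x) := by
    refine AlgebraicIndependent.isTranscendenceBasis_of_lift_trdeg_le_of_finite ?_ ?_
    · exact (algebraicIndependent_unique_type_iff (ι := Unit)).mpr hx
    · rw [X.trdeg_eq_one]; simp
  have h4 : Algebra.IsAlgebraic F⟮x⟯ X.Func := by
    have := h3.isAlgebraic_field
    rwa [Set.range_const] at this
  obtain ⟨s, hs⟩ := IntermediateField.fg_top_iff.mpr h2
  have h5 : FiniteDimensional F⟮x⟯ (IntermediateField.adjoin F⟮x⟯ (s : Set X.Func)) :=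
    IntermediateField.finiteDimensional_adjoin fun y _ => (h4.isAlgebraic y).isIntegral
  rw [hs] at h5
  exact IntermediateField.topEquiv.toLinearEquiv.finiteDimensional

/-- All quotients of two coordinates suffice: at `P` dehomogenize by a coordinate that does not
vanish there. -/
theorem exists_generators : ∃ T : Finset X.Func, ∀ P f, X.valuation P f ≤ 1 →
    ∃ a ∈ Algebra.adjoin F {u | u ∈ T ∧ X.valuation P u ≤ 1},
    ∃ b ∈ Algebra.adjoin F {u | u ∈ T ∧ X.valuation P u ≤ 1}, X.valuation P b = 1 ∧ f = a / b := by
  have hfin := Set.finite_range fun p : Fin (n + 1) × Fin (n + 1) => coord (extend F X.ideal) p.1 p.2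
  refine ⟨hfin.toFinset, fun P f hf => ?_⟩
  obtain ⟨d, G, H, hG, hH, h, rfl⟩ := exists_ratio_of_valuation_le_one hf
  obtain ⟨j, hj⟩ := exists_rep_ne_zero P
  have hjI := X_notMem hj
  have key : ∀ G : MvPolynomial (Fin (n + 1)) F, aeval (fun i => coord (extend F X.ideal) i j) G ∈
      Algebra.adjoin F {u | u ∈ hfin.toFinset ∧ X.valuation P u ≤ 1} := fun G => by
    refine Algebra.adjoin_mono (s := Set.range fun i => coord (extend F X.ideal) i j) ?_ ?_
    · rintro _ ⟨i, rfl⟩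
      exact ⟨hfin.mem_toFinset.mpr ⟨(i, j), rfl⟩, valuation_ratio_le_one _ _ (by simpa using hj)⟩
    · rw [Algebra.adjoin_range_eq_range_aeval]
      exact ⟨G, rfl⟩
  refine ⟨_, key G, _, key H, ?_, Subtype.ext (frac_eq_aeval_div hG hH hjI)⟩
  have hXd : (MvPolynomial.X j ^ d : MvPolynomial (Fin (n + 1)) F).IsHomogeneous d := by
    simpa using (isHomogeneous_X F j).pow d
  have he : aeval (fun i => coord (extend F X.ideal) i j) H = ratio _ hH hXd :=
    Subtype.ext (aeval_coord hH j)
  rw [he]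
  exact valuation_ratio_eq_one _ _ (by simp [hj]) h

theorem extend_le_ker_aeval_coord {j : Fin (n + 1)} :
    extend F X.ideal ≤ RingHom.ker (aeval fun i => coord (extend F X.ideal) i j) := by
  refine Ideal.map_le_iff_le_comap.mpr fun g hg => ?_
  rw [Ideal.mem_comap, RingHom.mem_ker, ← sum_homogeneousComponent g, map_sum, map_sum]
  refine Finset.sum_eq_zero fun d _ => Subtype.ext ?_
  rw [aeval_coord ((homogeneousComponent_isHomogeneous d g).map _), frac,
    Ideal.Quotient.eq_zero_iff_mem.mpr (Ideal.mem_map_of_mem _ (X.homogeneous g hg d)), map_zero,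
    zero_div]
  rfl

theorem mk_mem_zeroLocus {a : Fin (n + 1) → F} (ha : a ≠ 0)
    (h : extend F X.ideal ≤ RingHom.ker (eval a)) :
    Projectivization.mk F a ha ∈ zeroLocus (extend F X.ideal) := by
  obtain ⟨c, hc⟩ := Projectivization.exists_smul_eq_mk_rep F a ha
  suffices hle : extend F X.ideal ≤ RingHom.ker (eval (Projectivization.mk F a ha).rep) from
    fun g hg => hle hg
  refine Ideal.map_le_iff_le_comap.mpr fun g hg => ?_
  rw [Ideal.mem_comap, RingHom.mem_ker, ← sum_homogeneousComponent g, map_sum, map_sum]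
  refine Finset.sum_eq_zero fun d _ => ?_
  rw [← hc, Units.smul_def, eval_smul_of_isHomogeneous ((homogeneousComponent_isHomogeneous d g).map _)]
  have := h (Ideal.mem_map_of_mem (MvPolynomial.map (algebraMap k F)) (X.homogeneous g hg d))
  rw [RingHom.mem_ker.mp this, mul_zero]

/-- Every valuation ring of the function field has a centre on the curve. -/
theorem exists_localRing_le [IsAlgClosed F] (V : ValuationSubring X.Func)
    (hV : ∀ c, algebraMap F X.Func c ∈ V) {j₀ : Fin (n + 1)}
    (hj₀ : MvPolynomial.X j₀ ∉ extend F X.ideal) :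
    ∃ Q : X.Point, ∀ f ∈ localRing (extend F X.ideal) Q, f ∈ V := by
  -- For the coordinate of largest value all quotients by it lie in `V`.
  obtain ⟨j, -, hj⟩ := Finset.exists_max_image Finset.univ
    (fun j => V.valuation (coord (extend F X.ideal) j j₀)) ⟨j₀, Finset.mem_univ _⟩
  have hjI : MvPolynomial.X j ∉ extend F X.ideal := fun hm => by
    have := hj j₀ (Finset.mem_univ _)
    rw [coord_eq_zero hm, coord_self hj₀, map_zero, map_one] at this
    exact one_ne_zero (le_zero_iff.mp this)
  have hmem : ∀ i, coord (extend F X.ideal) i j ∈ V := fun i => by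
    have h1 := hj i (Finset.mem_univ _)
    rw [← coord_mul_coord i hjI j₀, map_mul] at h1
    have h2 : V.valuation (coord (extend F X.ideal) j j₀) ≠ 0 := by
      rw [Valuation.ne_zero_iff]
      intro h0
      have := coord_mul_coord j₀ hjI j₀
      rw [h0, mul_zero, coord_self hj₀] at this
      exact zero_ne_one this
    rw [← V.valuation_le_one_iff]
    exact (mul_le_iff_le_one_left (zero_lt_iff.mpr h2)).mp h1
  let θ : MvPolynomial (Fin (n + 1)) F →+* V :=
    (aeval (R := F) fun i => coord (extend F X.ideal) i j).toRingHom.codRestrict V.toSubring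
      fun G => by
        induction G using MvPolynomial.induction_on with
        | C c => simpa using hV c
        | add p q hp hq => rw [map_add]; exact add_mem hp hq
        | mul_X p i hp => rw [map_mul]; exact mul_mem hp (by simpa using hmem i)
  have hθ : ∀ G, (θ G : X.Func) = aeval (fun i => coord (extend F X.ideal) i j) G := fun G => rfl
  -- By the Nullstellensatz a maximal ideal containing the preimage of the maximal ideal of `V` is a
  -- point `a`, the centre. Polynomials nonzero at `a` become units of `V`, and `a ≠ 0` because its
  -- `j`-th coordinate is `1`.
  obtain ⟨m, hm, hle⟩ := Ideal.exists_le_maximal ((IsLocalRing.maximalIdeal V).comap θ)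
    (Ideal.comap_ne_top _ Ideal.IsPrime.ne_top')
  obtain ⟨a, rfl⟩ := (isMaximal_iff_eq_vanishingIdeal_singleton (K := F)).mp hm
  have hker : ∀ G, θ G ∈ IsLocalRing.maximalIdeal V → eval a G = 0 := fun G hG => by
    have := hle (Ideal.mem_comap.mpr hG)
    rwa [mem_vanishingIdeal_singleton_iff, aeval_eq_eval] at this
  have ha : a ≠ 0 := by
    rintro rfl
    have h1 : θ (MvPolynomial.X j - 1) = 0 := by
      refine Subtype.ext ?_
      rw [hθ, map_sub, aeval_X, coord_self hjI, map_one, sub_self]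
      rfl
    have := hker _ (h1 ▸ zero_mem _)
    simp at this
  have hI : extend F X.ideal ≤ RingHom.ker (eval a) := fun G hG => by
    refine RingHom.mem_ker.mpr (hker G ?_)
    have h1 : θ G = 0 := Subtype.ext (RingHom.mem_ker.mp (X.extend_le_ker_aeval_coord hG))
    exact h1 ▸ zero_mem _
  refine ⟨⟨_, X.mk_mem_zeroLocus ha hI⟩, fun f hf => ?_⟩
  obtain ⟨d, G, H, hG, hH, h, he⟩ := hf
  obtain ⟨c, hc⟩ := Projectivization.exists_smul_eq_mk_rep F a ha
  have hHa : eval a H ≠ 0 := fun h0 => h <| by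
    change eval (Projectivization.mk F a ha).rep H = 0
    rw [← hc, Units.smul_def, eval_smul_of_isHomogeneous hH, h0, mul_zero]
  have hu : IsUnit (θ H) := by
    by_contra hu
    exact hHa (hker H hu)
  obtain ⟨u, hu⟩ := hu
  have hf : f = θ G * (u⁻¹ : Vˣ) := by
    refine Subtype.ext (he.trans ?_)
    rw [frac_eq_aeval_div hG hH hjI, ← hθ, ← hθ, ← hu]
    congr 1
    rw [div_eq_mul_inv]
    congr 1
    refine inv_eq_of_mul_eq_one_right ?_
    exact congr(($(u.mul_inv) : X.Func))
  rw [hf]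
  exact mul_mem (θ G).2 (u⁻¹ : Vˣ).1.2

/-- A nonconstant `f` is not integral over `F`, so some valuation ring containing the constants
omits it. That ring contains the local ring of a point, where `f` cannot be regular. -/
theorem mem_range_of_valuation_le_one [IsAlgClosed F] {f : X.Func} (hf : ∀ P, X.valuation P f ≤ 1) :
    f ∈ Set.range (algebraMap F X.Func) := by
  by_contra hc
  obtain ⟨j, hj⟩ := exists_X_notMem (I := extend F X.ideal) hc
  have hint : f ∉ (integralClosure F X.Func).toSubring := fun h =>
    (transcendental_or_mem_range (F := F) f).elim (fun h' => h' (IsIntegral.isAlgebraic h)) hc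
  obtain ⟨V, hV, hfV⟩ := Subring.exists_le_valuationSubring_of_isIntegrallyClosedIn hint
  obtain ⟨Q, hQ⟩ := X.exists_localRing_le V (fun c => hV (isIntegral_algebraMap (x := c))) hj
  exact hfV (hQ f ((X.valuation_le_one_iff Q f).mp (hf Q)))

theorem isPlaceSystem [IsAlgClosed F] : IsPlaceSystem F fun P : X.Point => X.valuation P where
  const P c := ordGE_zero_iff.mpr (X.valuation_algebraMap_le_one P c)
  residue P f hf := by
    obtain ⟨c, hc⟩ := X.residue P (ordGE_zero_iff.mp hf)
    exact ⟨c, ordGE_one_iff.mpr hc⟩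
  uniformizer := X.exists_uniformizer
  separate S P hP := by
    have : Infinite F := IsAlgClosed.instInfinite
    simpa only [ordGE_one_iff] using X.separate S hP
  mem_range f hf := X.mem_range_of_valuation_le_one fun P => ordGE_zero_iff.mp (hf P)
  finite _ hx := X.finiteDimensional hx
  generators := by simpa only [ordGE_zero_iff] using X.exists_generators

end Curve

namespace Curve

open MvPolynomial

variable {k F : Type*} [Field k] [Field F] [Algebra k F] {n : ℕ} (X : Curve k F n)

/-! ### Rational points and the Frobenius morphism -/

theorem ordGE_aeval_sub {P : X.Point} {σ : Type*} {y : σ → X.Func} {a : σ → F} {m : ℤ}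
    (hy : ∀ i, OrdGE (X.valuation P) 0 (y i))
    (h : ∀ i, OrdGE (X.valuation P) m (y i - algebraMap F X.Func (a i)))
    (p : MvPolynomial σ F) :
    OrdGE (X.valuation P) m (aeval y p - algebraMap F X.Func (eval a p)) := by
  induction p using MvPolynomial.induction_on with
  | C c => simpa using OrdGE.zero m
  | add p q hp hq =>
    have := hp.add hq
    simp only [map_add]
    convert this using 1
    ring
  | mul_X p i hp =>
    have h1 := hp.mul_right (hy i)
    have h2 : OrdGE (X.valuation P) m (algebraMap F X.Func (eval a p) *
        (y i - algebraMap F X.Func (a i))) :=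
      OrdGE.mul_left (ordGE_zero_iff.mpr (X.valuation_algebraMap_le_one P _)) (h i)
    have := h1.add h2
    simp only [map_mul, aeval_X, eval_X]
    convert this using 1
    ring

theorem exists_rep_eq_smul {P : X.Point} (hP : P ∈ X.rationalPoints) :
    ∃ (c : F) (v : Fin (n + 1) → k), P.1.rep = c • fun i => algebraMap k F (v i) := by
  obtain ⟨v, hv, he⟩ := hP
  obtain ⟨c, hc⟩ := Projectivization.exists_smul_eq_mk_rep F _ hv
  exact ⟨c, v, by rw [he, ← hc]; rfl⟩

section

variable [Fintype k]

/-- The chosen representative is only proportional to a vector over `k`, so Frobenius fixes it up to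
a scalar. -/
theorem pow_card_eq_smul {P : X.Point} (hP : P ∈ X.rationalPoints) :
    ∃ c : F, c ≠ 0 ∧ (fun i => P.1.rep i ^ Fintype.card k) = c • P.1.rep := by
  obtain ⟨c, v, hv⟩ := X.exists_rep_eq_smul hP
  have hc : c ≠ 0 := by
    rintro rfl
    exact P.1.rep_nonzero (by rw [hv, zero_smul])
  refine ⟨c ^ (Fintype.card k - 1), pow_ne_zero _ hc, funext fun i => ?_⟩
  simp only [hv, Pi.smul_apply, smul_eq_mul, mul_pow, ← map_pow, FiniteField.pow_card]
  rw [← mul_assoc, ← pow_succ, Nat.sub_add_cancel Fintype.card_pos]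

variable [Algebra.IsAlgebraic k F]

theorem frobeniusPullback_of_mem_rationalFunctions {f : X.Func} (hf : f ∈ X.rationalFunctions) :
    frobeniusPullback X.ideal f = f ^ Fintype.card k := by
  obtain ⟨d, G, H, -, -, -, he⟩ := hf
  refine Subtype.ext ?_
  change frobeniusFrac X.ideal f.1 = f.1 ^ Fintype.card k
  rw [he, frobeniusFrac_frac, expand_map_algebraMap, expand_map_algebraMap, frac, frac, map_pow,
    map_pow, map_pow, map_pow, div_pow]

theorem valuation_frobeniusPullback_le_one {P : X.Point} (hP : P ∈ X.rationalPoints) {f : X.Func}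
    (hf : X.valuation P f ≤ 1) : X.valuation P (frobeniusPullback X.ideal f) ≤ 1 := by
  obtain ⟨d, G, H, hG, hH, h, he⟩ := (X.valuation_le_one_iff P f).mp hf
  obtain ⟨c, hc, hPc⟩ := X.pow_card_eq_smul hP
  have hom : ∀ {G : MvPolynomial (Fin (n + 1)) F}, G.IsHomogeneous d →
      (expand (Fintype.card k) G).IsHomogeneous (Fintype.card k * d) := fun hG =>
    hG.aeval _ fun i => by simpa using (isHomogeneous_X F i).pow (Fintype.card k)
  refine (X.valuation_le_one_iff P _).mpr ⟨_, _, _, hom hG, hom hH, ?_, ?_⟩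
  · rw [eval_expand]
    change eval (fun i => P.1.rep i ^ Fintype.card k) H ≠ 0
    rw [hPc, eval_smul_of_isHomogeneous hH]
    exact mul_ne_zero (pow_ne_zero _ hc) h
  · change frobeniusFrac X.ideal f.1 = _
    rw [he, frobeniusFrac_frac]

end

/-- The functions `x_i / x_j - a_i`, with `a_i ∈ k` the affine coordinates of `P`, are defined over
`k` and vanish at `P`. If none were a uniformizer, all would vanish to order two, and then so would
every function that vanishes at `P`. -/
theorem exists_uniformizer_mem_rationalFunctions {P : X.Point} (hP : P ∈ X.rationalPoints) :
    ∃ t ∈ X.rationalFunctions, X.valuation P t = exp (-1) := by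
  obtain ⟨c, v, hv⟩ := X.exists_rep_eq_smul hP
  have hc : c ≠ 0 := by
    rintro rfl
    exact P.1.rep_nonzero (by rw [hv, zero_smul])
  obtain ⟨j, hj⟩ := exists_rep_ne_zero P
  have hjI := X_notMem hj
  have hvj : v j ≠ 0 := fun h0 => hj (by simp [hv, h0])
  let a : Fin (n + 1) → k := fun i => v i / v j
  have hrep : P.1.rep = P.1.rep j • fun i => algebraMap k F (a i) := by
    funext i
    simp only [hv, a, Pi.smul_apply, smul_eq_mul, map_div₀]
    field_simp [(map_ne_zero (algebraMap k F)).mpr hvj]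
  have hom : ∀ i, (MvPolynomial.X i - C (a i) * MvPolynomial.X j).IsHomogeneous 1 := fun i => by
    refine (isHomogeneous_X k i).sub ?_
    simpa using (isHomogeneous_C (Fin (n + 1)) _).mul (isHomogeneous_X k j)
  let t : Fin (n + 1) → X.Func := fun i =>
    coord (extend F X.ideal) i j - algebraMap F X.Func (algebraMap k F (a i))
  have ht : ∀ i, t i = ratio _ ((hom i).map (algebraMap k F)) (isHomogeneous_X F j) := fun i => by
    refine Subtype.ext ?_
    change frac _ _ _ - algebraMap F _ _ = frac _ _ _
    have h0 := toFrac_ne_zero hjI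
    rw [← frac_C, frac, frac, frac, map_one, map_one, div_one, map_sub, map_mul, map_X, map_X,
      map_C, map_sub, map_mul, map_sub, map_mul, sub_div, mul_div_cancel_right₀ _ h0]
  have htr : ∀ i, t i ∈ X.rationalFunctions := fun i =>
    ⟨1, _, MvPolynomial.X j, hom i, isHomogeneous_X k j, by rwa [map_X], by rw [ht, map_X]; rfl⟩
  by_contra! hne
  have hcoord : ∀ i, OrdGE (X.valuation P) 0 (coord (extend F X.ideal) i j) := fun i =>
    ordGE_zero_iff.mpr (valuation_ratio_le_one _ _ (by simpa using hj))
  have h2 : ∀ i, OrdGE (X.valuation P) 2 (t i) := fun i => by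
    have h1 : OrdGE (X.valuation P) 1 (t i) := by
      rw [ordGE_one_iff, ht]
      refine valuation_ratio_lt_one _ _ (by simpa using hj) ?_
      have := congrFun hrep i
      simp only [Pi.smul_apply, smul_eq_mul] at this
      simp [this, mul_comm]
    by_contra h2
    exact hne _ (htr i) (eq_exp_neg_iff.mpr ⟨h1, h2⟩)
  obtain ⟨π, hπ⟩ := X.exists_uniformizer P
  have hπ1 := (eq_exp_neg_iff.mp hπ).1
  obtain ⟨d, G, H, hG, hH, h, rfl⟩ :=
    exists_ratio_of_valuation_le_one (ordGE_zero_iff.mp (hπ1.mono zero_le_one))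
  have hGP : eval P.1.rep G = 0 := by
    by_contra h0
    rw [ordGE_one_iff, valuation_ratio_eq_one hG hH h h0] at hπ1
    exact lt_irrefl _ hπ1
  have hGa : eval (fun i => algebraMap k F (a i)) G = 0 := by
    rw [hrep, eval_smul_of_isHomogeneous hG] at hGP
    exact (mul_eq_zero.mp hGP).resolve_left (pow_ne_zero _ hj)
  have h3 := X.ordGE_aeval_sub hcoord h2 G
  rw [hGa, map_zero, sub_zero] at h3
  have hXd : (MvPolynomial.X j ^ d : MvPolynomial (Fin (n + 1)) F).IsHomogeneous d := by
    simpa using (isHomogeneous_X F j).pow d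
  have he : aeval (fun i => coord (extend F X.ideal) i j) H = ratio _ hH hXd :=
    Subtype.ext (aeval_coord hH j)
  have hH1 : X.valuation P (aeval (fun i => coord (extend F X.ideal) i j) H) = 1 := by
    rw [he]
    exact valuation_ratio_eq_one _ _ (by simp [hj]) h
  have heq : ratio (extend F X.ideal) hG hH = aeval (fun i => coord (extend F X.ideal) i j) G /
      aeval (fun i => coord (extend F X.ideal) i j) H :=
    Subtype.ext (frac_eq_aeval_div hG hH hjI)
  refine (eq_exp_neg_iff.mp hπ).2 ?_
  rw [OrdGE, heq, map_div₀, hH1, div_one]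
  exact h3

end Curve

namespace Curve

variable {k F : Type*} [Field k] [Field F] [Algebra k F] {n : ℕ} (X : Curve k F n)

/-! ### The bound for the number of rational points -/

theorem riemannRochSpace_eq_rr (h : IsPlaceSystem F fun P : X.Point => X.valuation P) (D : X.Div) :
    X.riemannRochSpace D = h.rr D := by
  ext f
  rw [h.mem_rr]
  change (f ≠ 0 → ∀ P, 0 ≤ D P + X.ord P f) ↔ _
  simp only [OrdGE, neg_neg, ← X.ord_iff]
  tauto

/-- A supremum of integers is an upper bound only if the set is bounded, which is Riemann's
inequality. -/
theorem degree_add_one_sub_finrank_le_genus [IsAlgClosed F] {x : X.Func} (hx : Transcendental F x)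
    (D : X.Div) : X.degree D + 1 - Module.finrank F (X.riemannRochSpace D) ≤ X.genus := by
  obtain ⟨C, hC⟩ := X.isPlaceSystem.riemann hx
  refine le_ciSup (f := fun D : X.Div =>
    X.degree D + 1 - (Module.finrank F (X.riemannRochSpace D) : ℤ)) ⟨C + 1, ?_⟩ D
  rintro _ ⟨D, rfl⟩
  have := hC D
  rw [← X.riemannRochSpace_eq_rr] at this
  change D.degree + 1 - _ ≤ _
  linarith

theorem degree_eq_of_mem_linearSeries [IsAlgClosed F] {E D : X.Div} {V : Submodule F X.Func}
    (hD : D ∈ X.linearSeries E V) : X.degree D = X.degree E := by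
  obtain ⟨f, -, hf, hP⟩ := hD
  have : D = E + X.isPlaceSystem.divisor f := Finsupp.ext hP
  have h1 : D.degree = E.degree := by
    rw [this, map_add, X.isPlaceSystem.degree_divisor hf, add_zero]
  exact h1

theorem linearSeries_nonempty [IsAlgClosed F] (E : X.Div) {V : Submodule F X.Func} {f : X.Func}
    (hf : f ∈ V) (hf0 : f ≠ 0) : (X.linearSeries E V).Nonempty :=
  ⟨E + X.isPlaceSystem.divisor f, f, hf, hf0, fun _ => rfl⟩

/-- At a point that is not a base point, some element of a spanning family attains the minimal
order. -/
theorem exists_ord_eq_neg {E : X.Div} {α : Type*} {f : α → X.Func}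
    (hf : Submodule.span F (Set.range f) ≤ X.riemannRochSpace E)
    (hbpf : X.BasePointFree (X.linearSeries E (Submodule.span F (Set.range f)))) (P : X.Point) :
    ∃ j, f j ≠ 0 ∧ X.ord P (f j) = -E P := by
  obtain ⟨D, ⟨g, hg, hg0, hD⟩, hDP⟩ := hbpf P
  have hmem : ∀ j, f j ≠ 0 → 0 ≤ E P + X.ord P (f j) := fun j hj =>
    hf (Submodule.subset_span ⟨j, rfl⟩) hj P
  by_contra! hc
  -- If all the spanning functions had larger order at `P`, so would the whole span, and `P` would
  -- be a base point.
  have hge : ∀ g ∈ Submodule.span F (Set.range f), OrdGE (X.valuation P) (-E P + 1) g := by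
    intro g hg
    induction hg using Submodule.span_induction with
    | mem g hg =>
      obtain ⟨j, rfl⟩ := hg
      by_cases h0 : f j = 0
      · rw [h0]; exact OrdGE.zero _
      · rw [ordGE_iff h0]
        have h1 := hmem j h0
        have h2 := hc j h0
        change _ ≤ X.ord P (f j)
        omega
    | zero => exact OrdGE.zero _
    | add a b _ _ ha hb => exact ha.add hb
    | smul c a _ ha =>
      rw [Algebra.smul_def]
      exact OrdGE.mul_left (ordGE_zero_iff.mpr (X.valuation_algebraMap_le_one P c)) ha
  have h1 : _ ≤ X.ord P g := (ordGE_iff hg0).mp (hge g hg)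
  have h2 := hD P
  omega

theorem mul_card_rationalPoints_le [Fintype k] [IsAlgClosed F] [Algebra.IsAlgebraic k F] {r : ℕ}
    {d : ℤ} {𝒟 : Set X.Div} (h𝒟 : X.IsLinearSeries 𝒟 r d) (hbpf : X.BasePointFree 𝒟)
    {ν : Fin r → ℕ} (hν : X.IsFrobeniusOrders 𝒟 ν) :
    r * (X.rationalPoints.ncard : ℤ) ≤
      (∑ i, (ν i : ℤ)) * (2 * X.genus - 2) + (Fintype.card k + r) * d := by
  obtain ⟨E₀, V₀, -, rfl, -, hV₀⟩ := h𝒟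
  obtain ⟨E, f, x, hx, hfr, hli, hfE, hD, hmin⟩ := hν
  -- The divisors in the two descriptions of the series may differ, but both have the degree of a
  -- common member.
  have hdeg : X.degree E₀ = X.degree E := by
    obtain ⟨D, hD'⟩ := X.linearSeries_nonempty E
      (Submodule.subset_span (Set.mem_range_self 0) : f 0 ∈ _) (hli.ne_zero 0)
    rw [← X.degree_eq_of_mem_linearSeries hD']
    exact (X.degree_eq_of_mem_linearSeries (hV₀ ▸ hD ▸ hD')).symm
  -- The pullback of a function in `k(X)` is its `q`-th power, so the Frobenius row consists of the
  -- `f j ^ q`.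
  have hset : X.frobeniusOrderSet x hx f = minorSet (fun j => f j ^ Fintype.card k) fun m j =>
      PowerSeries.coeff m ((exists_isTaylorHom F x hx).choose (f j)) := by
    simp only [frobeniusOrderSet, frobeniusMatrix,
      fun j => X.frobeniusPullback_of_mem_rationalFunctions (hfr j)]
    rfl
  rw [hset] at hmin
  rw [hdeg, Set.ncard_eq_toFinset_card _ X.rationalPoints_finite]
  refine X.isPlaceSystem.card_fixed_le hx (exists_isTaylorHom F x hx).choose_spec
    Fintype.one_lt_card f hmin E (fun P j => ?_)
    (X.exists_ord_eq_neg hfE (hD ▸ hbpf)) (frobeniusPullback X.ideal)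
    (fun j => X.frobeniusPullback_of_mem_rationalFunctions (hfr j)) _ (fun P hP => ?_) fun A => ?_
  · have := hfE (Submodule.subset_span ⟨j, rfl⟩)
    rw [X.riemannRochSpace_eq_rr X.isPlaceSystem] at this
    exact this P
  · rw [Set.Finite.mem_toFinset] at hP
    refine ⟨fun g hg => ordGE_zero_iff.mpr
      (X.valuation_frobeniusPullback_le_one hP (ordGE_zero_iff.mp hg)), ?_⟩
    obtain ⟨t, ht, htv⟩ := X.exists_uniformizer_mem_rationalFunctions hP
    exact ⟨t, htv, X.frobeniusPullback_of_mem_rationalFunctions ht⟩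
  · rw [← X.riemannRochSpace_eq_rr]
    exact X.degree_add_one_sub_finrank_le_genus hx.transcendental A

end Curve

end StohrVoloch

theorem theorem3p1 {k F : Type*} [Field k] [Fintype k] [Field F] [Algebra k F] [IsAlgClosure k F]
    {n : ℕ} (X : StohrVoloch.Curve k F n) (r : ℕ) (hr : 1 ≤ r) (d : ℤ) (𝒟 : Set X.Div)
    (h𝒟 : X.IsLinearSeries 𝒟 r d) (hbpf : X.BasePointFree 𝒟) (hdef : X.IsDefinedOver 𝒟)
    (ν : Fin r → ℕ) (hν : X.IsFrobeniusOrders 𝒟 ν) :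
    (X.rationalPoints.ncard : ℚ) ≤
      ((∑ i, (ν i : ℚ)) * (2 * X.genus - 2) + (Fintype.card k + r) * d) / r := by
  have : IsAlgClosed F := IsAlgClosure.isAlgClosed k
  have hr0 : (0 : ℚ) < r := mod_cast hr
  rw [le_div_iff₀' hr0]
  exact_mod_cast X.mul_card_rationalPoints_le h𝒟 hbpf hν
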